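/- Let $(F^{2n-2},\omega_F,Z_F,\psi_F)$, $n\ge 1$, be a Weinstein manifold: $F$ is a smooth manifold without boundary, $\omega_F$ a symplectic form on $F$, $\psi_F\colon F\to\mathbb{R}$ an exhausting (proper and bounded below) Morse function and $Z_F$ a complete Liouville vector field for $\omega_F$ (that is, $\mathcal{L}_{Z_F}\omega_F=\omega_F$) which is gradient-like for $\psi_F$ (that is, $d\psi_F(Z_F)\ge\delta\,(|Z_F|^2+|d\psi_F|^2)$ for some Riemannian metric and some positive continuous function $\delta$). Suppose that there is an almost complex structure $J_F$ on $F$, tamed by $\omega_F$, such that $(TF,J_F)$ is trivial as a complex vector bundle. Let $\psi(q,z)=\psi_F(q)+|z|^2$ on $F\times\mathbb{C}$, let $c>\min\psi_F$ be a regular value of $\psi$, and let $W=\psi^{-1}((-\infty,c])$. On $F\times\mathbb{C}\times\mathbb{R}\times\mathbb{S}^1$, with coordinates $(q,z=re^{i\varphi},s,\theta)$, consider $$\omega'=\omega_F+r\,dr\wedge d\varphi+2\,ds\wedge d\theta,\qquad Z'=Z_F+\tfrac12 r\partial_r+s\partial_s,\qquad \psi'(q,z,s,\theta)=\psi(q,z)+s^2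 .$$ Let $V=(\psi')^{-1}(c)$, which is the product $\mathcal{D}W\times\mathbb{S}^1$ of the double $\mathcal{D}W=\{(p,s)\in (F\times\mathbb{C})\times\mathbb{R} : \psi(p)+s^2=c\}$ of $W$ with the circle, equipped with the contact structure $\xi=\ker\alpha$, $\alpha=(\iota_{Z'}\omega')|_V$. Let $\Psi$ be the diffeomorphism of $V$ given by $\Psi(q,z,s,\theta)=(q,e^{i\theta}z,s,\theta)$. Then $\Psi$ is smoothly isotopic to a contactomorphism $\Psi_c$ of $(V,\xi)$ such that, for each integer $k\neq0$, the iterate $\Psi_c^k$ is not contact-isotopic to the identity (that is, not joined to the identity by a smooth isotopy through contactomorphisms of $(V,\xi)$). -/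

import Mathlib

open scoped Manifold ContDiff Topology

noncomputable section

namespace WeinsteinStab

/-! ### Differential forms, vector fields and Weinstein structures on a boundaryless manifold -/

section Weinstein

variable {E : Type*} [NormedAddCommGroup E] [NormedSpace ℝ E]
  {F : Type*} [TopologicalSpace F] [ChartedSpace E F]

/-- The expression of a 1-form `lam` in the preferred chart at `x`, i.e. its pull-back to the model
space by the inverse of that chart. -/
def chartOneForm (lam : ∀ q : F, TangentSpace 𝓘(ℝ, E) q →L[ℝ] ℝ) (x : F) (y : E) : E →L[ℝ] ℝ :=
  ContinuousLinearMap.comp (lam ((extChartAt 𝓘(ℝ, E) x).symm y) : E →L[ℝ] ℝ)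
    (mfderiv 𝓘(ℝ, E) 𝓘(ℝ, E) (extChartAt 𝓘(ℝ, E) x).symm y : E →L[ℝ] E)

/-- The expression of a bilinear form `om` in the preferred chart at `x`. -/
def chartTwoForm
    (om : ∀ q : F, TangentSpace 𝓘(ℝ, E) q →L[ℝ] TangentSpace 𝓘(ℝ, E) q →L[ℝ] ℝ) (x : F) (y : E) :
    E →L[ℝ] E →L[ℝ] ℝ :=
  let A : E →L[ℝ] E := mfderiv 𝓘(ℝ, E) 𝓘(ℝ, E) (extChartAt 𝓘(ℝ, E) x).symm y
  let B : E →L[ℝ] E →L[ℝ] ℝ := om ((extChartAt 𝓘(ℝ, E) x).symm y)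
  B.bilinearComp A A

/-- The exterior derivative of a 1-form at `x`, computed in the preferred chart at `x` (the tangent
space at `x` is identified with the model space by this very chart):
`dλ(u,v) = ∂_u λ(v) - ∂_v λ(u)`. -/
def extDerivOne (lam : ∀ q : F, TangentSpace 𝓘(ℝ, E) q →L[ℝ] ℝ) (x : F)
    (u v : TangentSpace 𝓘(ℝ, E) x) : ℝ :=
  fderiv ℝ (chartOneForm lam x) (extChartAt 𝓘(ℝ, E) x x) u v
    - fderiv ℝ (chartOneForm lam x) (extChartAt 𝓘(ℝ, E) x x) v u

/-- The exterior derivative of a 2-form at `x`: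
`dω(u,v,w) = ∂_u ω(v,w) + ∂_v ω(w,u) + ∂_w ω(u,v)`. -/
def extDerivTwo
    (om : ∀ q : F, TangentSpace 𝓘(ℝ, E) q →L[ℝ] TangentSpace 𝓘(ℝ, E) q →L[ℝ] ℝ) (x : F)
    (u v w : TangentSpace 𝓘(ℝ, E) x) : ℝ :=
  fderiv ℝ (chartTwoForm om x) (extChartAt 𝓘(ℝ, E) x x) u v w
    + fderiv ℝ (chartTwoForm om x) (extChartAt 𝓘(ℝ, E) x x) v w u
    + fderiv ℝ (chartTwoForm om x) (extChartAt 𝓘(ℝ, E) x x) w u v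

/-- A symplectic form: a smooth, alternating, nondegenerate, closed 2-form. -/
structure IsSymplecticForm [IsManifold 𝓘(ℝ, E) ∞ F]
    (om : ∀ q : F, TangentSpace 𝓘(ℝ, E) q →L[ℝ] TangentSpace 𝓘(ℝ, E) q →L[ℝ] ℝ) : Prop where
  smooth : ContMDiff 𝓘(ℝ, E) (𝓘(ℝ, E).prod 𝓘(ℝ, E →L[ℝ] E →L[ℝ] ℝ)) ∞
    (fun q ↦ Bundle.TotalSpace.mk' (E →L[ℝ] E →L[ℝ] ℝ)
      (E := fun q : F ↦ TangentSpace 𝓘(ℝ, E) q →L[ℝ] TangentSpace 𝓘(ℝ, E) q →L[ℝ] ℝ) q (om q))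
  alternating : ∀ (q : F) (v : TangentSpace 𝓘(ℝ, E) q), om q v v = 0
  nondegenerate : ∀ (q : F) (v : TangentSpace 𝓘(ℝ, E) q), (∀ w, om q v w = 0) → v = 0
  closed : ∀ (q : F) (u v w : TangentSpace 𝓘(ℝ, E) q), extDerivTwo om q u v w = 0

/-- The vector field `Z` is complete: its flow is defined for all times. -/
def IsCompleteVectorField (Z : ∀ q : F, TangentSpace 𝓘(ℝ, E) q) : Prop :=
  ∀ q : F, ∃ γ : ℝ → F, γ 0 = q ∧ IsMIntegralCurve (I := 𝓘(ℝ, E)) γ Z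

/-- `psi` is a Morse function: it is smooth and at each critical point its Hessian (the second
derivative in the preferred chart at this point) is nondegenerate. -/
def IsMorseFunction (psi : F → ℝ) : Prop :=
  ContMDiff 𝓘(ℝ, E) 𝓘(ℝ, ℝ) ∞ psi ∧
  ∀ q : F, mfderiv 𝓘(ℝ, E) 𝓘(ℝ, ℝ) psi q = 0 →
    ∀ u : E, (∀ v : E, fderiv ℝ (fderiv ℝ (psi ∘ (extChartAt 𝓘(ℝ, E) q).symm))
      (extChartAt 𝓘(ℝ, E) q q) u v = 0) → u = 0

/-- `psi` is exhausting: proper and bounded from below. -/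
def IsExhausting (psi : F → ℝ) : Prop :=
  IsProperMap psi ∧ BddBelow (Set.range psi)

/-- `Z` is gradient-like for `psi`: there are a Riemannian metric `g` and a positive continuous
function `δ` with `dψ(Z) ≥ δ (|Z|² + |dψ|²)`. Here `|dψ|` is the norm of the `g`-gradient `G`
of `psi`. -/
def IsGradientLike [IsManifold 𝓘(ℝ, E) ∞ F] (Z : ∀ q : F, TangentSpace 𝓘(ℝ, E) q)
    (psi : F → ℝ) : Prop :=
  ∃ (g : Bundle.ContMDiffRiemannianMetric 𝓘(ℝ, E) ∞ E (fun q : F ↦ TangentSpace 𝓘(ℝ, E) q))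
    (δ : F → ℝ) (G : ∀ q : F, TangentSpace 𝓘(ℝ, E) q),
    Continuous δ ∧ (∀ q, 0 < δ q) ∧
    (∀ q v, g.inner q (G q) v = mfderiv 𝓘(ℝ, E) 𝓘(ℝ, ℝ) psi q v) ∧
    ∀ q, δ q * (g.inner q (Z q) (Z q) + g.inner q (G q) (G q))
      ≤ (mfderiv 𝓘(ℝ, E) 𝓘(ℝ, ℝ) psi q (Z q) : ℝ)

/-- A Weinstein structure `(ω, Z, ψ)`: a symplectic form, a complete Liouville vector field and an
exhausting Morse function for which the vector field is gradient-like. (As `ω` is closed, the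
Liouville condition `L_Z ω = ω` reads `d(ι_Z ω) = ω`.) -/
structure IsWeinstein [IsManifold 𝓘(ℝ, E) ∞ F]
    (om : ∀ q : F, TangentSpace 𝓘(ℝ, E) q →L[ℝ] TangentSpace 𝓘(ℝ, E) q →L[ℝ] ℝ)
    (Z : ∀ q : F, TangentSpace 𝓘(ℝ, E) q) (psi : F → ℝ) : Prop where
  symplectic : IsSymplecticForm om
  smooth_field : ContMDiff 𝓘(ℝ, E) 𝓘(ℝ, E).tangent ∞
    (fun q ↦ (⟨q, Z q⟩ : TangentBundle 𝓘(ℝ, E) F))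
  liouville : ∀ (q : F) (u v : TangentSpace 𝓘(ℝ, E) q),
    extDerivOne (fun p ↦ om p (Z p)) q u v = om q u v
  complete : IsCompleteVectorField Z
  exhausting : IsExhausting psi
  morse : IsMorseFunction (E := E) psi
  gradientLike : IsGradientLike Z psi

/-- A smooth almost complex structure on `F`. -/
structure IsAlmostComplex [IsManifold 𝓘(ℝ, E) ∞ F]
    (J : ∀ q : F, TangentSpace 𝓘(ℝ, E) q →L[ℝ] TangentSpace 𝓘(ℝ, E) q) : Prop where
  smooth : ContMDiff 𝓘(ℝ, E).tangent 𝓘(ℝ, E).tangent ∞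
    (fun v : TangentBundle 𝓘(ℝ, E) F ↦ (⟨v.1, J v.1 v.2⟩ : TangentBundle 𝓘(ℝ, E) F))
  sq : ∀ (q : F) (v : TangentSpace 𝓘(ℝ, E) q), J q (J q v) = -v

/-- `J` is tamed by `om`. -/
def IsTamed (om : ∀ q : F, TangentSpace 𝓘(ℝ, E) q →L[ℝ] TangentSpace 𝓘(ℝ, E) q →L[ℝ] ℝ)
    (J : ∀ q : F, TangentSpace 𝓘(ℝ, E) q →L[ℝ] TangentSpace 𝓘(ℝ, E) q) : Prop :=
  ∀ (q : F) (v : TangentSpace 𝓘(ℝ, E) q), v ≠ 0 → 0 < om q v (J q v)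

/-- `(TF, J)` is trivial as a complex vector bundle of rank `m`: there is a map `TF → ℂᵐ`,
continuous on the total space, which is a complex linear isomorphism on each tangent space. -/
def IsComplexTrivial [IsManifold 𝓘(ℝ, E) ∞ F] (m : ℕ)
    (J : ∀ q : F, TangentSpace 𝓘(ℝ, E) q →L[ℝ] TangentSpace 𝓘(ℝ, E) q) : Prop :=
  ∃ ν : ∀ q : F, TangentSpace 𝓘(ℝ, E) q ≃ₗ[ℝ] (Fin m → ℂ),
    Continuous (fun v : TangentBundle 𝓘(ℝ, E) F ↦ ν v.1 v.2) ∧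
    ∀ (q : F) (v : TangentSpace 𝓘(ℝ, E) q), ν q (J q v) = Complex.I • ν q v

end Weinstein

/-! ### Diffeomorphisms, isotopies and contactomorphisms of an embedded submanifold -/

section Submanifold

variable {E : Type*} [NormedAddCommGroup E] [NormedSpace ℝ E] {H : Type*} [TopologicalSpace H]
  {M : Type*} [TopologicalSpace M] [ChartedSpace H M]
  {E' : Type*} [NormedAddCommGroup E'] [NormedSpace ℝ E'] {H' : Type*} [TopologicalSpace H']
  {N : Type*} [TopologicalSpace N] [ChartedSpace H' N]

/-- `g`, on the open set `U`, is a smooth extension of the map `f` defined on the subset `S`. -/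
def IsLocalExtension (I : ModelWithCorners ℝ E H) (I' : ModelWithCorners ℝ E' H') {S : Set M}
    (f : S → N) (U : Set M) (g : M → N) : Prop :=
  IsOpen U ∧ ContMDiffOn I I' ∞ g U ∧ ∀ y : S, (y : M) ∈ U → f y = g y

/-- A map on a subset `S` of a manifold is smooth if near each point of `S` it extends to a smooth
map on an open subset of the manifold. -/
def IsSmoothOnSubset (I : ModelWithCorners ℝ E H) (I' : ModelWithCorners ℝ E' H') {S : Set M}
    (f : S → N) : Prop :=
  ∀ x : S, ∃ (U : Set M) (g : M → N), (x : M) ∈ U ∧ IsLocalExtension I I' f U g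

/-- A bijection `f` of the submanifold `S` is a diffeomorphism if `f` and `f⁻¹` are smooth. -/
def IsDiffeo (I : ModelWithCorners ℝ E H) {S : Set M} (f : Equiv.Perm S) : Prop :=
  IsSmoothOnSubset I I (fun x : S ↦ (f x : M)) ∧
  IsSmoothOnSubset I I (fun x : S ↦ (f.symm x : M))

/-- `Φ t`, `t ∈ [0,1]`, is a smooth isotopy of `S`: each `Φ t` is a diffeomorphism and the map
`[0,1] × S → S` is smooth. -/
def IsIsotopy (I : ModelWithCorners ℝ E H) {S : Set M} (Φ : ℝ → Equiv.Perm S) : Prop :=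
  (∀ t ∈ Set.Icc (0 : ℝ) 1, IsDiffeo I (Φ t)) ∧
  IsSmoothOnSubset (𝓘(ℝ, ℝ).prod I) I (S := Set.Icc (0 : ℝ) 1 ×ˢ S)
    (fun p ↦ (Φ p.1.1 ⟨p.1.2, p.2.2⟩ : M))

/-- Smoothly isotopic diffeomorphisms. -/
def SmoothlyIsotopic (I : ModelWithCorners ℝ E H) {S : Set M} (f g : Equiv.Perm S) : Prop :=
  ∃ Φ : ℝ → Equiv.Perm S, IsIsotopy I Φ ∧ Φ 0 = f ∧ Φ 1 = g

/-- A diffeomorphism `f` of `S` with `df(ξ) = ξ`, where `ξ` is a field of subspaces of `TM` that are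
tangent to `S` along `S`. (The derivative of `f` at a point of `S` is the restriction to the tangent
space of `S` of the derivative of any smooth local extension.) -/
def IsContactomorphism (I : ModelWithCorners ℝ E H) {S : Set M}
    (ξ : ∀ x : M, Submodule ℝ (TangentSpace I x)) (f : Equiv.Perm S) : Prop :=
  IsDiffeo I f ∧
  ∀ (x : S) (U : Set M) (g : M → M), (x : M) ∈ U →
    IsLocalExtension I I (fun y : S ↦ (f y : M)) U g →
    (ξ x).map (mfderiv I I g x).toLinearMap = ξ (g x)

/-- Contact-isotopic contactomorphisms: they are joined by a smooth isotopy through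
contactomorphisms. -/
def ContactIsotopic (I : ModelWithCorners ℝ E H) {S : Set M}
    (ξ : ∀ x : M, Submodule ℝ (TangentSpace I x)) (f g : Equiv.Perm S) : Prop :=
  ∃ Φ : ℝ → Equiv.Perm S, IsIsotopy I Φ ∧ Φ 0 = f ∧ Φ 1 = g ∧
    ∀ t ∈ Set.Icc (0 : ℝ) 1, IsContactomorphism I ξ (Φ t)

end Submanifold

/-! ### The stabilization and the contact manifold -/

section Stabilization

variable {E : Type*} [NormedAddCommGroup E] [NormedSpace ℝ E]
  {F : Type*} [TopologicalSpace F] [ChartedSpace E F]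

/-- `ψ(q,z) = ψ_F(q) + |z|²` on `F × ℂ`. -/
def psiStab (psi : F → ℝ) (p : F × ℂ) : ℝ := psi p.1 + ‖p.2‖ ^ 2

/-- `c` is a regular value of the function `f` on `F × ℂ`. -/
def IsRegularValueStab (E : Type*) [NormedAddCommGroup E] [NormedSpace ℝ E]
    {F : Type*} [TopologicalSpace F] [ChartedSpace E F] (f : F × ℂ → ℝ) (c : ℝ) : Prop :=
  ∀ p : F × ℂ, f p = c → mfderiv (𝓘(ℝ, E).prod 𝓘(ℝ, ℂ)) 𝓘(ℝ, ℝ) f p ≠ 0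

/-- The model with corners of `F × ℂ × ℝ × S¹`. -/
abbrev modelStab (E : Type*) [NormedAddCommGroup E] [NormedSpace ℝ E] :
    ModelWithCorners ℝ (E × ℂ × ℝ × EuclideanSpace ℝ (Fin 1))
      (ModelProd E (ModelProd ℂ (ModelProd ℝ (EuclideanSpace ℝ (Fin 1))))) :=
  𝓘(ℝ, E).prod (𝓘(ℝ, ℂ).prod (𝓘(ℝ, ℝ).prod (𝓡 1)))

/-- `ψ'(q,z,s,θ) = ψ(q,z) + s²` on `F × ℂ × ℝ × S¹`. -/
def psiPrime (psi : F → ℝ) (x : F × ℂ × ℝ × Circle) : ℝ := psiStab psi (x.1, x.2.1) + x.2.2.1 ^ 2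

/-- The hypersurface `{ψ' = c}`, that is `DW × S¹` where
`DW = {(p,s) ∈ (F × ℂ) × ℝ | s² + ψ(p) - c = 0}` is the double of `W = {ψ ≤ c}`. -/
def doubleCircle (psi : F → ℝ) (c : ℝ) : Set (F × ℂ × ℝ × Circle) := {x | psiPrime psi x = c}

/-- The angular 1-form `dθ` on the circle: `dθ(w) = Im (u⁻¹ · w)` for `w` tangent to the unit circle
of `ℂ` at `u`. -/
def dTheta (u : Circle) : TangentSpace (𝓡 1) u →L[ℝ] ℝ :=
  ContinuousLinearMap.comp Complex.imCLM
    (ContinuousLinearMap.comp (ContinuousLinearMap.mul ℝ ℂ ((u⁻¹ : Circle) : ℂ))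
      (mfderiv (𝓡 1) 𝓘(ℝ, ℂ) (fun u : Circle ↦ (u : ℂ)) u :
        EuclideanSpace ℝ (Fin 1) →L[ℝ] ℂ))

/-- The symplectic form `ω' = ω_F + ω₀ + 2 ds ∧ dθ`, where `ω₀ = r dr ∧ dφ = dx ∧ dy`. -/
def omegaPrime
    (om : ∀ q : F, TangentSpace 𝓘(ℝ, E) q →L[ℝ] TangentSpace 𝓘(ℝ, E) q →L[ℝ] ℝ)
    (x : F × ℂ × ℝ × Circle) (v w : TangentSpace (modelStab E) x) : ℝ :=
  om x.1 v.1 w.1 + (v.2.1.re * w.2.1.im - v.2.1.im * w.2.1.re)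
    + 2 * (v.2.2.1 * dTheta x.2.2.2 w.2.2.2 - dTheta x.2.2.2 v.2.2.2 * w.2.2.1)

/-- The Liouville vector field `Z' = Z_F + Z₀ + s ∂_s`, where `Z₀ = ½ r ∂_r`. -/
def zPrime (Z : ∀ q : F, TangentSpace 𝓘(ℝ, E) q) (x : F × ℂ × ℝ × Circle) :
    TangentSpace (modelStab E) x :=
  ((Z x.1, (1 / 2 : ℂ) * x.2.1, x.2.2.1, 0) : E × ℂ × ℝ × EuclideanSpace ℝ (Fin 1))

/-- The 1-form `ι_{Z'} ω'`, whose restriction to `{ψ' = c}` is the contact form `α`. -/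
def alphaForm
    (om : ∀ q : F, TangentSpace 𝓘(ℝ, E) q →L[ℝ] TangentSpace 𝓘(ℝ, E) q →L[ℝ] ℝ)
    (Z : ∀ q : F, TangentSpace 𝓘(ℝ, E) q) (x : F × ℂ × ℝ × Circle) :
    TangentSpace (modelStab E) x →ₗ[ℝ] ℝ where
  toFun v := omegaPrime om x (zPrime Z x) v
  map_add' v w := by
    have e1 : (v + w).1 = v.1 + w.1 := rfl
    have e2 : (v + w).2.1 = v.2.1 + w.2.1 := rfl
    have e3 : (v + w).2.2.1 = v.2.2.1 + w.2.2.1 := rfl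
    have e4 : (v + w).2.2.2 = v.2.2.2 + w.2.2.2 := rfl
    have h1 := (om x.1 (zPrime Z x).1).map_add v.1 w.1
    have h2 := (dTheta x.2.2.2).map_add v.2.2.2 w.2.2.2
    simp only [omegaPrime, e1, e2, e3, e4, Complex.add_im, Complex.add_re]
    erw [h1, h2]
    ring
  map_smul' a v := by
    have e1 : (a • v).1 = a • v.1 := rfl
    have e2 : (a • v).2.1 = a • v.2.1 := rfl
    have e3 : (a • v).2.2.1 = a * v.2.2.1 := rfl
    have e4 : (a • v).2.2.2 = a • v.2.2.2 := rfl
    have h1 := (om x.1 (zPrime Z x).1).map_smul a v.1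
    have h2 := (dTheta x.2.2.2).map_smul a v.2.2.2
    simp only [omegaPrime, e1, e2, e3, e4, Complex.smul_im, Complex.smul_re, smul_eq_mul,
      RingHom.id_apply]
    erw [h1, h2]
    simp only [smul_eq_mul]
    ring

/-- The contact structure `ξ = ker α` on `{ψ' = c}`. At a point of this regular level set, the
tangent space is the kernel of `dψ'`. -/
def xiStab
    (om : ∀ q : F, TangentSpace 𝓘(ℝ, E) q →L[ℝ] TangentSpace 𝓘(ℝ, E) q →L[ℝ] ℝ)
    (Z : ∀ q : F, TangentSpace 𝓘(ℝ, E) q) (psi : F → ℝ) (x : F × ℂ × ℝ × Circle) :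
    Submodule ℝ (TangentSpace (modelStab E) x) :=
  LinearMap.ker (mfderiv (modelStab E) 𝓘(ℝ, ℝ) (psiPrime psi) x).toLinearMap ⊓
    LinearMap.ker (alphaForm om Z x)

/-- The diffeomorphism `Ψ(q,z,s,θ) = (q, e^{iθ} z, s, θ)` of `{ψ' = c}`. -/
def PsiMap (psi : F → ℝ) (c : ℝ) : Equiv.Perm (doubleCircle psi c) where
  toFun x := ⟨(x.1.1, (x.1.2.2.2 : ℂ) * x.1.2.1, x.1.2.2.1, x.1.2.2.2), by
    have h := x.2
    simpa [doubleCircle, psiPrime, psiStab, Circle.norm_coe] using h⟩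
  invFun x := ⟨(x.1.1, ((x.1.2.2.2)⁻¹ : Circle) * x.1.2.1, x.1.2.2.1, x.1.2.2.2), by
    have h := x.2
    simpa [doubleCircle, psiPrime, psiStab, Circle.norm_coe] using h⟩
  left_inv x := by
    ext <;> simp
  right_inv x := by
    ext <;> simp

end Stabilization

end WeinsteinStab

end

/-! Construction. Rotating the ℂ-factor by `e^{ikθ}` adds `½ k |z|² dθ` to `½ Im(z̄ dz)`. The shear
`s ↦ s - k |z|² / 4` subtracts the same amount from `2 s dθ`. So the `twist` with rotation number
`k` and shear coefficient `k` preserves `ι_{Z'} ω'` on the whole stabilization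
(`alphaForm_mfderiv_twist`). It does not preserve `V = {ψ' = c}`, but it commutes with the flow of
`Z'`, which is transverse to `V`. Following that flow back to `V` therefore gives a permutation
`twistPerm` of `V`, additive in both parameters, and for equal parameters `α` is multiplied only by
a positive function. With rotation number 1, the shear 0 gives `Ψ` and the shear 1 gives `Ψ_c`.
Moving the shear from 0 to 1 is the smooth isotopy, and the `k`-th power of `Ψ_c` is the twist with
both parameters equal to `k`.

Obstruction. Let `q₀` be a minimum of `ψ_F`; there `dψ_F = 0` and `Z_F = 0`. Put `s₀ = √(c -
ψ_F(q₀))`. The circle `{(q₀, 0, s₀, u)}` lies in `V`, is fixed by all twists, and along it `ξ = TF ⊕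
ℂ`. The `k`-th twist acts on `ξ` there by `id ⊕ u^k`. A contactomorphism acts conformally
symplectically on `ξ` at these points (`omegaPrime_mfderiv_permExt`). In a contact isotopy ending at
the identity, the conformal factor along the circle never vanishes and ends at 1, so it stays
positive.

The trivialisation of `(TF, J)`, the coordinate of ℂ and `ds + i dθ` form a global complex frame,
whose complex structure is tamed by `ω'`. Positivity of the factor and tameness make the complex
linear part of the derivative on `ξ`, completed by the direction `Z'`, invertible
(`frameMap_injective`). Its determinant along the circle is a homotopy of loops in `ℂ \ {0}` from
`u^k s₀` to `s₀`, and `winding_eq_zero` gives `k = 0`.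

Analytic input. The flow of a complete field is smooth by the implicit function theorem in a space
of curves (`contMDiff_flow`). Identities such as `L_Z λ = λ` and `dα = ω'` are checked on
parametrised surfaces. A map of `V` is extended to an open set, constant along the flow of `Z'`
(`permExt`), so that derivatives can be taken in the ambient manifold. -/

open scoped ComplexConjugate


/-! ### Smoothness of the composition operator and smooth dependence on initial conditions -/

section Composition

universe u

variable {K : Type*} [TopologicalSpace K] [CompactSpace K]
  {E : Type u} [NormedAddCommGroup E] [NormedSpace ℝ E]
  {G : Type u} [NormedAddCommGroup G] [NormedSpace ℝ G]

/-- Pointwise evaluation `(A, h) ↦ (s ↦ A s (h s))` as a continuous bilinear map. -/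
noncomputable def pointwiseApply : C(K, E →L[ℝ] G) →L[ℝ] C(K, E) →L[ℝ] C(K, G) :=
  LinearMap.mkContinuous₂
    (LinearMap.mk₂ ℝ (fun (A : C(K, E →L[ℝ] G)) (h : C(K, E)) ↦
        (⟨fun s ↦ A s (h s), A.continuous.clm_apply h.continuous⟩ : C(K, G)))
      (fun _ _ _ ↦ by ext; simp) (fun _ _ _ ↦ by ext; simp)
      (fun _ _ _ ↦ by ext; simp) (fun _ _ _ ↦ by ext; simp)) 1 (by
    intro A h
    rw [one_mul]
    refine (ContinuousMap.norm_le _ (by positivity)).2 fun s ↦ ?_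
    refine (ContinuousLinearMap.le_opNorm _ _).trans ?_
    gcongr
    exacts [A.norm_coe_le_norm s, h.norm_coe_le_norm s])

@[simp] lemma pointwiseApply_apply (A : C(K, E →L[ℝ] G)) (h : C(K, E)) (s : K) :
    pointwiseApply A h s = A s (h s) := rfl

/-- The mean value inequality at each parameter `s`. It needs one radius on which `f'` is close to
`f' (γ s)` for all `s`, and this comes from continuity of postcomposition by `f'` in the sup norm.
-/
lemma hasFDerivAt_continuousMap_comp {f : E → G} {f' : E → E →L[ℝ] G}
    (hf : ∀ x, HasFDerivAt f (f' x) x) (hc : Continuous f) (hf' : Continuous f') (γ : C(K, E)) :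
    HasFDerivAt (fun γ : C(K, E) ↦ (⟨f, hc⟩ : C(E, G)).comp γ)
      (pointwiseApply ((⟨f', hf'⟩ : C(E, E →L[ℝ] G)).comp γ)) γ := by
  rw [hasFDerivAt_iff_isLittleO_nhds_zero, Asymptotics.isLittleO_iff]
  intro ε hε
  have hcont : Continuous (fun γ : C(K, E) ↦ (⟨f', hf'⟩ : C(E, E →L[ℝ] G)).comp γ) :=
    ContinuousMap.continuous_postcomp _
  have hev : ∀ᶠ γ' in 𝓝 γ, dist ((⟨f', hf'⟩ : C(E, E →L[ℝ] G)).comp γ')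
      ((⟨f', hf'⟩ : C(E, E →L[ℝ] G)).comp γ) < ε :=
    hcont.tendsto γ (Metric.ball_mem_nhds ((⟨f', hf'⟩ : C(E, E →L[ℝ] G)).comp γ) hε)
  obtain ⟨δ, hδ, hball⟩ := Metric.eventually_nhds_iff.1 hev
  filter_upwards [Metric.ball_mem_nhds (0 : C(K, E)) hδ] with h hh
  have hh' : ‖h‖ < δ := by simpa using hh
  refine (ContinuousMap.norm_le _ (by positivity)).2 fun s ↦ ?_
  have key : ∀ z ∈ Metric.ball (γ s) δ, ‖f' z - f' (γ s)‖ ≤ ε := by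
    intro z hz
    -- Translating `γ` by the constant `z - γ s` makes it pass through `z` while staying within `δ`
    -- of `γ`.
    have h1 := hball (y := γ + ContinuousMap.const K (z - γ s)) (by
      rw [dist_eq_norm, add_sub_cancel_left]
      refine (ContinuousMap.norm_lt_iff _ hδ).2 fun _ ↦ ?_
      simpa [dist_eq_norm] using hz)
    have h2 := ((ContinuousMap.dist_lt_iff hε).1 h1 s).le
    simpa [dist_eq_norm] using h2
  have h3 := (convex_ball (γ s) δ).norm_image_sub_le_of_norm_hasFDerivWithin_le'
    (fun z _ ↦ (hf z).hasFDerivWithinAt) key (Metric.mem_ball_self hδ)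
    (y := γ s + h s) (by simpa using (h.norm_coe_le_norm s).trans_lt hh')
  have h4 : ‖f (γ s + h s) - f (γ s) - f' (γ s) (h s)‖ ≤ ε * ‖h s‖ := by simpa using h3
  exact h4.trans (mul_le_mul_of_nonneg_left (h.norm_coe_le_norm s) hε.le)

end Composition

/-- Induction on `n`: the derivative is again a composition operator, that of `f'`, followed by the
bounded bilinear map `pointwiseApply`. The target changes from `G` to `E →L[ℝ] G`, hence the
quantification over spaces inside the induction. -/
lemma contDiff_continuousMap_comp {K : Type*} [TopologicalSpace K] [CompactSpace K] (n : ℕ) :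
    ∀ {E G : Type u} [NormedAddCommGroup E] [NormedSpace ℝ E]
      [NormedAddCommGroup G] [NormedSpace ℝ G] {f : E → G} (hc : Continuous f),
      ContDiff ℝ n f → ContDiff ℝ n (fun γ : C(K, E) ↦ (⟨f, hc⟩ : C(E, G)).comp γ) := by
  induction n with
  | zero =>
    intro E G _ _ _ _ f hc _
    exact contDiff_zero.2 (ContinuousMap.continuous_postcomp _)
  | succ n ih =>
    intro E G _ _ _ _ f hc hf
    rw [Nat.cast_add, Nat.cast_one] at hf ⊢
    obtain ⟨f', hf'1, hf'2⟩ := contDiff_succ_iff_hasFDerivAt.1 hf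
    refine contDiff_succ_iff_hasFDerivAt.2 ⟨_, ?_, fun γ ↦
      hasFDerivAt_continuousMap_comp hf'2 hc hf'1.continuous γ⟩
    exact pointwiseApply.contDiff.comp (ih hf'1.continuous hf'1)

/-! ### Integral curves as solutions of an integral equation on `[-1, 1]` -/

section LocalFlow

variable {E : Type u} [NormedAddCommGroup E]

/-- The compact time interval on which the local flows are parametrised. -/
abbrev TimeInterval : Type := Set.Icc (-1 : ℝ) 1

lemma neg_one_le_one : (-1 : ℝ) ≤ 1 := by norm_num

/-- The extension of a curve on `[-1, 1]` to the real line, constant outside `[-1, 1]`. -/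
noncomputable def extendCurve (γ : C(TimeInterval, E)) (r : ℝ) : E :=
  γ (Set.projIcc (-1) 1 neg_one_le_one r)

lemma continuous_extendCurve (γ : C(TimeInterval, E)) : Continuous (extendCurve γ) :=
  γ.continuous.comp continuous_projIcc

variable [NormedSpace ℝ E]

/-- The primitive vanishing at `0`, as a continuous linear operator. -/
noncomputable def primitiveCLM : C(TimeInterval, E) →L[ℝ] C(TimeInterval, E) :=
  LinearMap.mkContinuous
    { toFun γ := ⟨fun s ↦ ∫ r in (0 : ℝ)..s, extendCurve γ r,
        (intervalIntegral.continuous_primitive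
          (fun a b ↦ (continuous_extendCurve γ).intervalIntegrable a b) 0).comp
          continuous_subtype_val⟩
      map_add' γ γ' := by
        ext s
        exact intervalIntegral.integral_add ((continuous_extendCurve γ).intervalIntegrable _ _)
          ((continuous_extendCurve γ').intervalIntegrable _ _)
      map_smul' a γ := by
        ext s
        exact intervalIntegral.integral_smul a (extendCurve γ) } 1 (by
    intro γ
    rw [one_mul]
    refine (ContinuousMap.norm_le _ (norm_nonneg _)).2 fun s ↦ ?_
    have h := intervalIntegral.norm_integral_le_of_norm_le_const (a := (0 : ℝ)) (b := (s : ℝ))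
      (f := extendCurve γ) (C := ‖γ‖) (fun r _ ↦ γ.norm_coe_le_norm _)
    have hs : |(s : ℝ) - 0| ≤ 1 := by rw [sub_zero]; exact abs_le.2 s.2
    exact h.trans (mul_le_of_le_one_right (norm_nonneg _) hs))

lemma primitiveCLM_apply (γ : C(TimeInterval, E)) (s : TimeInterval) :
    primitiveCLM γ s = ∫ r in (0 : ℝ)..s, extendCurve γ r := rfl

/-- Constant curves, as a continuous linear operator. -/
noncomputable def constCurveCLM : E →L[ℝ] C(TimeInterval, E) :=
  LinearMap.mkContinuous
    { toFun x := ContinuousMap.const _ x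
      map_add' _ _ := rfl
      map_smul' _ _ := rfl } 1 (by
    intro x
    rw [one_mul]
    exact (ContinuousMap.norm_le _ (norm_nonneg _)).2 fun s ↦ le_rfl)

@[simp] lemma constCurveCLM_apply (x : E) (s : TimeInterval) : constCurveCLM x s = x := rfl

/-- The rescaled integral curves of a `C^n` vector field depend in a `C^n` way on the scale and on
the initial condition. -/
lemma exists_contDiffAt_solution [CompleteSpace E] {n : ℕ} (hn : n ≠ 0) {v : E → E}
    (hv : ContDiff ℝ n v) (x₀ : E) :
    ∃ Γ : ℝ × E → C(TimeInterval, E), ContDiffAt ℝ n Γ (0, x₀) ∧ Γ (0, x₀) = constCurveCLM x₀ ∧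
      ∀ᶠ p in 𝓝 ((0 : ℝ), x₀), Γ p = constCurveCLM p.2 +
        p.1 • primitiveCLM ((⟨v, hv.continuous⟩ : C(E, E)).comp (Γ p)) := by
  have hn' : (n : WithTop ℕ∞) ≠ 0 := by exact_mod_cast hn
  let N : C(TimeInterval, E) → C(TimeInterval, E) := fun γ ↦ (⟨v, hv.continuous⟩ : C(E, E)).comp γ
  have hN : ContDiff ℝ n N := contDiff_continuousMap_comp n hv.continuous hv
  let P : (ℝ × E) × C(TimeInterval, E) → C(TimeInterval, E) := fun w ↦
    w.2 - constCurveCLM w.1.2 - w.1.1 • primitiveCLM (N w.2)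
  have hP : ContDiff ℝ n P :=
    (contDiff_snd.sub (constCurveCLM.contDiff.comp (contDiff_snd.comp contDiff_fst))).sub
      ((contDiff_fst.comp contDiff_fst).smul (primitiveCLM.contDiff.comp (hN.comp contDiff_snd)))
  let u : (ℝ × E) × C(TimeInterval, E) := ((0, x₀), constCurveCLM x₀)
  have hPu : P u = 0 := by simp [P, u]
  -- The scale multiplies the integral term, so at scale 0 the equation is affine in the curve with
  -- linear part the identity. The implicit function theorem then applies without any contraction
  -- estimate.
  have hd : fderiv ℝ P u ∘L .inr ℝ (ℝ × E) C(TimeInterval, E) = .id ℝ _ := by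
    have h1 : HasFDerivAt P (fderiv ℝ P u) (u.1, u.2) :=
      (hP.contDiffAt.differentiableAt hn').hasFDerivAt
    have h2 : HasFDerivAt (fun γ ↦ P (u.1, γ))
        (fderiv ℝ P u ∘L .inr ℝ (ℝ × E) C(TimeInterval, E)) u.2 :=
      h1.comp u.2 (hasFDerivAt_prodMk_right u.1 u.2)
    have h3 : HasFDerivAt (fun γ ↦ P (u.1, γ)) (.id ℝ C(TimeInterval, E)) u.2 := by
      have : (fun γ ↦ P (u.1, γ)) = fun γ ↦ γ - constCurveCLM x₀ := by
        funext γ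
        simp [P, u]
      rw [this]
      exact (hasFDerivAt_id _).sub_const _
    exact h2.unique h3
  have hinv : (fderiv ℝ P u ∘L .inr ℝ (ℝ × E) C(TimeInterval, E)).IsInvertible := by
    rw [hd]
    exact ContinuousLinearMap.isInvertible_equiv (f := ContinuousLinearEquiv.refl ℝ _)
  have hPu' : ContDiffAt ℝ n P u := hP.contDiffAt
  refine ⟨hPu'.implicitFunction hn' hinv, hPu'.contDiffAt_implicitFunction hn' hinv,
    hPu'.implicitFunction_apply_self hn' hinv, ?_⟩
  filter_upwards [hPu'.eventually_apply_implicitFunction hn' hinv] with p hp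
  rw [hPu] at hp
  have h5 := sub_eq_zero.1 hp
  rw [sub_eq_iff_eq_add] at h5
  rw [add_comm]
  exact h5

/-- The fundamental theorem of calculus. Only interior times are allowed, because `extendCurve` is
constant beyond the endpoints. -/
lemma hasDerivAt_extendCurve [CompleteSpace E] {v : E → E} (hv : Continuous v) {γ : C(TimeInterval, E)} {t : ℝ}
    {x : E} (h : γ = constCurveCLM x + t • primitiveCLM ((⟨v, hv⟩ : C(E, E)).comp γ)) {r : ℝ}
    (hr : r ∈ Set.Ioo (-1 : ℝ) 1) :
    HasDerivAt (extendCurve γ) (t • v (extendCurve γ r)) r := by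
  have h1 : extendCurve γ =ᶠ[𝓝 r] fun s ↦ x + t • ∫ a in (0 : ℝ)..s, v (extendCurve γ a) := by
    filter_upwards [isOpen_Ioo.mem_nhds hr] with s hs
    have hs' : s ∈ Set.Icc (-1 : ℝ) 1 := Set.Ioo_subset_Icc_self hs
    have h2 := DFunLike.congr_fun h ⟨s, hs'⟩
    rw [extendCurve, Set.projIcc_of_mem _ hs']
    exact h2
  refine HasDerivAt.congr_of_eventuallyEq ?_ h1
  exact ((intervalIntegral.integral_hasDerivAt_right
    ((hv.comp (continuous_extendCurve γ)).intervalIntegrable _ _)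
    (hv.comp (continuous_extendCurve γ)).aestronglyMeasurable.stronglyMeasurableAtFilter
    (hv.comp (continuous_extendCurve γ)).continuousAt).const_smul t).const_add x

end LocalFlow

/-! ### The flow of a complete smooth vector field -/

/-- Multiplication by a bump function. It replaces a vector field known only near a point of a chart
by one on the whole model space, as the composition operator requires. -/
lemma ContDiffAt.exists_contDiff_eventuallyEq {E G : Type*} [NormedAddCommGroup E]
    [NormedSpace ℝ E] [FiniteDimensional ℝ E] [NormedAddCommGroup G] [NormedSpace ℝ G] {n : ℕ}
    {w : E → G} {y₀ : E} (hw : ContDiffAt ℝ n w y₀) :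
    ∃ v : E → G, ContDiff ℝ n v ∧ v =ᶠ[𝓝 y₀] w := by
  obtain ⟨r, hr, hball⟩ := Metric.eventually_nhds_iff_ball.1 (hw.eventually (by simp))
  let f : ContDiffBump y₀ := ⟨r / 4, r / 2, by positivity, by linarith⟩
  refine ⟨fun y ↦ f y • w y, contDiff_iff_contDiffAt.2 fun y ↦ ?_, ?_⟩
  · by_cases hy : y ∈ Metric.ball y₀ r
    · exact f.contDiff.contDiffAt.smul (hball y hy)
    · have h0 : y ∉ tsupport f := by
        rw [f.tsupport_eq]
        intro h
        exact hy (Metric.closedBall_subset_ball (by change r / 2 < r; linarith) h)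
      have h1 : (fun y ↦ f y • w y) =ᶠ[𝓝 y] fun _ ↦ 0 := by
        filter_upwards [(isClosed_tsupport f).isOpen_compl.mem_nhds h0] with z hz
        rw [image_eq_zero_of_notMem_tsupport hz, zero_smul]
      exact contDiffAt_const.congr_of_eventuallyEq h1
  · filter_upwards [f.eventuallyEq_one] with y hy
    rw [hy]
    simp

namespace WeinsteinStab

section Flow

variable {E : Type*} [NormedAddCommGroup E] [NormedSpace ℝ E]
  {F : Type*} [TopologicalSpace F] [ChartedSpace E F] {Z : ∀ q : F, TangentSpace 𝓘(ℝ, E) q}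

/-- The flow of a complete vector field. -/
noncomputable def flow (hZ : IsCompleteVectorField Z) (t : ℝ) (q : F) : F := (hZ q).choose t

variable (hZ : IsCompleteVectorField Z)

@[simp] lemma flow_zero (q : F) : flow hZ 0 q = q := (hZ q).choose_spec.1

lemma isMIntegralCurve_flow (q : F) :
    IsMIntegralCurve (I := 𝓘(ℝ, E)) (fun t ↦ flow hZ t q) Z := (hZ q).choose_spec.2

lemma continuous_flow_left (q : F) : Continuous (fun t ↦ flow hZ t q) :=
  continuous_iff_continuousAt.2 fun t ↦ (isMIntegralCurve_flow hZ q t).continuousAt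

variable [IsManifold 𝓘(ℝ, E) ∞ F]
  (hs : ContMDiff 𝓘(ℝ, E) 𝓘(ℝ, E).tangent ∞ (fun q ↦ (⟨q, Z q⟩ : TangentBundle 𝓘(ℝ, E) F)))
include hs

lemma flow_add [T2Space F] (s t : ℝ) (q : F) : flow hZ (s + t) q = flow hZ s (flow hZ t q) := by
  have h1 : IsMIntegralCurve (I := 𝓘(ℝ, E)) ((fun s ↦ flow hZ s q) ∘ (· + t)) Z :=
    (isMIntegralCurve_flow hZ q).comp_add t
  exact congrFun (isMIntegralCurve_Ioo_eq_of_contMDiff_boundaryless (t₀ := 0)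
    (hs.of_le (by simp)) h1 (isMIntegralCurve_flow hZ (flow hZ t q)) (by simp)) s

omit hs in
/-- A solution of the differential equation in a chart is an integral curve. -/
lemma hasMFDerivAt_chart_symm_comp {x₀ : F} {c : ℝ → E} {t : ℝ}
    (hc : c t ∈ (extChartAt 𝓘(ℝ, E) x₀).target)
    (h : HasDerivAt c (tangentCoordChange 𝓘(ℝ, E) ((extChartAt 𝓘(ℝ, E) x₀).symm (c t)) x₀
      ((extChartAt 𝓘(ℝ, E) x₀).symm (c t)) (Z ((extChartAt 𝓘(ℝ, E) x₀).symm (c t)))) t) :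
    HasMFDerivAt 𝓘(ℝ, ℝ) 𝓘(ℝ, E) ((extChartAt 𝓘(ℝ, E) x₀).symm ∘ c) t
      ((1 : ℝ →L[ℝ] ℝ).smulRight (Z ((extChartAt 𝓘(ℝ, E) x₀).symm (c t)))) := by
  have hft1 := (extChartAt 𝓘(ℝ, E) x₀).target_subset_preimage_source hc
  have hft2 := mem_extChartAt_source (I := 𝓘(ℝ, E)) ((extChartAt 𝓘(ℝ, E) x₀).symm (c t))
  set xt := (extChartAt 𝓘(ℝ, E) x₀).symm (c t) with hxt
  suffices H : HasDerivAt ((extChartAt 𝓘(ℝ, E) xt ∘ (extChartAt 𝓘(ℝ, E) x₀).symm) ∘ c)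
      (Z xt : E) t by
    refine ⟨(continuousAt_extChartAt_symm'' hc).comp h.continuousAt, ?_⟩
    have H' := H.hasFDerivAt.hasFDerivWithinAt (s := Set.range 𝓘(ℝ, ℝ))
    exact H'
  have key : ∀ e : E, HasDerivAt c (tangentCoordChange 𝓘(ℝ, E) xt x₀ xt e) t →
      HasDerivAt ((extChartAt 𝓘(ℝ, E) xt ∘ (extChartAt 𝓘(ℝ, E) x₀).symm) ∘ c) e t := by
    intro e h
    rw [← tangentCoordChange_self (I := 𝓘(ℝ, E)) (x := xt) (z := xt) (v := e) hft2,
      ← tangentCoordChange_comp (x := x₀) ⟨⟨hft2, hft1⟩, hft2⟩]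
    apply HasFDerivAt.comp_hasDerivAt _ _ h
    apply HasFDerivWithinAt.hasFDerivAt (s := Set.range 𝓘(ℝ, E)) _ (by simp)
    rw [← (extChartAt 𝓘(ℝ, E) x₀).right_inv hc]
    exact hasFDerivWithinAt_tangentCoordChange ⟨hft1, hft2⟩
  exact key _ h

/-- In a chart, the flow at a small time `t` is the solution operator of the integral equation at
scale `2 t`, evaluated at the parameter `1/2`; uniqueness of integral curves identifies the two. -/
lemma contMDiffAt_flow_zero [T2Space F] [FiniteDimensional ℝ E] (n : ℕ) (x₀ : F) :
    ContMDiffAt (𝓘(ℝ, ℝ).prod 𝓘(ℝ, E)) 𝓘(ℝ, E) n (fun p : ℝ × F ↦ flow hZ p.1 p.2) (0, x₀) := by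
  suffices H : ∀ n : ℕ, n ≠ 0 → ContMDiffAt (𝓘(ℝ, ℝ).prod 𝓘(ℝ, E)) 𝓘(ℝ, E) n
      (fun p : ℝ × F ↦ flow hZ p.1 p.2) (0, x₀) from
    (H (n + 1) (by simp)).of_le (by exact_mod_cast Nat.le_succ n)
  intro n hn
  have : CompleteSpace E := FiniteDimensional.complete ℝ E
  set φ := extChartAt 𝓘(ℝ, E) x₀ with hφ
  let w : E → E := fun y ↦ tangentCoordChange 𝓘(ℝ, E) (φ.symm y) x₀ (φ.symm y) (Z (φ.symm y))
  have hw : ContDiffAt ℝ n w (φ x₀) := by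
    have h1 := (contMDiffAt_iff.1 ((hs x₀).of_le (n := ∞) (m := n) (by exact_mod_cast le_top))).2
    exact (h1.contDiffAt (by simp)).snd
  obtain ⟨v, hv, hvw⟩ := hw.exists_contDiff_eventuallyEq
  obtain ⟨Γ, hΓ1, hΓ2, hΓ3⟩ := exists_contDiffAt_solution hn hv (φ x₀)
  have htar : φ.target ∈ 𝓝 (φ x₀) := extChartAt_target_mem_nhds x₀
  obtain ⟨r, hr, hball⟩ := Metric.eventually_nhds_iff_ball.1 (hvw.and htar)
  have hΓ4 : ∀ᶠ p in 𝓝 ((0 : ℝ), φ x₀), ∀ s, Γ p s ∈ Metric.ball (φ x₀) r := by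
    have h1 : ∀ᶠ p in 𝓝 ((0 : ℝ), φ x₀), Γ p ∈ Metric.ball (constCurveCLM (φ x₀)) r := by
      have h2 := hΓ1.continuousAt
      rw [ContinuousAt, hΓ2] at h2
      exact h2 (Metric.ball_mem_nhds _ hr)
    filter_upwards [h1] with p hp s
    exact (ContinuousMap.dist_lt_iff hr).1 hp s
  -- The integral equation yields a differential equation only inside `(-1, 1)`, so the curve is
  -- read at `1/2` rather than at the endpoint, and the scale is doubled to compensate.
  let half : TimeInterval := ⟨1 / 2, by norm_num, by norm_num⟩
  -- The local flow is given by the solution operator.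
  have key : ∀ p : ℝ × E, Γ p = constCurveCLM p.2 +
        p.1 • primitiveCLM ((⟨v, hv.continuous⟩ : C(E, E)).comp (Γ p)) →
      (∀ s, Γ p s ∈ Metric.ball (φ x₀) r) → p.1 ≠ 0 →
      flow hZ (p.1 / 2) (φ.symm p.2) = φ.symm (Γ p half) := by
    rintro ⟨t, y⟩ h1 h2 (ht : t ≠ 0)
    have hpos : 0 < |t| := abs_pos.2 ht
    -- The solution at scale `t` has velocity `t • v`; the substitution `u / t` restores unit speed.
    -- Hence the hypothesis `t ≠ 0`; time zero is treated separately below.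
    have hγ : IsMIntegralCurveOn (I := 𝓘(ℝ, E))
        (φ.symm ∘ fun u ↦ extendCurve (Γ (t, y)) (u / t)) Z (Set.Ioo (-|t|) |t|) := by
      intro u hu
      have hu' : u / t ∈ Set.Ioo (-1 : ℝ) 1 := by
        rw [Set.mem_Ioo, ← abs_lt] at hu
        rw [Set.mem_Ioo, ← abs_lt, abs_div, div_lt_one hpos]
        exact hu
      have h3 := hball _ (h2 (Set.projIcc (-1) 1 neg_one_le_one (u / t)))
      refine (hasMFDerivAt_chart_symm_comp (Z := Z) h3.2 ?_).hasMFDerivWithinAt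
      have h4 := (hasDerivAt_extendCurve hv.continuous h1 hu').scomp u
        ((hasDerivAt_id u).div_const t)
      have h5 : v (extendCurve (Γ (t, y)) (u / t)) = w (extendCurve (Γ (t, y)) (u / t)) := h3.1
      simp only [h5, smul_smul, one_div_mul_cancel ht, one_smul] at h4
      exact h4
    have h0 : (0 : ℝ) ∈ Set.Icc (-1 : ℝ) 1 := by norm_num
    have h6 := isMIntegralCurveOn_Ioo_eqOn_of_contMDiff_boundaryless (t₀ := 0)
      (a := -|t|) (b := |t|) (by simpa using ht) (hs.of_le (by simp))
      ((isMIntegralCurve_flow hZ (φ.symm y)).isMIntegralCurveOn _) hγ (by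
        have h7 := DFunLike.congr_fun h1 ⟨0, h0⟩
        simp only [flow_zero, Function.comp_apply, zero_div, extendCurve,
          Set.projIcc_of_mem neg_one_le_one h0, h7]
        simp [primitiveCLM_apply])
    have h8 := h6 (x := t / 2) (by
      rw [Set.mem_Ioo, ← abs_lt, abs_div, abs_two]
      linarith)
    have h9 : t / 2 / t = 1 / 2 := by field_simp
    have h10 : Set.projIcc (-1) 1 neg_one_le_one (1 / 2) = half :=
      Set.projIcc_of_mem neg_one_le_one half.2
    simp only [Function.comp_apply, extendCurve, h9, h10] at h8
    exact h8
  have hT : Filter.Tendsto (fun p : ℝ × F ↦ (2 * p.1, φ p.2)) (𝓝 (0, x₀))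
      (𝓝 ((0 : ℝ), φ x₀)) := by
    have h1 : ContinuousAt (fun p : ℝ × F ↦ (2 * p.1, φ p.2)) (0, x₀) :=
      (continuous_const.mul continuous_fst).continuousAt.prodMk
        (ContinuousAt.comp (g := φ) (f := Prod.snd) (continuousAt_extChartAt x₀) continuousAt_snd)
    simpa [ContinuousAt] using h1
  have hloc : (fun p : ℝ × F ↦ flow hZ p.1 p.2) =ᶠ[𝓝 (0, x₀)]
      fun p ↦ φ.symm (ContinuousMap.evalCLM ℝ half (Γ (2 * p.1, φ p.2))) := by
    filter_upwards [hT.eventually hΓ3, hT.eventually hΓ4,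
      continuousAt_snd.preimage_mem_nhds (extChartAt_source_mem_nhds (I := 𝓘(ℝ, E)) x₀)]
      with ⟨t, q⟩ h1 h2 (h3 : q ∈ φ.source)
    by_cases ht : t = 0
    · subst ht
      simp only [mul_zero, zero_smul, add_zero] at h1
      simp [h1, φ.left_inv h3]
    · have h4 := key _ h1 h2 (by simpa using ht)
      simpa [φ.left_inv h3] using h4
  refine ContMDiffAt.congr_of_eventuallyEq ?_ hloc
  have h1 : ContMDiffAt (𝓘(ℝ, ℝ).prod 𝓘(ℝ, E)) 𝓘(ℝ, ℝ × E) n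
      (fun p : ℝ × F ↦ (2 * p.1, φ p.2)) (0, x₀) := by
    refine ContMDiffAt.prodMk_space ?_ ?_
    · exact ((contDiff_const.mul contDiff_id).contMDiff (f := fun t : ℝ ↦ 2 * t)).contMDiffAt.comp
        _ contMDiffAt_fst
    · exact ContMDiffAt.comp (0, x₀) (g := φ) (f := Prod.snd)
        ((contMDiffAt_extChartAt (n := ∞)).of_le (by exact_mod_cast le_top)) contMDiffAt_snd
  have h2 : ContMDiffAt 𝓘(ℝ, ℝ × E) 𝓘(ℝ, E) n (fun p ↦ ContinuousMap.evalCLM ℝ half (Γ p))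
      (2 * (0 : ℝ), φ x₀) := by
    rw [mul_zero]
    exact ((ContinuousMap.evalCLM ℝ half).contDiff.contDiffAt.comp _ hΓ1).contMDiffAt
  have h3 : ContMDiffAt 𝓘(ℝ, E) 𝓘(ℝ, E) n φ.symm
      (ContinuousMap.evalCLM ℝ half (Γ (2 * (0 : ℝ), φ x₀))) := by
    have h4 : ContinuousMap.evalCLM ℝ half (Γ (2 * (0 : ℝ), φ x₀)) = φ x₀ := by
      rw [mul_zero, hΓ2]
      rfl
    rw [h4]
    exact ((contMDiffOn_extChartAt_symm (n := ∞) x₀).of_le (by exact_mod_cast le_top)).contMDiffAt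
      htar
  exact ContMDiffAt.comp ((0 : ℝ), x₀)
    (g := fun p : ℝ × E ↦ φ.symm (ContinuousMap.evalCLM ℝ half (Γ p)))
    (ContMDiffAt.comp (2 * (0 : ℝ), φ x₀) h3 h2) h1

/-- The flow of a complete smooth vector field is smooth. -/
lemma contMDiff_flow [T2Space F] [FiniteDimensional ℝ E] :
    ContMDiff (𝓘(ℝ, ℝ).prod 𝓘(ℝ, E)) 𝓘(ℝ, E) ∞ (fun p : ℝ × F ↦ flow hZ p.1 p.2) := by
  rw [contMDiff_infty]
  rintro n ⟨t₀, x₀⟩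
  -- For finite `n`, being `C^n` at a point is an open condition. The set of good times is therefore
  -- open, and it will be shown closed.
  let A : Set ℝ := {t | ContMDiffAt (𝓘(ℝ, ℝ).prod 𝓘(ℝ, E)) 𝓘(ℝ, E) n
    (fun p : ℝ × F ↦ flow hZ p.1 p.2) (t, x₀)}
  suffices hA : A = Set.univ from (hA ▸ Set.mem_univ t₀ : t₀ ∈ A)
  have : IsManifold 𝓘(ℝ, E) n F := .of_le (n := ∞) (by exact_mod_cast le_top)
  have : IsManifold (𝓘(ℝ, ℝ).prod 𝓘(ℝ, E)) n (ℝ × F) := inferInstance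
  have hev : ∀ {p : ℝ × F}, ContMDiffAt (𝓘(ℝ, ℝ).prod 𝓘(ℝ, E)) 𝓘(ℝ, E) n
      (fun p : ℝ × F ↦ flow hZ p.1 p.2) p → ∀ᶠ p' in 𝓝 p,
      ContMDiffAt (𝓘(ℝ, ℝ).prod 𝓘(ℝ, E)) 𝓘(ℝ, E) n (fun p : ℝ × F ↦ flow hZ p.1 p.2) p' :=
    fun h ↦ (contMDiffAt_iff_contMDiffAt_nhds (by simp)).1 h
  have hopen : IsOpen A := isOpen_iff_mem_nhds.2 fun t ht ↦
    (Continuous.prodMk_left x₀).continuousAt.eventually (hev ht)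
  have hclosed : IsClosed A := by
    refine isClosed_of_closure_subset fun t₁ ht₁ ↦ ?_
    have h1 : ContinuousAt (fun t ↦ (t₁ - t, flow hZ t x₀)) t₁ :=
      ((continuous_const.sub continuous_id).prodMk (continuous_flow_left hZ x₀)).continuousAt
    have h2 : ∀ᶠ t in 𝓝 t₁, ContMDiffAt (𝓘(ℝ, ℝ).prod 𝓘(ℝ, E)) 𝓘(ℝ, E) n
        (fun p : ℝ × F ↦ flow hZ p.1 p.2) (t₁ - t, flow hZ t x₀) := by
      refine h1.eventually (hev ?_)
      simp only [sub_self]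
      exact contMDiffAt_flow_zero hZ hs n _
    obtain ⟨t, ht1, ht2⟩ := (mem_closure_iff_frequently.1 ht₁).and_eventually h2 |>.exists
    -- Near a limit time, the group law writes the flow as a good time `t` followed by the short
    -- time `t₁ - t`, where smoothness near time zero applies.
    have h3 : (fun p : ℝ × F ↦ flow hZ p.1 p.2) =
        (fun p : ℝ × F ↦ flow hZ p.1 p.2) ∘ fun p ↦ (p.1 - t, flow hZ t p.2) := by
      funext p
      simp only [Function.comp_apply]
      rw [← flow_add hZ hs, sub_add_cancel]
    have h4 : ContMDiffAt (𝓘(ℝ, ℝ).prod 𝓘(ℝ, E)) (𝓘(ℝ, ℝ).prod 𝓘(ℝ, E)) n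
        (fun p : ℝ × F ↦ (p.1 - t, flow hZ t p.2)) (t₁, x₀) := by
      refine ContMDiffAt.prodMk ?_ ?_
      · exact ((contDiff_id.sub contDiff_const).contMDiff (f := fun s : ℝ ↦ s - t)).contMDiffAt.comp
          _ contMDiffAt_fst
      · exact ContMDiffAt.comp (t₁, x₀) (g := fun p : ℝ × F ↦ flow hZ p.1 p.2)
          (f := fun p : ℝ × F ↦ (t, p.2)) ht1 (contMDiffAt_const.prodMk contMDiffAt_snd)
    change ContMDiffAt _ _ _ _ _
    rw [h3]
    exact ContMDiffAt.comp (t₁, x₀) ht2 h4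
  exact IsClopen.eq_univ ⟨hclosed, hopen⟩ ⟨0, contMDiffAt_flow_zero hZ hs n x₀⟩

end Flow

end WeinsteinStab

namespace WeinsteinStab

lemma two_le_infty : (2 : WithTop ℕ∞) ≤ ∞ := ENat.LEInfty.out

/-! ### Smooth families of tangent vectors -/

section MFDerivSection

variable {E : Type*} [NormedAddCommGroup E] [NormedSpace ℝ E] {H : Type*} [TopologicalSpace H]
  {I : ModelWithCorners ℝ E H} {M : Type*} [TopologicalSpace M] [ChartedSpace H M]
  {E' : Type*} [NormedAddCommGroup E'] [NormedSpace ℝ E'] {H' : Type*} [TopologicalSpace H']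
  {I' : ModelWithCorners ℝ E' H'} {M' : Type*} [TopologicalSpace M'] [ChartedSpace H' M']
  {E'' : Type*} [NormedAddCommGroup E''] [NormedSpace ℝ E''] {H'' : Type*} [TopologicalSpace H'']
  {J : ModelWithCorners ℝ E'' H''} {N : Type*} [TopologicalSpace N] [ChartedSpace H'' N]
  [IsManifold I 1 M] [IsManifold I' 1 M'] [IsManifold J 1 N] {m n : WithTop ℕ∞}

/-- The partial derivatives of a smooth family of maps, applied to a smooth family of tangent
vectors, form a smooth family of tangent vectors. -/
lemma contMDiffAt_mfderiv_section {x₀ : N} {f : N → M → M'} {g : N → M}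
    {v : ∀ x, TangentSpace I (g x)}
    (hf : ContMDiffAt (J.prod I) I' n (Function.uncurry f) (x₀, g x₀))
    (hg : ContMDiffAt J I m g x₀)
    (hv : ContMDiffAt J I.tangent m (fun x ↦ (⟨g x, v x⟩ : TangentBundle I M)) x₀)
    (hmn : m + 1 ≤ n) :
    ContMDiffAt J I'.tangent m
      (fun x ↦ (⟨f x (g x), mfderiv I I' (f x) (g x) (v x)⟩ : TangentBundle I' M')) x₀ := by
  have h1 := ContMDiffAt.mfderiv f g hf hg hmn
  refine ContMDiffAt.clm_apply_of_inCoordinates (b₁ := g) (b₂ := fun x ↦ f x (g x)) (v := v)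
    (ϕ := fun x ↦ mfderiv I I' (f x) (g x)) h1 hv ?_
  exact ContMDiffAt.comp x₀ (g := Function.uncurry f) (f := fun x ↦ (x, g x))
    (hf.of_le (le_self_add.trans hmn)) (contMDiffAt_id.prodMk hg)

omit [IsManifold I 1 M] [IsManifold J 1 N] in
lemma contMDiffAt_mfderiv_const_apply {f : E → M'} {a : E}
    (hf : ContMDiffAt 𝓘(ℝ, E) I' n f a) (hmn : m + 1 ≤ n) (v : E) :
    ContMDiffAt 𝓘(ℝ, E) I'.tangent m
      (fun x ↦ (⟨f x, mfderiv 𝓘(ℝ, E) I' f x v⟩ : TangentBundle I' M')) a := by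
  refine contMDiffAt_mfderiv_section (J := 𝓘(ℝ, E)) (I := 𝓘(ℝ, E)) (f := fun _ : E ↦ f) (g := id)
    (v := fun _ ↦ v) (x₀ := a) ?_ contMDiffAt_id ?_ hmn
  · exact ContMDiffAt.comp (a, a) (g := f) (f := Prod.snd) hf contMDiffAt_snd
  · exact contMDiffAt_vectorSpace_iff_contDiffAt.2 contDiffAt_const

end MFDerivSection

/-! ### The exterior derivative of a 1-form along a parametrised surface -/

section SurfaceFormula

variable {E : Type*} [NormedAddCommGroup E] [NormedSpace ℝ E]
  {F : Type*} [TopologicalSpace F] [ChartedSpace E F] [IsManifold 𝓘(ℝ, E) ∞ F]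
  {D : Type*} [NormedAddCommGroup D] [NormedSpace ℝ D]

lemma mfderiv_eq_mfderiv_symm_fderiv {γ : D → F} {a p : D}
    (hp : γ p ∈ (extChartAt 𝓘(ℝ, E) (γ a)).source)
    (hγ : MDifferentiableAt 𝓘(ℝ, D) 𝓘(ℝ, E) γ p) (e : D) :
    (mfderiv 𝓘(ℝ, D) 𝓘(ℝ, E) γ p e : E) =
      (mfderiv 𝓘(ℝ, E) 𝓘(ℝ, E) (extChartAt 𝓘(ℝ, E) (γ a)).symm (extChartAt 𝓘(ℝ, E) (γ a) (γ p)) :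
        E →L[ℝ] E) (fderiv ℝ (extChartAt 𝓘(ℝ, E) (γ a) ∘ γ) p e) := by
  set φ := extChartAt 𝓘(ℝ, E) (γ a)
  have h1 : γ =ᶠ[𝓝 p] φ.symm ∘ (φ ∘ γ) := by
    filter_upwards [hγ.continuousAt.preimage_mem_nhds
      ((isOpen_extChartAt_source (I := 𝓘(ℝ, E)) (γ a)).mem_nhds hp)] with x hx
    exact (φ.left_inv hx).symm
  have h2 : MDifferentiableAt 𝓘(ℝ, E) 𝓘(ℝ, E) φ (γ p) :=
    mdifferentiableAt_extChartAt (by simpa [φ] using hp)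
  have h3 : MDifferentiableAt 𝓘(ℝ, E) 𝓘(ℝ, E) φ.symm (φ (γ p)) :=
    ((contMDiffOn_extChartAt_symm (n := 1) (γ a)).contMDiffAt
      ((isOpen_extChartAt_target (I := 𝓘(ℝ, E)) (γ a)).mem_nhds (φ.map_source hp))).mdifferentiableAt
      (by simp)
  have h4 := h2.comp p hγ
  rw [h1.mfderiv_eq, mfderiv_comp (I' := 𝓘(ℝ, E)) p h3 h4, mfderiv_eq_fderiv]
  rfl

/-- The exterior derivative of a 1-form computed on a parametrised surface. -/
lemma fderiv_sub_fderiv_eq_extDerivOne {lam : ∀ q : F, TangentSpace 𝓘(ℝ, E) q →L[ℝ] ℝ}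
    {γ : D → F} {a : D}
    (hlam : DifferentiableAt ℝ (chartOneForm lam (γ a)) (extChartAt 𝓘(ℝ, E) (γ a) (γ a)))
    (hγ : ContMDiffAt 𝓘(ℝ, D) 𝓘(ℝ, E) 2 γ a) :
    (∀ e : D, DifferentiableAt ℝ (fun p ↦ lam (γ p) (mfderiv 𝓘(ℝ, D) 𝓘(ℝ, E) γ p e)) a) ∧
    ∀ e e' : D,
      fderiv ℝ (fun p ↦ lam (γ p) (mfderiv 𝓘(ℝ, D) 𝓘(ℝ, E) γ p e')) a e
        - fderiv ℝ (fun p ↦ lam (γ p) (mfderiv 𝓘(ℝ, D) 𝓘(ℝ, E) γ p e)) a e' =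
      extDerivOne lam (γ a) (mfderiv 𝓘(ℝ, D) 𝓘(ℝ, E) γ a e) (mfderiv 𝓘(ℝ, D) 𝓘(ℝ, E) γ a e') := by
  set φ := extChartAt 𝓘(ℝ, E) (γ a) with hφ
  set γh : D → E := φ ∘ γ with hγh
  have : IsManifold 𝓘(ℝ, E) 2 F := .of_le (n := ∞) two_le_infty
  have hsm : ContDiffAt ℝ 2 γh a := by
    have h1 := (contMDiffAt_extChartAt (I := 𝓘(ℝ, E)) (n := 2) (x := γ a)).comp a hγ
    exact contMDiffAt_iff_contDiffAt.1 h1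
  have hev : ∀ e : D, (fun p ↦ lam (γ p) (mfderiv 𝓘(ℝ, D) 𝓘(ℝ, E) γ p e)) =ᶠ[𝓝 a]
      fun p ↦ chartOneForm lam (γ a) (γh p) (fderiv ℝ γh p e) := by
    intro e
    have h1 := (contMDiffAt_iff_contMDiffAt_nhds (by simp)).1 hγ
    filter_upwards [h1, hγ.continuousAt.preimage_mem_nhds
      (extChartAt_source_mem_nhds (I := 𝓘(ℝ, E)) (γ a))] with p hp1 hp2
    have h2 := mfderiv_eq_mfderiv_symm_fderiv hp2 (hp1.mdifferentiableAt (by simp)) e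
    have h3 : φ.symm (γh p) = γ p := φ.left_inv hp2
    have h4 : ∀ (q q' : F) (hq : q = q') (u u' : E) (hu : u = u'),
        (lam q : E →L[ℝ] ℝ) u = (lam q' : E →L[ℝ] ℝ) u' := by
      rintro q _ rfl u _ rfl
      rfl
    exact h4 _ _ h3.symm _ _ h2
  have hd1 : DifferentiableAt ℝ γh a := hsm.differentiableAt (by simp)
  have hd2 : DifferentiableAt ℝ (fderiv ℝ γh) a :=
    (hsm.fderiv_right (m := 1) (by norm_num)).differentiableAt (by simp)
  have hd3 : HasFDerivAt (fun p ↦ chartOneForm lam (γ a) (γh p))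
      ((fderiv ℝ (chartOneForm lam (γ a)) (γh a)).comp (fderiv ℝ γh a)) a :=
    HasFDerivAt.comp a (g := chartOneForm lam (γ a)) hlam.hasFDerivAt hd1.hasFDerivAt
  have hder : ∀ e : D, HasFDerivAt (fun p ↦ lam (γ p) (mfderiv 𝓘(ℝ, D) 𝓘(ℝ, E) γ p e))
      _ a := fun e ↦ (hd3.clm_apply
        (hd2.hasFDerivAt.clm_apply (hasFDerivAt_const e a))).congr_of_eventuallyEq (hev e)
  refine ⟨fun e ↦ (hder e).differentiableAt, fun e e' ↦ ?_⟩
  have hm : ∀ e : D, (mfderiv 𝓘(ℝ, D) 𝓘(ℝ, E) γ a e : E) = fderiv ℝ γh a e := by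
    intro e
    rw [(hγ.mdifferentiableAt (by simp)).mfderiv]
    simp only [mfld_simps, fderivWithin_univ]
    rfl
  -- The second derivatives of the parametrisation cancel in the antisymmetrised expression; this is
  -- why `γ` must be `C^2`.
  have hsymm : fderiv ℝ (fderiv ℝ γh) a e e' = fderiv ℝ (fderiv ℝ γh) a e' e :=
    (hsm.isSymmSndFDerivAt (by simp)).eq e e'
  rw [(hder e).fderiv, (hder e').fderiv, extDerivOne, hm, hm]
  simp [hsymm]
  rfl

variable [FiniteDimensional ℝ E]

/-- In finite dimension a family of linear forms is differentiable as soon as its values on fixed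
vectors are. -/
lemma differentiableAt_chartOneForm
    {om : ∀ q : F, TangentSpace 𝓘(ℝ, E) q →L[ℝ] TangentSpace 𝓘(ℝ, E) q →L[ℝ] ℝ}
    (hom : ContMDiff 𝓘(ℝ, E) (𝓘(ℝ, E).prod 𝓘(ℝ, E →L[ℝ] E →L[ℝ] ℝ)) ∞
    (fun q ↦ Bundle.TotalSpace.mk' (E →L[ℝ] E →L[ℝ] ℝ)
      (E := fun q : F ↦ TangentSpace 𝓘(ℝ, E) q →L[ℝ] TangentSpace 𝓘(ℝ, E) q →L[ℝ] ℝ) q (om q)))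
    {Z : ∀ q : F, TangentSpace 𝓘(ℝ, E) q}
    (hs : ContMDiff 𝓘(ℝ, E) 𝓘(ℝ, E).tangent ∞ (fun q ↦ (⟨q, Z q⟩ : TangentBundle 𝓘(ℝ, E) F)))
    (q : F) :
    DifferentiableAt ℝ (chartOneForm (fun p ↦ om p (Z p)) q) (extChartAt 𝓘(ℝ, E) q q) := by
  set φ := extChartAt 𝓘(ℝ, E) q with hφ
  have hmem : φ.target ∈ 𝓝 (φ q) := extChartAt_target_mem_nhds q
  have : IsManifold 𝓘(ℝ, E) 2 F := .of_le (n := ∞) two_le_infty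
  have hsym : ContMDiffAt 𝓘(ℝ, E) 𝓘(ℝ, E) ∞ φ.symm (φ q) :=
    (contMDiffOn_extChartAt_symm q).contMDiffAt hmem
  have key : ∀ v : E, ContDiffAt ℝ 1 (fun y ↦ chartOneForm (fun p ↦ om p (Z p)) q y v) (φ q) := by
    intro v
    have h1 : ContMDiffAt 𝓘(ℝ, E) (𝓘(ℝ, E).prod 𝓘(ℝ, E →L[ℝ] E →L[ℝ] ℝ)) 1
      (fun y ↦ Bundle.TotalSpace.mk' (E →L[ℝ] E →L[ℝ] ℝ)
        (E := fun q : F ↦ TangentSpace 𝓘(ℝ, E) q →L[ℝ] TangentSpace 𝓘(ℝ, E) q →L[ℝ] ℝ)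
        (φ.symm y) (om (φ.symm y))) (φ q) :=
      ((hom (φ.symm (φ q))).comp (φ q) hsym).of_le (by simp)
    have h2 : ContMDiffAt 𝓘(ℝ, E) 𝓘(ℝ, E).tangent 1
        (fun y ↦ (⟨φ.symm y, Z (φ.symm y)⟩ : TangentBundle 𝓘(ℝ, E) F)) (φ q) :=
      ((hs (φ.symm (φ q))).comp (φ q) hsym).of_le (by simp)
    have h3 : ContMDiffAt 𝓘(ℝ, E) 𝓘(ℝ, E).tangent 1
        (fun y ↦ (⟨φ.symm y, mfderiv 𝓘(ℝ, E) 𝓘(ℝ, E) φ.symm y v⟩ : TangentBundle 𝓘(ℝ, E) F))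
        (φ q) :=
      contMDiffAt_mfderiv_const_apply hsym
        ((by norm_num : (1 : WithTop ℕ∞) + 1 = 2).trans_le two_le_infty) v
    have h5 := ContMDiffAt.clm_bundle_apply₂ (F₁ := E) (F₂ := E) (F₃ := ℝ)
      (E₁ := fun q : F ↦ TangentSpace 𝓘(ℝ, E) q) (E₂ := fun q : F ↦ TangentSpace 𝓘(ℝ, E) q)
      (E₃ := fun _ : F ↦ ℝ) h1 h2 h3
    rw [Bundle.contMDiffAt_totalSpace] at h5
    exact contMDiffAt_iff_contDiffAt.1 h5.2
  have h6 : ContDiffAt ℝ 1 (chartOneForm (fun p ↦ om p (Z p)) q) (φ q) := by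
    have hd : Module.finrank ℝ E = Module.finrank ℝ (Fin (Module.finrank ℝ E) → ℝ) := by simp
    let e₁ := ContinuousLinearEquiv.ofFinrankEq hd
    let e₂ := (e₁.arrowCongr (1 : ℝ ≃L[ℝ] ℝ)).trans
      (ContinuousLinearEquiv.piRing (𝕜 := ℝ) (E := ℝ) (Fin (Module.finrank ℝ E)))
    rw [← e₂.comp_contDiffAt_iff]
    exact contDiffAt_pi.2 fun i ↦ key _
  exact h6.differentiableAt (by simp)

end SurfaceFormula

end WeinsteinStab

namespace WeinsteinStab

/-! ### Scaling of the Liouville form under its flow -/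

section FlowPullback

variable {E : Type*} [NormedAddCommGroup E] [NormedSpace ℝ E]
  {F : Type*} [TopologicalSpace F] [ChartedSpace E F]

/-- The tangent space at `q` is the model space by means of the preferred chart at `q`, so this
derivative is literally the identity. -/
lemma hasMFDerivAt_extChartAt_symm_self (q : F) :
    HasMFDerivAt 𝓘(ℝ, E) 𝓘(ℝ, E) (extChartAt 𝓘(ℝ, E) q).symm (extChartAt 𝓘(ℝ, E) q q)
      (ContinuousLinearMap.id ℝ E) := by
  refine ⟨continuousAt_extChartAt_symm q, ?_⟩
  have h1 : writtenInExtChartAt 𝓘(ℝ, E) 𝓘(ℝ, E) (extChartAt 𝓘(ℝ, E) q q)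
      (extChartAt 𝓘(ℝ, E) q).symm =ᶠ[𝓝 (extChartAt 𝓘(ℝ, E) q q)] id := by
    filter_upwards [extChartAt_target_mem_nhds (I := 𝓘(ℝ, E)) q] with y hy
    simp only [writtenInExtChartAt, extChartAt_model_space_eq_id, PartialEquiv.refl_symm,
      PartialEquiv.refl_coe, Function.comp_id, Function.comp_apply, id_eq, extChartAt_to_inv]
    exact (extChartAt 𝓘(ℝ, E) q).right_inv hy
  simp only [mfld_simps] at h1 ⊢
  exact ((hasFDerivAt_id _).congr_of_eventuallyEq h1).hasFDerivWithinAt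

lemma eq_exp_mul_of_hasDerivAt_self {h : ℝ → ℝ} (hh : ∀ r, HasDerivAt h (h r) r) (s : ℝ) :
    h s = Real.exp s * h 0 := by
  have h1 : ∀ r, HasDerivAt (fun r ↦ Real.exp (-r) * h r) 0 r := by
    intro r
    have h2 : HasDerivAt (fun r ↦ Real.exp (-r) * h r)
        (Real.exp (-r) * (-1) * h r + Real.exp (-r) * h r) r :=
      ((hasDerivAt_id r).neg.exp).mul (hh r)
    convert h2 using 1
    ring
  have h3 := is_const_of_deriv_eq_zero (fun r ↦ (h1 r).differentiableAt) (fun r ↦ (h1 r).deriv) s 0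
  simp only [neg_zero, Real.exp_zero, one_mul] at h3
  rw [← h3, ← mul_assoc, ← Real.exp_add, add_neg_cancel, Real.exp_zero, one_mul]

variable [IsManifold 𝓘(ℝ, E) ∞ F] {Z : ∀ q : F, TangentSpace 𝓘(ℝ, E) q}
  {om : ∀ q : F, TangentSpace 𝓘(ℝ, E) q →L[ℝ] TangentSpace 𝓘(ℝ, E) q →L[ℝ] ℝ} {psi : F → ℝ}

lemma contMDiff_flow_time [T2Space F] [FiniteDimensional ℝ E] (hZ : IsCompleteVectorField Z)
    (hs : ContMDiff 𝓘(ℝ, E) 𝓘(ℝ, E).tangent ∞ (fun q ↦ (⟨q, Z q⟩ : TangentBundle 𝓘(ℝ, E) F)))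
    (t : ℝ) : ContMDiff 𝓘(ℝ, E) 𝓘(ℝ, E) ∞ (flow hZ t) :=
  (contMDiff_flow hZ hs).comp (contMDiff_const.prodMk contMDiff_id)

/-- The flow of a Liouville vector field rescales the Liouville form. -/
lemma liouville_flow_pullback [T2Space F] [FiniteDimensional ℝ E] (hW : IsWeinstein om Z psi)
    (s : ℝ) (q : F) (v : TangentSpace 𝓘(ℝ, E) q) :
    om (flow hW.complete s q) (Z (flow hW.complete s q))
      (mfderiv 𝓘(ℝ, E) 𝓘(ℝ, E) (flow hW.complete s) q v) = Real.exp s * om q (Z q) v := by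
  set φ := extChartAt 𝓘(ℝ, E) q with hφ
  set lam : ∀ q : F, TangentSpace 𝓘(ℝ, E) q →L[ℝ] ℝ := fun p ↦ om p (Z p) with hlam
  let γ : ℝ × E → F := fun p ↦ flow hW.complete p.1 (φ.symm p.2)
  have hq : φ.symm (φ q) = q := extChartAt_to_inv q
  have hγ : ∀ p : ℝ × E, p.2 ∈ φ.target → ContMDiffAt 𝓘(ℝ, ℝ × E) 𝓘(ℝ, E) ∞ γ p := by
    intro p hp
    have h1 : ContMDiffAt 𝓘(ℝ, E) 𝓘(ℝ, E) ∞ φ.symm p.2 :=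
      (contMDiffOn_extChartAt_symm q).contMDiffAt
        ((isOpen_extChartAt_target (I := 𝓘(ℝ, E)) q).mem_nhds hp)
    exact ContMDiffAt.comp p (contMDiff_flow hW.complete hW.smooth_field (p.1, φ.symm p.2))
      (contDiff_fst.contMDiff.contMDiffAt.prodMk
        (ContMDiffAt.comp p h1 contDiff_snd.contMDiff.contMDiffAt))
  have hm1 : ∀ p : ℝ × E, p.2 ∈ φ.target →
      (mfderiv 𝓘(ℝ, ℝ × E) 𝓘(ℝ, E) γ p ((1 : ℝ), (0 : E)) : E) = Z (γ p) := by
    intro p hp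
    have h1 : HasMFDerivAt 𝓘(ℝ, ℝ) 𝓘(ℝ, ℝ × E) (fun t : ℝ ↦ (t, p.2)) p.1
        (ContinuousLinearMap.inl ℝ ℝ E) := (hasFDerivAt_prodMk_left p.1 p.2).hasMFDerivAt
    have h2 := HasMFDerivAt.comp p.1 (g := γ)
      ((hγ p hp).mdifferentiableAt (by simp)).hasMFDerivAt h1
    have h3 := hasMFDerivAt_unique h2 (isMIntegralCurve_flow hW.complete (φ.symm p.2) p.1)
    have h4 := DFunLike.congr_fun h3 (1 : ℝ)
    refine h4.trans ?_
    exact one_smul ℝ (Z (γ p) : E)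
  have hmem : φ q ∈ φ.target := mem_extChartAt_target q
  have hm2 : ∀ r : ℝ, (mfderiv 𝓘(ℝ, ℝ × E) 𝓘(ℝ, E) γ (r, φ q) ((0 : ℝ), (v : E)) : E) =
      mfderiv 𝓘(ℝ, E) 𝓘(ℝ, E) (flow hW.complete r) q v := by
    intro r
    have h1 : HasMFDerivAt 𝓘(ℝ, E) 𝓘(ℝ, ℝ × E) (fun y : E ↦ (r, y)) (φ q)
        (ContinuousLinearMap.inr ℝ ℝ E) := (hasFDerivAt_prodMk_right r (φ q)).hasMFDerivAt
    have h2 := HasMFDerivAt.comp (φ q) (g := γ)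
      ((hγ (r, φ q) hmem).mdifferentiableAt (by simp)).hasMFDerivAt h1
    have h3 : HasMFDerivAt 𝓘(ℝ, E) 𝓘(ℝ, E) (flow hW.complete r) (φ.symm (φ q))
        (mfderiv 𝓘(ℝ, E) 𝓘(ℝ, E) (flow hW.complete r) q) := by
      rw [hq]
      exact ((contMDiff_flow_time hW.complete hW.smooth_field r).mdifferentiableAt
        (by simp)).hasMFDerivAt
    have h4 := HasMFDerivAt.comp (φ q) h3 (hasMFDerivAt_extChartAt_symm_self q)
    exact DFunLike.congr_fun (hasMFDerivAt_unique h2 h4) v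
  let β : ℝ × E → ℝ × E → ℝ := fun e p ↦ lam (γ p) (mfderiv 𝓘(ℝ, ℝ × E) 𝓘(ℝ, E) γ p e)
  have hder : ∀ r : ℝ, HasDerivAt (fun r ↦ β (0, v) (r, φ q)) (β (0, v) (r, φ q)) r := by
    intro r
    obtain ⟨h1, h2⟩ := fderiv_sub_fderiv_eq_extDerivOne (lam := lam) (γ := γ) (a := (r, φ q))
      (differentiableAt_chartOneForm hW.symplectic.smooth hW.smooth_field _)
      ((hγ (r, φ q) hmem).of_le two_le_infty)
    have h3 := h2 (1, 0) (0, v)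
    -- Since `λ(Z) = ω(Z, Z) = 0`, only the time derivative survives in `dλ(Z, v) = ω(Z, v) = λ(v)`.
    -- The value of `λ` on a transported vector thus satisfies `h' = h`.
    have h4 : (fun p ↦ lam (γ p) (mfderiv 𝓘(ℝ, ℝ × E) 𝓘(ℝ, E) γ p ((1 : ℝ), (0 : E))))
        =ᶠ[𝓝 (r, φ q)] fun _ ↦ 0 := by
      filter_upwards [continuousAt_snd.preimage_mem_nhds
        (extChartAt_target_mem_nhds (I := 𝓘(ℝ, E)) q)] with p hp
      exact (congrArg (lam (γ p)) (hm1 p hp)).trans (hW.symplectic.alternating _ _)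
    rw [h4.fderiv_eq, hW.liouville] at h3
    have h6 : (mfderiv 𝓘(ℝ, ℝ × E) 𝓘(ℝ, E) γ (r, φ q) ((1 : ℝ), (0 : E)) : E) = Z (γ (r, φ q)) :=
      hm1 _ hmem
    have h5 : fderiv ℝ (β (0, v)) (r, φ q) (1, 0) = β (0, v) (r, φ q) := by
      have h7 := congrArg (fun w : E ↦ om (γ (r, φ q)) w
        (mfderiv 𝓘(ℝ, ℝ × E) 𝓘(ℝ, E) γ (r, φ q) ((0 : ℝ), (v : E)))) h6
      refine Eq.trans ?_ (h3.trans h7)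
      simp
      rfl
    have h8 := (h1 (0, v)).hasFDerivAt.comp_hasDerivAt r
      ((hasDerivAt_id r).prodMk (hasDerivAt_const r (φ q)))
    have h9 : fderiv ℝ (fun p ↦ lam (γ p) (mfderiv 𝓘(ℝ, ℝ × E) 𝓘(ℝ, E) γ p ((0 : ℝ), (v : E))))
      (r, φ q) (1, 0) = β (0, v) (r, φ q) := h5
    rw [← h5]
    exact h8
  have h0 := eq_exp_mul_of_hasDerivAt_self hder s
  have hm2' : ∀ r, β (0, v) (r, φ q) = om (flow hW.complete r q) (Z (flow hW.complete r q))
      (mfderiv 𝓘(ℝ, E) 𝓘(ℝ, E) (flow hW.complete r) q v) := by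
    intro r
    have h1 : γ (r, φ q) = flow hW.complete r q := congrArg (flow hW.complete r) hq
    have h4 : ∀ (q q' : F) (_ : q = q') (u u' : E) (_ : u = u'),
        (lam q : E →L[ℝ] ℝ) u = (lam q' : E →L[ℝ] ℝ) u' := by
      rintro q _ rfl u _ rfl
      rfl
    exact h4 _ _ h1 _ _ (hm2 r)
  rw [hm2', hm2'] at h0
  rw [h0]
  congr 1
  have h5 : flow hW.complete 0 = (id : F → F) := by
    funext q
    simp
  rw [h5, mfderiv_id]
  rfl

end FlowPullback

end WeinsteinStab

namespace WeinsteinStab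

/-- The underlying set of the stabilization `F × ℂ × ℝ × S¹`. -/
abbrev Stab (F : Type*) := F × ℂ × ℝ × Circle

/-! ### Coordinates of tangent vectors of `F × ℂ × ℝ × S¹` -/

section Components

variable {E : Type*} [NormedAddCommGroup E] [NormedSpace ℝ E]
  {F : Type*} [TopologicalSpace F] [ChartedSpace E F]
  {D : Type*} [NormedAddCommGroup D] [NormedSpace ℝ D] {K : Type*} [TopologicalSpace K]
  {J : ModelWithCorners ℝ D K} {N : Type*} [TopologicalSpace N] [ChartedSpace K N]

lemma mfderiv_stab_fst {f : N → Stab F} {p : N} (hf : MDifferentiableAt J (modelStab E) f p)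
    (v : TangentSpace J p) :
    (mfderiv J 𝓘(ℝ, E) (fun p ↦ (f p).1) p v : E) = (mfderiv J (modelStab E) f p v).1 := by
  have h := mfderiv_comp p (mdifferentiableAt_fst (I := 𝓘(ℝ, E))
    (I' := 𝓘(ℝ, ℂ).prod (𝓘(ℝ, ℝ).prod (𝓡 1))) (x := f p)) hf
  rw [mfderiv_fst] at h
  exact DFunLike.congr_fun h v

lemma mfderiv_stab_snd {f : N → Stab F} {p : N} (hf : MDifferentiableAt J (modelStab E) f p)
    (v : TangentSpace J p) :
    (mfderiv J (𝓘(ℝ, ℂ).prod (𝓘(ℝ, ℝ).prod (𝓡 1))) (fun p ↦ (f p).2) p v :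
      ℂ × ℝ × EuclideanSpace ℝ (Fin 1)) = (mfderiv J (modelStab E) f p v).2 := by
  have h := mfderiv_comp p (mdifferentiableAt_snd (I := 𝓘(ℝ, E))
    (I' := 𝓘(ℝ, ℂ).prod (𝓘(ℝ, ℝ).prod (𝓡 1))) (x := f p)) hf
  rw [mfderiv_snd] at h
  exact DFunLike.congr_fun h v

lemma mfderiv_stab_complex {f : N → Stab F} {p : N} (hf : MDifferentiableAt J (modelStab E) f p)
    (v : TangentSpace J p) :
    mvfderiv J (fun p ↦ (f p).2.1) p v = (mfderiv J (modelStab E) f p v).2.1 := by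
  rw [← mfderiv_stab_snd hf]
  have h := mfderiv_comp p (mdifferentiableAt_fst (I := 𝓘(ℝ, ℂ))
    (I' := 𝓘(ℝ, ℝ).prod (𝓡 1)) (x := (f p).2)) hf.snd
  rw [mfderiv_fst] at h
  exact DFunLike.congr_fun h v

lemma mfderiv_stab_real {f : N → Stab F} {p : N} (hf : MDifferentiableAt J (modelStab E) f p)
    (v : TangentSpace J p) :
    mvfderiv J (fun p ↦ (f p).2.2.1) p v = (mfderiv J (modelStab E) f p v).2.2.1 := by
  rw [← mfderiv_stab_snd hf]
  have h := mfderiv_comp p (mdifferentiableAt_snd (I := 𝓘(ℝ, ℂ))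
    (I' := 𝓘(ℝ, ℝ).prod (𝓡 1)) (x := (f p).2)) hf.snd
  rw [mfderiv_snd] at h
  have h' := mfderiv_comp p (mdifferentiableAt_fst (I := 𝓘(ℝ, ℝ))
    (I' := 𝓡 1) (x := (f p).2.2)) hf.snd.snd
  rw [mfderiv_fst] at h'
  exact (DFunLike.congr_fun h' v).trans (congrArg Prod.fst (DFunLike.congr_fun h v))

lemma mfderiv_stab_circle {f : N → Stab F} {p : N} (hf : MDifferentiableAt J (modelStab E) f p)
    (v : TangentSpace J p) :
    (mfderiv J (𝓡 1) (fun p ↦ (f p).2.2.2) p v : EuclideanSpace ℝ (Fin 1)) =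
      (mfderiv J (modelStab E) f p v).2.2.2 := by
  rw [← mfderiv_stab_snd hf]
  have h := mfderiv_comp p (mdifferentiableAt_snd (I := 𝓘(ℝ, ℂ))
    (I' := 𝓘(ℝ, ℝ).prod (𝓡 1)) (x := (f p).2)) hf.snd
  rw [mfderiv_snd] at h
  have h' := mfderiv_comp p (mdifferentiableAt_snd (I := 𝓘(ℝ, ℝ))
    (I' := 𝓡 1) (x := (f p).2.2)) hf.snd.snd
  rw [mfderiv_snd] at h'
  exact (DFunLike.congr_fun h' v).trans (congrArg Prod.snd (DFunLike.congr_fun h v))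

/-! ### The angular form -/

lemma contMDiff_circle_coe : ContMDiff (𝓡 1) 𝓘(ℝ, ℂ) ∞ (fun u : Circle ↦ (u : ℂ)) := by
  have : Fact (Module.finrank ℝ ℂ = 1 + 1) := ⟨Complex.finrank_real_complex⟩
  exact contMDiff_coe_sphere

lemma mdifferentiableAt_circle_coe (u : Circle) :
    MDifferentiableAt (𝓡 1) 𝓘(ℝ, ℂ) (fun u : Circle ↦ (u : ℂ)) u :=
  contMDiff_circle_coe.mdifferentiableAt (by simp)

lemma dTheta_apply (u : Circle) (w : TangentSpace (𝓡 1) u) :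
    dTheta u w = (((u⁻¹ : Circle) : ℂ) *
      mvfderiv (𝓡 1) (fun u : Circle ↦ (u : ℂ)) u w).im := rfl

lemma dTheta_mfderiv {f : N → Circle} {p : N} (hf : MDifferentiableAt J (𝓡 1) f p)
    (v : TangentSpace J p) :
    dTheta (f p) (mfderiv J (𝓡 1) f p v) =
      ((((f p)⁻¹ : Circle) : ℂ) * mvfderiv J (fun p ↦ (f p : ℂ)) p v).im := by
  rw [dTheta_apply]
  have h := mfderiv_comp p (mdifferentiableAt_circle_coe (f p)) hf
  have h' := DFunLike.congr_fun h v
  exact congrArg (fun w : ℂ ↦ ((((f p)⁻¹ : Circle) : ℂ) * w).im) h'.symm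

/-- Differentiating `|u|² = 1` shows that `u⁻¹ du` is purely imaginary, so it is determined by its
imaginary part `dθ`. -/
lemma mvfderiv_circle_coe (u : Circle) (w : TangentSpace (𝓡 1) u) :
    mvfderiv (𝓡 1) (fun u : Circle ↦ (u : ℂ)) u w =
      Complex.I * u * dTheta u w := by
  set d : ℂ := mvfderiv (𝓡 1) (fun u : Circle ↦ (u : ℂ)) u w with hd
  have h1 : (((u⁻¹ : Circle) : ℂ) * d).re = 0 := by
    have h2 : (fun u : Circle ↦ Complex.normSq (u : ℂ)) = fun _ ↦ 1 := by
      funext u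
      simp
    have h3 : HasMFDerivAt (𝓡 1) 𝓘(ℝ, ℂ) (fun u : Circle ↦ (u : ℂ)) u _ :=
      (mdifferentiableAt_circle_coe u).hasMFDerivAt
    have h4 : HasFDerivAt (fun z : ℂ ↦ z.re * z.re + z.im * z.im)
        ((u : ℂ).re • Complex.reCLM + (u : ℂ).re • Complex.reCLM +
          ((u : ℂ).im • Complex.imCLM + (u : ℂ).im • Complex.imCLM)) (u : ℂ) :=
      (Complex.reCLM.hasFDerivAt.mul Complex.reCLM.hasFDerivAt).add
        (Complex.imCLM.hasFDerivAt.mul Complex.imCLM.hasFDerivAt)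
    have h5 := HasMFDerivAt.comp u (g := fun z : ℂ ↦ z.re * z.re + z.im * z.im)
      h4.hasMFDerivAt h3
    have h6 : HasMFDerivAt (𝓡 1) 𝓘(ℝ, ℝ)
      ((fun z : ℂ ↦ z.re * z.re + z.im * z.im) ∘ fun u : Circle ↦ (u : ℂ)) u 0 := by
      have : ((fun z : ℂ ↦ z.re * z.re + z.im * z.im) ∘ fun u : Circle ↦ (u : ℂ)) = fun _ ↦ 1 := h2
      rw [this]
      exact hasMFDerivAt_const _ _
    have h7 := DFunLike.congr_fun (hasMFDerivAt_unique h5 h6) w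
    have h8 : (u : ℂ).re * d.re + (u : ℂ).re * d.re + ((u : ℂ).im * d.im + (u : ℂ).im * d.im) = 0 :=
      h7
    rw [Circle.coe_inv_eq_conj]
    simp only [Complex.mul_re, Complex.conj_re, Complex.conj_im]
    linarith
  have h9 : ((u⁻¹ : Circle) : ℂ) * d = Complex.I * dTheta u w := by
    apply Complex.ext
    · rw [h1]
      simp
    · rw [dTheta_apply, ← hd]
      simp
  calc d = u * (((u⁻¹ : Circle) : ℂ) * d) := by
        rw [← mul_assoc, ← Circle.coe_mul, mul_inv_cancel, Circle.coe_one, one_mul]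
    _ = _ := by
        rw [h9]
        ring

end Components

end WeinsteinStab

namespace WeinsteinStab

/-! ### The contact form and the Liouville flow on the stabilization -/

section StabFlow

variable {E : Type*} [NormedAddCommGroup E] [NormedSpace ℝ E]
  {F : Type*} [TopologicalSpace F] [ChartedSpace E F]
  {D : Type*} [NormedAddCommGroup D] [NormedSpace ℝ D] {K : Type*} [TopologicalSpace K]
  {J : ModelWithCorners ℝ D K} {N : Type*} [TopologicalSpace N] [ChartedSpace K N]
  {Z : ∀ q : F, TangentSpace 𝓘(ℝ, E) q}
  {om : ∀ q : F, TangentSpace 𝓘(ℝ, E) q →L[ℝ] TangentSpace 𝓘(ℝ, E) q →L[ℝ] ℝ} {psi : F → ℝ}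

lemma alphaForm_apply (x : Stab F) (v : TangentSpace (modelStab E) x) :
    alphaForm om Z x v = om x.1 (Z x.1) v.1 + 1 / 2 * (conj x.2.1 * v.2.1).im
      + 2 * x.2.2.1 * dTheta x.2.2.2 v.2.2.2 := by
  change omegaPrime om x (zPrime Z x) v = _
  have h0 : dTheta x.2.2.2 (0 : EuclideanSpace ℝ (Fin 1)) = 0 := (dTheta x.2.2.2).map_zero
  simp only [omegaPrime, zPrime, h0, Complex.mul_im, Complex.mul_re, Complex.conj_re,
    Complex.conj_im]
  norm_num
  ring

lemma alphaForm_zPrime (hom : ∀ (q : F) (v : TangentSpace 𝓘(ℝ, E) q), om q v v = 0) (x : Stab F) :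
    alphaForm om Z x (zPrime Z x) = 0 := by
  have h : om x.1 (Z x.1) (Z x.1) = 0 := hom _ _
  rw [alphaForm_apply]
  have h0 : dTheta x.2.2.2 (0 : EuclideanSpace ℝ (Fin 1)) = 0 := (dTheta x.2.2.2).map_zero
  change om x.1 (Z x.1) (Z x.1) + 1 / 2 * (conj x.2.1 * ((1 / 2 : ℂ) * x.2.1)).im
    + 2 * x.2.2.1 * dTheta x.2.2.2 (0 : EuclideanSpace ℝ (Fin 1)) = 0
  rw [h, h0]
  simp
  ring

/-- The derivatives of the projections of the stabilization. -/
lemma hasMFDerivAt_stab_fst (x : Stab F) :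
    HasMFDerivAt (modelStab E) 𝓘(ℝ, E) (fun x : Stab F ↦ x.1) x
      (ContinuousLinearMap.fst ℝ E (ℂ × ℝ × EuclideanSpace ℝ (Fin 1))) := hasMFDerivAt_fst x

lemma hasMFDerivAt_stab_snd (x : Stab F) :
    HasMFDerivAt (modelStab E) (𝓘(ℝ, ℂ).prod (𝓘(ℝ, ℝ).prod (𝓡 1))) (fun x : Stab F ↦ x.2) x
      (ContinuousLinearMap.snd ℝ E (ℂ × ℝ × EuclideanSpace ℝ (Fin 1))) := hasMFDerivAt_snd x

lemma hasMFDerivAt_stab_complex (x : Stab F) :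
    HasMFDerivAt (modelStab E) 𝓘(ℝ, ℂ) (fun x : Stab F ↦ x.2.1) x
      ((ContinuousLinearMap.fst ℝ ℂ (ℝ × EuclideanSpace ℝ (Fin 1))).comp
        (ContinuousLinearMap.snd ℝ E (ℂ × ℝ × EuclideanSpace ℝ (Fin 1)))) :=
  HasMFDerivAt.comp x (hasMFDerivAt_fst x.2) (hasMFDerivAt_stab_snd x)

lemma hasMFDerivAt_stab_real (x : Stab F) :
    HasMFDerivAt (modelStab E) 𝓘(ℝ, ℝ) (fun x : Stab F ↦ x.2.2.1) x
      ((ContinuousLinearMap.fst ℝ ℝ (EuclideanSpace ℝ (Fin 1))).comp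
        ((ContinuousLinearMap.snd ℝ ℂ (ℝ × EuclideanSpace ℝ (Fin 1))).comp
          (ContinuousLinearMap.snd ℝ E (ℂ × ℝ × EuclideanSpace ℝ (Fin 1))))) :=
  HasMFDerivAt.comp x (hasMFDerivAt_fst x.2.2)
    (HasMFDerivAt.comp x (hasMFDerivAt_snd x.2) (hasMFDerivAt_stab_snd x))

lemma hasMFDerivAt_stab_circle (x : Stab F) :
    HasMFDerivAt (modelStab E) (𝓡 1) (fun x : Stab F ↦ x.2.2.2) x
      ((ContinuousLinearMap.snd ℝ ℝ (EuclideanSpace ℝ (Fin 1))).comp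
        ((ContinuousLinearMap.snd ℝ ℂ (ℝ × EuclideanSpace ℝ (Fin 1))).comp
          (ContinuousLinearMap.snd ℝ E (ℂ × ℝ × EuclideanSpace ℝ (Fin 1))))) :=
  HasMFDerivAt.comp x (hasMFDerivAt_snd x.2.2)
    (HasMFDerivAt.comp x (hasMFDerivAt_snd x.2) (hasMFDerivAt_stab_snd x))

/-! ### The Liouville flow on the stabilization -/

/-- The flow of `Z'`. -/
noncomputable def stabFlow (hZ : IsCompleteVectorField Z) (s : ℝ) (x : Stab F) : Stab F :=
  (flow hZ s x.1, (Real.exp (s / 2) : ℂ) * x.2.1, Real.exp s * x.2.2.1, x.2.2.2)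

section

variable (hZ : IsCompleteVectorField Z)

@[simp] lemma stabFlow_zero (x : Stab F) : stabFlow hZ 0 x = x := by
  simp [stabFlow]

variable [IsManifold 𝓘(ℝ, E) ∞ F]
  (hs : ContMDiff 𝓘(ℝ, E) 𝓘(ℝ, E).tangent ∞ (fun q ↦ (⟨q, Z q⟩ : TangentBundle 𝓘(ℝ, E) F)))

include hs

lemma stabFlow_add [T2Space F] (s t : ℝ) (x : Stab F) :
    stabFlow hZ (s + t) x = stabFlow hZ s (stabFlow hZ t x) := by
  simp only [stabFlow, flow_add hZ hs, Prod.mk.injEq, true_and, and_true]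
  constructor
  · rw [add_div, Real.exp_add]
    push_cast
    ring
  · rw [Real.exp_add]
    ring

variable [T2Space F] [FiniteDimensional ℝ E]

lemma contMDiff_stabFlow :
    ContMDiff (𝓘(ℝ, ℝ).prod (modelStab E)) (modelStab E) ∞
      (fun p : ℝ × Stab F ↦ stabFlow hZ p.1 p.2) := by
  have h2 : ContMDiff (𝓘(ℝ, ℝ).prod (modelStab E)) (modelStab E) ∞
      (fun p : ℝ × Stab F ↦ p.2) := contMDiff_snd
  have h1 : ContMDiff (𝓘(ℝ, ℝ).prod (modelStab E)) 𝓘(ℝ, ℝ) ∞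
      (fun p : ℝ × Stab F ↦ p.1) := contMDiff_fst
  have hg1 : ContDiff ℝ ∞ (fun p : ℝ × ℂ ↦ (Real.exp (p.1 / 2) : ℂ) * p.2) :=
    (Complex.ofRealCLM.contDiff.comp (Real.contDiff_exp.comp (contDiff_fst.div_const 2))).mul
      contDiff_snd
  have hg2 : ContDiff ℝ ∞ (fun p : ℝ × ℝ ↦ Real.exp p.1 * p.2) :=
    (Real.contDiff_exp.comp contDiff_fst).mul contDiff_snd
  exact ContMDiff.prodMk ((contMDiff_flow hZ hs).comp (h1.prodMk h2.fst))
    ((hg1.contMDiff.comp (h1.prodMk_space h2.snd.fst)).prodMk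
      ((hg2.contMDiff.comp (h1.prodMk_space h2.snd.snd.fst)).prodMk h2.snd.snd.snd))

lemma hasMFDerivAt_stabFlow_time (s : ℝ) (x : Stab F) :
    HasMFDerivAt (modelStab E) (modelStab E) (stabFlow hZ s) x
      (((mfderiv 𝓘(ℝ, E) 𝓘(ℝ, E) (flow hZ s) x.1 : E →L[ℝ] E).comp
        (ContinuousLinearMap.fst ℝ E (ℂ × ℝ × EuclideanSpace ℝ (Fin 1)))).prod
      ((((Real.exp (s / 2) : ℝ) • ContinuousLinearMap.id ℝ ℂ).comp
        ((ContinuousLinearMap.fst ℝ ℂ (ℝ × EuclideanSpace ℝ (Fin 1))).comp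
        (ContinuousLinearMap.snd ℝ E (ℂ × ℝ × EuclideanSpace ℝ (Fin 1))))).prod
      ((((Real.exp s : ℝ) • ContinuousLinearMap.id ℝ ℝ).comp
        ((ContinuousLinearMap.fst ℝ ℝ (EuclideanSpace ℝ (Fin 1))).comp
        ((ContinuousLinearMap.snd ℝ ℂ (ℝ × EuclideanSpace ℝ (Fin 1))).comp
          (ContinuousLinearMap.snd ℝ E (ℂ × ℝ × EuclideanSpace ℝ (Fin 1)))))).prod
      ((ContinuousLinearMap.snd ℝ ℝ (EuclideanSpace ℝ (Fin 1))).comp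
        ((ContinuousLinearMap.snd ℝ ℂ (ℝ × EuclideanSpace ℝ (Fin 1))).comp
          (ContinuousLinearMap.snd ℝ E (ℂ × ℝ × EuclideanSpace ℝ (Fin 1)))))))) := by
  have h1 := HasMFDerivAt.comp x (g := flow hZ s) (f := fun x : Stab F ↦ x.1)
    ((contMDiff_flow_time hZ hs s).mdifferentiableAt (x := x.1) (by simp)).hasMFDerivAt
    (hasMFDerivAt_stab_fst x)
  have hg2 : HasFDerivAt (fun z : ℂ ↦ (Real.exp (s / 2) : ℂ) * z)
      ((Real.exp (s / 2) : ℝ) • ContinuousLinearMap.id ℝ ℂ) x.2.1 := by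
    have h := (hasFDerivAt_id (𝕜 := ℝ) x.2.1).const_smul (Real.exp (s / 2))
    refine h.congr_of_eventuallyEq (Filter.Eventually.of_forall fun z ↦ ?_)
    simp
  have h2 := HasMFDerivAt.comp x (f := fun x : Stab F ↦ x.2.1) hg2.hasMFDerivAt
    (hasMFDerivAt_stab_complex (E := E) x)
  have hg3 : HasFDerivAt (fun z : ℝ ↦ Real.exp s * z)
      ((Real.exp s : ℝ) • ContinuousLinearMap.id ℝ ℝ) x.2.2.1 :=
    (hasFDerivAt_id (𝕜 := ℝ) x.2.2.1).const_smul (Real.exp s)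
  have h3 := HasMFDerivAt.comp x (f := fun x : Stab F ↦ x.2.2.1) hg3.hasMFDerivAt
    (hasMFDerivAt_stab_real (E := E) x)
  exact h1.prodMk (h2.prodMk (h3.prodMk (hasMFDerivAt_stab_circle x)))

omit hs in
/-- The flow of `Z'` rescales the contact form. -/
lemma alphaForm_mfderiv_stabFlow (hW : IsWeinstein om Z psi) (s : ℝ) (x : Stab F)
    (v : TangentSpace (modelStab E) x) :
    alphaForm om Z (stabFlow hW.complete s x)
      (mfderiv (modelStab E) (modelStab E) (stabFlow hW.complete s) x v) =
    Real.exp s * alphaForm om Z x v := by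
  rw [(hasMFDerivAt_stabFlow_time hW.complete hW.smooth_field s x).mfderiv, alphaForm_apply,
    alphaForm_apply]
  have h1 := liouville_flow_pullback hW s x.1 v.1
  have h2 : (conj ((Real.exp (s / 2) : ℂ) * x.2.1) * ((Real.exp (s / 2) : ℝ) • v.2.1)).im =
      Real.exp s * (conj x.2.1 * v.2.1).im := by
    have h3 : Real.exp s = Real.exp (s / 2) * Real.exp (s / 2) := by
      rw [← Real.exp_add, add_halves]
    rw [h3]
    simp only [Complex.mul_im, Complex.mul_re, Complex.conj_re, Complex.conj_im, Complex.smul_re,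
      Complex.smul_im, Complex.ofReal_re, Complex.ofReal_im, smul_eq_mul]
    ring
  have h4 : om (stabFlow hW.complete s x).1 (Z (stabFlow hW.complete s x).1)
      (mfderiv 𝓘(ℝ, E) 𝓘(ℝ, E) (flow hW.complete s) x.1 v.1) +
      1 / 2 * (conj ((Real.exp (s / 2) : ℂ) * x.2.1) * ((Real.exp (s / 2) : ℝ) • v.2.1)).im +
      2 * (Real.exp s * x.2.2.1) * dTheta x.2.2.2 v.2.2.2 =
      Real.exp s * (om x.1 (Z x.1) v.1 + 1 / 2 * (conj x.2.1 * v.2.1).im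
        + 2 * x.2.2.1 * dTheta x.2.2.2 v.2.2.2) := by
    rw [h2, show (stabFlow hW.complete s x).1 = flow hW.complete s x.1 from rfl, h1]
    ring
  exact h4

omit hs [IsManifold 𝓘(ℝ, E) ∞ F] [T2Space F] [FiniteDimensional ℝ E] in
lemma hasMFDerivAt_stabFlow_left (s : ℝ) (x : Stab F) :
    HasMFDerivAt 𝓘(ℝ, ℝ) (modelStab E) (fun s ↦ stabFlow hZ s x) s
      ((1 : ℝ →L[ℝ] ℝ).smulRight (zPrime Z (stabFlow hZ s x)) :
        ℝ →L[ℝ] (E × ℂ × ℝ × EuclideanSpace ℝ (Fin 1))) := by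
  have h1 := isMIntegralCurve_flow hZ x.1 s
  have hg2 : HasDerivAt (fun s : ℝ ↦ (Real.exp (s / 2) : ℂ) * x.2.1)
      ((1 / 2 : ℂ) * ((Real.exp (s / 2) : ℂ) * x.2.1)) s := by
    have h : HasDerivAt (fun s : ℝ ↦ (Real.exp (s / 2) : ℂ) * x.2.1)
        (((Real.exp (s / 2) * (1 / 2) : ℝ) : ℂ) * x.2.1) s :=
      (((hasDerivAt_id s).div_const 2).exp.ofReal_comp).mul_const x.2.1
    convert h using 1
    push_cast
    ring
  have hg3 : HasDerivAt (fun s : ℝ ↦ Real.exp s * x.2.2.1) (Real.exp s * x.2.2.1) s :=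
    (Real.hasDerivAt_exp s).mul_const _
  have h := h1.prodMk (hg2.hasFDerivAt.hasMFDerivAt.prodMk (hg3.hasFDerivAt.hasMFDerivAt.prodMk
    (hasMFDerivAt_const (I := 𝓘(ℝ, ℝ)) (I' := 𝓡 1) x.2.2.2 s)))
  refine HasMFDerivAt.congr_mfderiv h (ContinuousLinearMap.ext_ring ?_)
  refine Prod.ext rfl (Prod.ext ?_ (Prod.ext ?_ ?_))
  · change (1 : ℝ) • ((1 / 2 : ℂ) * ((Real.exp (s / 2) : ℂ) * x.2.1)) =
      (1 : ℝ) • ((1 / 2 : ℂ) * ((Real.exp (s / 2) : ℂ) * x.2.1))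
    rfl
  · change (1 : ℝ) • (Real.exp s * x.2.2.1) = (1 : ℝ) • (Real.exp s * x.2.2.1)
    rfl
  · change (0 : EuclideanSpace ℝ (Fin 1)) = (1 : ℝ) • (0 : EuclideanSpace ℝ (Fin 1))
    rw [smul_zero]

/-- The total derivative of the flow of `Z'`. -/
lemma mfderiv_stabFlow (p : ℝ × Stab F) (ds : ℝ) (v : TangentSpace (modelStab E) p.2) :
    (mfderiv (𝓘(ℝ, ℝ).prod (modelStab E)) (modelStab E)
      (fun p : ℝ × Stab F ↦ stabFlow hZ p.1 p.2) p (ds, v) :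
        E × ℂ × ℝ × EuclideanSpace ℝ (Fin 1)) =
      ds • zPrime Z (stabFlow hZ p.1 p.2) +
        mfderiv (modelStab E) (modelStab E) (stabFlow hZ p.1) p.2 v := by
  have h := mfderiv_prod_eq_add_apply (I := 𝓘(ℝ, ℝ)) (I' := modelStab E) (I'' := modelStab E)
    (f := fun p : ℝ × Stab F ↦ stabFlow hZ p.1 p.2) (p := p)
    (v := ((ds, v) : ℝ × E × ℂ × ℝ × EuclideanSpace ℝ (Fin 1)))
    ((contMDiff_stabFlow hZ hs).mdifferentiableAt (by simp))
  rw [(hasMFDerivAt_stabFlow_left hZ p.1 p.2).mfderiv] at h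
  exact h

end

end StabFlow

end WeinsteinStab

namespace WeinsteinStab

/-! ### The twist and its effect on the contact form -/

section Twist

variable {E : Type*} [NormedAddCommGroup E] [NormedSpace ℝ E]
  {F : Type*} [TopologicalSpace F] [ChartedSpace E F]
  {Z : ∀ q : F, TangentSpace 𝓘(ℝ, E) q}
  {om : ∀ q : F, TangentSpace 𝓘(ℝ, E) q →L[ℝ] TangentSpace 𝓘(ℝ, E) q →L[ℝ] ℝ} {psi : F → ℝ}

/-- The twist `(q, z, s, θ) ↦ (q, e^{ikθ} z, s - a |z|² / 4, θ)`. -/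
noncomputable def twist (a : ℝ) (k : ℤ) (x : Stab F) : Stab F :=
  (x.1, ((x.2.2.2 ^ k : Circle) : ℂ) * x.2.1, x.2.2.1 - a * Complex.normSq x.2.1 / 4, x.2.2.2)

omit [TopologicalSpace F] [ChartedSpace E F] in
@[simp] lemma twist_zero (x : Stab F) : twist 0 0 x = x := by
  simp [twist]

lemma normSq_circle_mul (u : Circle) (z : ℂ) : Complex.normSq (u * z) = Complex.normSq z := by
  simp

omit [TopologicalSpace F] in
lemma twist_twist (a b : ℝ) (k l : ℤ) (x : Stab F) :
    twist a k (twist b l x) = twist (a + b) (k + l) x := by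
  simp only [twist, normSq_circle_mul, Prod.mk.injEq, true_and, and_true]
  constructor
  · rw [zpow_add, Circle.coe_mul, mul_assoc]
  · ring

/-- The flow scales `z` by `e^{s/2}` and the real coordinate by `e^s`, so `|z|²` and the real
coordinate have the same weight and the shear is equivariant. -/
lemma stabFlow_twist (hZ : IsCompleteVectorField Z) (s a : ℝ) (k : ℤ) (x : Stab F) :
    stabFlow hZ s (twist a k x) = twist a k (stabFlow hZ s x) := by
  simp only [twist, stabFlow, Prod.mk.injEq, true_and, and_true]
  constructor
  · ring
  · have h : Real.exp s = Real.exp (s / 2) * Real.exp (s / 2) := by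
      rw [← Real.exp_add, add_halves]
    rw [Complex.normSq_mul, Complex.normSq_ofReal, ← h]
    ring

lemma contMDiff_circle_zpow (k : ℤ) : ContMDiff (𝓡 1) (𝓡 1) ∞ (fun u : Circle ↦ u ^ k) := by
  have : LieGroup (𝓡 1) ∞ Circle := .of_le (n := ω) le_top
  have : ContMDiffMul (𝓡 1) ∞ Circle := inferInstance
  cases k with
  | ofNat n => simpa using contMDiff_pow (I := 𝓡 1) (n := ∞) (G := Circle) n
  | negSucc n =>
    simpa [zpow_negSucc] using (contMDiff_pow (I := 𝓡 1) (n := ∞) (G := Circle) (n + 1)).inv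

lemma contDiff_normSq : ContDiff ℝ ∞ Complex.normSq := by
  have h : Complex.normSq = fun z : ℂ ↦ z.re * z.re + z.im * z.im := by
    funext z
    exact Complex.normSq_apply z
  rw [h]
  exact (Complex.reCLM.contDiff.mul Complex.reCLM.contDiff).add
    (Complex.imCLM.contDiff.mul Complex.imCLM.contDiff)

lemma contMDiff_twist (k : ℤ) :
    ContMDiff (𝓘(ℝ, ℝ).prod (modelStab E)) (modelStab E) ∞
      (fun p : ℝ × Stab F ↦ twist p.1 k p.2) := by
  have h2 : ContMDiff (𝓘(ℝ, ℝ).prod (modelStab E)) (modelStab E) ∞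
      (fun p : ℝ × Stab F ↦ p.2) := contMDiff_snd
  have h1 : ContMDiff (𝓘(ℝ, ℝ).prod (modelStab E)) 𝓘(ℝ, ℝ) ∞
      (fun p : ℝ × Stab F ↦ p.1) := contMDiff_fst
  have hu : ContMDiff (𝓘(ℝ, ℝ).prod (modelStab E)) 𝓘(ℝ, ℂ) ∞
      (fun p : ℝ × Stab F ↦ ((p.2.2.2.2 ^ k : Circle) : ℂ)) :=
    contMDiff_circle_coe.comp ((contMDiff_circle_zpow k).comp h2.snd.snd.snd)
  have hg1 : ContDiff ℝ ∞ (fun p : ℂ × ℂ ↦ p.1 * p.2) := contDiff_fst.mul contDiff_snd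
  have hg2 : ContDiff ℝ ∞ (fun p : ℝ × ℝ × ℂ ↦ p.2.1 - p.1 * Complex.normSq p.2.2 / 4) :=
    (contDiff_fst.comp contDiff_snd).sub ((contDiff_fst.mul
      (contDiff_normSq.comp (contDiff_snd.comp contDiff_snd))).div_const 4)
  exact ContMDiff.prodMk h2.fst ((hg1.contMDiff.comp (hu.prodMk_space h2.snd.fst)).prodMk
      ((hg2.contMDiff.comp (h1.prodMk_space (h2.snd.snd.fst.prodMk_space h2.snd.fst))).prodMk
        h2.snd.snd.snd))

lemma contMDiff_twist_right (a : ℝ) (k : ℤ) :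
    ContMDiff (modelStab E) (modelStab E) ∞ (fun x : Stab F ↦ twist a k x) :=
  ContMDiff.comp (g := fun p : ℝ × Stab F ↦ twist p.1 k p.2) (f := fun x ↦ (a, x))
    (I' := 𝓘(ℝ, ℝ).prod (modelStab E))
    (contMDiff_twist k) (contMDiff_const.prodMk contMDiff_id)

/-- The complex coordinate of the derivative of the twist. -/
lemma mvfderiv_twist_complex (k : ℤ) (x : Stab F) (v : TangentSpace (modelStab E) x) :
    mvfderiv (modelStab E) (fun x : Stab F ↦ ((x.2.2.2 ^ k : Circle) : ℂ) * x.2.1) x v =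
      ((x.2.2.2 ^ k : Circle) : ℂ) * (v.2.1 + k * Complex.I * dTheta x.2.2.2 v.2.2.2 * x.2.1) := by
  have hu : (x.2.2.2 : ℂ) ≠ 0 := Circle.coe_ne_zero _
  have h1 := HasMFDerivAt.comp x
    (f := fun x : Stab F ↦ x.2.2.2) (mdifferentiableAt_circle_coe x.2.2.2).hasMFDerivAt
    (hasMFDerivAt_stab_circle (E := E) x)
  have h2 : HasMFDerivAt (modelStab E) 𝓘(ℝ, ℂ × ℂ)
      (fun x : Stab F ↦ (((x.2.2.2 : Circle) : ℂ), x.2.1)) x _ :=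
    ⟨h1.1.prodMk (hasMFDerivAt_stab_complex (E := E) x).1,
      h1.2.prodMk (hasMFDerivAt_stab_complex (E := E) x).2⟩
  have h3 : HasFDerivAt (fun p : ℂ × ℂ ↦ p.1 ^ k * p.2) _ (((x.2.2.2 : Circle) : ℂ), x.2.1) :=
    HasFDerivAt.mul (HasFDerivAt.comp (g := fun w : ℂ ↦ w ^ k) (((x.2.2.2 : Circle) : ℂ), x.2.1)
      ((hasDerivAt_zpow k (x.2.2.2 : ℂ) (Or.inl hu)).hasFDerivAt.restrictScalars ℝ) hasFDerivAt_fst)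
      hasFDerivAt_snd
  have h4 := HasMFDerivAt.comp x h3.hasMFDerivAt h2
  have h5 : (fun x : Stab F ↦ ((x.2.2.2 ^ k : Circle) : ℂ) * x.2.1) =
      (fun p : ℂ × ℂ ↦ p.1 ^ k * p.2) ∘ fun x : Stab F ↦ (((x.2.2.2 : Circle) : ℂ), x.2.1) := by
    funext x
    simp
  have h6 := DFunLike.congr_fun h4.mfderiv v
  rw [h5]
  refine Eq.trans h6 ?_
  have h7 := mvfderiv_circle_coe x.2.2.2 v.2.2.2
  set w : ℂ := mvfderiv (𝓡 1) (fun u : Circle ↦ (u : ℂ)) x.2.2.2 v.2.2.2 with hw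
  change ((x.2.2.2 : ℂ) ^ k) • v.2.1 + x.2.1 • (w • ((k : ℂ) * (x.2.2.2 : ℂ) ^ (k - 1))) = _
  rw [h7, Circle.coe_zpow, zpow_sub_one₀ hu]
  simp only [smul_eq_mul]
  field_simp

/-- The twist with `a = k` preserves the contact form. -/
lemma alphaForm_mfderiv_twist (k : ℤ) (x : Stab F) (v : TangentSpace (modelStab E) x) :
    alphaForm om Z (twist k k x) (mfderiv (modelStab E) (modelStab E) (twist (k : ℝ) k) x v) =
      alphaForm om Z x v := by
  have hd : MDifferentiableAt (modelStab E) (modelStab E) (fun x : Stab F ↦ twist (k : ℝ) k x) x :=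
    (contMDiff_twist_right k k).mdifferentiableAt (by simp)
  rw [alphaForm_apply, alphaForm_apply]
  have e1 : (mfderiv (modelStab E) (modelStab E) (twist (k : ℝ) k) x v).1 = v.1 := by
    refine (mfderiv_stab_fst hd v).symm.trans ?_
    exact DFunLike.congr_fun (hasMFDerivAt_stab_fst x).mfderiv v
  have e2 := (mfderiv_stab_complex hd v).symm.trans (mvfderiv_twist_complex k x v)
  have e4 : (mfderiv (modelStab E) (modelStab E) (twist (k : ℝ) k) x v).2.2.2 = v.2.2.2 := by
    refine (mfderiv_stab_circle hd v).symm.trans ?_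
    exact DFunLike.congr_fun (hasMFDerivAt_stab_circle x).mfderiv v
  -- The rotation contributes `k |z|² dθ` to `Im(z̄ dz)`. Half of it is what the shear by `k |z|² /
  -- 4` removes from `2 s dθ`.
  have e5 : (conj (((x.2.2.2 ^ k : Circle) : ℂ) * x.2.1) * (((x.2.2.2 ^ k : Circle) : ℂ) *
      (v.2.1 + k * Complex.I * dTheta x.2.2.2 v.2.2.2 * x.2.1))).im =
      (conj x.2.1 * v.2.1).im + k * Complex.normSq x.2.1 * dTheta x.2.2.2 v.2.2.2 := by
    set w : Circle := x.2.2.2 ^ k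
    have h1 : conj (w : ℂ) * w = 1 := by
      rw [← Complex.normSq_eq_conj_mul_self]
      simp
    have h2 : conj ((w : ℂ) * x.2.1) * ((w : ℂ) *
        (v.2.1 + k * Complex.I * dTheta x.2.2.2 v.2.2.2 * x.2.1)) =
        (conj (w : ℂ) * w) * (conj x.2.1 * v.2.1 + (conj x.2.1 * x.2.1) *
          (k * dTheta x.2.2.2 v.2.2.2) * Complex.I) := by
      rw [map_mul]
      ring
    rw [h2, h1, one_mul, ← Complex.normSq_eq_conj_mul_self]
    have h3 : ((Complex.normSq x.2.1 : ℝ) : ℂ) * (k * dTheta x.2.2.2 v.2.2.2) * Complex.I =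
        ((Complex.normSq x.2.1 * (k * dTheta x.2.2.2 v.2.2.2) : ℝ) : ℂ) * Complex.I := by
      push_cast
      rfl
    rw [h3, Complex.add_im, Complex.im_ofReal_mul, Complex.I_im]
    ring
  have key : ∀ (v₁ : E) (v₂ : ℂ) (v₄ : EuclideanSpace ℝ (Fin 1)), v₁ = v.1 →
      v₂ = ((x.2.2.2 ^ k : Circle) : ℂ) *
        (v.2.1 + k * Complex.I * dTheta x.2.2.2 v.2.2.2 * x.2.1) → v₄ = v.2.2.2 →
      om x.1 (Z x.1) v₁ + 1 / 2 * (conj (((x.2.2.2 ^ k : Circle) : ℂ) * x.2.1) * v₂).im +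
        2 * (x.2.2.1 - k * Complex.normSq x.2.1 / 4) * dTheta x.2.2.2 v₄ =
      om x.1 (Z x.1) v.1 + 1 / 2 * (conj x.2.1 * v.2.1).im
        + 2 * x.2.2.1 * dTheta x.2.2.2 v.2.2.2 := by
    rintro _ _ _ rfl rfl rfl
    rw [e5]
    ring
  exact key _ _ _ e1 e2 e4

end Twist

end WeinsteinStab

namespace WeinsteinStab

/-! ### An implicit function theorem on manifolds -/

section Implicit

variable {E : Type*} [NormedAddCommGroup E] [NormedSpace ℝ E] [CompleteSpace E]
  {H : Type*} [TopologicalSpace H]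
  {I : ModelWithCorners ℝ E H} [I.Boundaryless] {M : Type*} [TopologicalSpace M] [ChartedSpace H M]
  [IsManifold I ∞ M]

/-- The implicit function theorem for a real equation on a boundaryless manifold. -/
lemma exists_contMDiffAt_implicit {f : M × ℝ → ℝ} {x₀ : M} {s₀ d : ℝ}
    (hf : ContMDiffAt (I.prod 𝓘(ℝ, ℝ)) 𝓘(ℝ, ℝ) ∞ f (x₀, s₀))
    (hd : HasDerivAt (fun s ↦ f (x₀, s)) d s₀) (hd0 : d ≠ 0) :
    ∃ τ : M → ℝ, ContMDiffAt I 𝓘(ℝ, ℝ) ∞ τ x₀ ∧ τ x₀ = s₀ ∧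
      ∀ᶠ x in 𝓝 x₀, f (x, τ x) = f (x₀, s₀) := by
  set φ := extChartAt I x₀ with hφ
  have hφx : φ.symm (φ x₀) = x₀ := extChartAt_to_inv x₀
  let g : E × ℝ → ℝ := fun p ↦ f (φ.symm p.1, p.2)
  let u : E × ℝ := (φ x₀, s₀)
  have hgu : g u = f (x₀, s₀) := by simp [g, u, hφx]
  have hsym : ContMDiffAt 𝓘(ℝ, E) I ∞ φ.symm (φ x₀) :=
    (contMDiffOn_extChartAt_symm x₀).contMDiffAt (extChartAt_target_mem_nhds x₀)
  have hg : ContDiffAt ℝ ∞ g u := by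
    rw [← contMDiffAt_iff_contDiffAt]
    have h1 : ContMDiffAt 𝓘(ℝ, E × ℝ) (I.prod 𝓘(ℝ, ℝ)) ∞ (fun p : E × ℝ ↦ (φ.symm p.1, p.2)) u :=
      (ContMDiffAt.comp u (g := φ.symm) (f := Prod.fst) hsym
        contDiff_fst.contMDiff.contMDiffAt).prodMk contDiff_snd.contMDiff.contMDiffAt
    refine ContMDiffAt.comp u (g := f) (f := fun p : E × ℝ ↦ (φ.symm p.1, p.2)) ?_ h1
    simpa only [u, hφx] using hf
  have hinv : (fderiv ℝ g u ∘L .inr ℝ E ℝ).IsInvertible := by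
    have h1 : HasFDerivAt (fun s ↦ g (φ x₀, s)) (fderiv ℝ g u ∘L .inr ℝ E ℝ) s₀ :=
      HasFDerivAt.comp (g := g) s₀ (hg.differentiableAt (by simp)).hasFDerivAt
        (hasFDerivAt_prodMk_right (φ x₀) s₀)
    have h2 : HasFDerivAt (fun s ↦ g (φ x₀, s)) (ContinuousLinearMap.toSpanSingleton ℝ d) s₀ := by
      simpa only [g, hφx] using hd.hasFDerivAt
    rw [h1.unique h2]
    refine ⟨ContinuousLinearEquiv.unitsEquivAut ℝ (Units.mk0 d hd0), ?_⟩
    ext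
    simp
  refine ⟨fun x ↦ hg.implicitFunction (by simp) hinv (φ x), ?_, ?_, ?_⟩
  · exact ContMDiffAt.comp x₀ (g := hg.implicitFunction (by simp) hinv) (f := φ)
      (contMDiffAt_iff_contDiffAt.2 (hg.contDiffAt_implicitFunction (by simp) hinv))
      contMDiffAt_extChartAt
  · exact hg.implicitFunction_apply_self (by simp) hinv
  · have h1 := (continuousAt_extChartAt (I := I) x₀).eventually
      (hg.eventually_apply_implicitFunction (by simp) hinv)
    filter_upwards [h1, extChartAt_source_mem_nhds (I := I) x₀] with x hx1 hx2
    have h3 : φ.symm (φ x) = x := φ.left_inv hx2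
    rw [hgu] at hx1
    change f (φ.symm (φ x), _) = _ at hx1
    rwa [h3] at hx1

end Implicit

/-! ### Projection to `{ψ' = c}` along the Liouville flow -/

section HittingTime

variable {E : Type*} [NormedAddCommGroup E] [NormedSpace ℝ E]
  {F : Type*} [TopologicalSpace F] [ChartedSpace E F] [IsManifold 𝓘(ℝ, E) ∞ F]
  {Z : ∀ q : F, TangentSpace 𝓘(ℝ, E) q}
  {om : ∀ q : F, TangentSpace 𝓘(ℝ, E) q →L[ℝ] TangentSpace 𝓘(ℝ, E) q →L[ℝ] ℝ} {psi : F → ℝ}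
  {c : ℝ}

lemma IsGradientLike.mfderiv_nonneg (h : IsGradientLike Z psi) (q : F) :
    (0 : ℝ) ≤ mvfderiv 𝓘(ℝ, E) psi q (Z q) := by
  obtain ⟨g, δ, G, -, hδ, hG, hle⟩ := h
  have hpos : ∀ v : TangentSpace 𝓘(ℝ, E) q, 0 ≤ g.inner q v v := by
    intro v
    by_cases hv : v = 0
    · subst hv
      simp
    · exact (g.pos q v hv).le
  exact (mul_nonneg (hδ q).le (add_nonneg (hpos _) (hpos _))).trans (hle q)

/-- The gradient-like inequality bounds `|Z|² + |dψ|²` by a positive multiple of `dψ(Z)`. -/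
lemma IsGradientLike.mfderiv_eq_zero (h : IsGradientLike Z psi) {q : F}
    (hq : mvfderiv 𝓘(ℝ, E) psi q (Z q) = 0) : mfderiv 𝓘(ℝ, E) 𝓘(ℝ, ℝ) psi q = 0 ∧ Z q = 0 := by
  obtain ⟨g, δ, G, -, hδ, hG, hle⟩ := h
  have hpos : ∀ v : TangentSpace 𝓘(ℝ, E) q, 0 ≤ g.inner q v v := by
    intro v
    by_cases hv : v = 0
    · subst hv
      simp
    · exact (g.pos q v hv).le
  have h1 : δ q * (g.inner q (Z q) (Z q) + g.inner q (G q) (G q)) ≤ 0 := (hle q).trans_eq hq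
  have h2 := nonpos_of_mul_nonpos_right h1 (hδ q)
  have h3 : ∀ v : TangentSpace 𝓘(ℝ, E) q, g.inner q v v ≤ 0 → v = 0 := by
    intro v hv
    by_contra hne
    exact absurd (g.pos q v hne) (not_lt.2 hv)
  have hG0 : G q = 0 := h3 _ (by linarith [hpos (Z q)])
  refine ⟨ContinuousLinearMap.ext fun v ↦ ?_, h3 _ (by linarith [hpos (G q)])⟩
  rw [← hG, hG0]
  simp
  rfl

/-- The derivative of `ψ'` along `Z'`. -/
noncomputable def liouvilleRate (Z : ∀ q : F, TangentSpace 𝓘(ℝ, E) q) (psi : F → ℝ) (x : Stab F) :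
    ℝ := mvfderiv 𝓘(ℝ, E) psi x.1 (Z x.1) + ‖x.2.1‖ ^ 2 + 2 * x.2.2.1 ^ 2

omit [IsManifold 𝓘(ℝ, E) ∞ F] in
lemma psiPrime_stabFlow (hZ : IsCompleteVectorField Z) (s : ℝ) (x : Stab F) :
    psiPrime psi (stabFlow hZ s x) =
      psi (flow hZ s x.1) + Real.exp s * ‖x.2.1‖ ^ 2 + (Real.exp s * x.2.2.1) ^ 2 := by
  have h : ‖(Real.exp (s / 2) : ℂ) * x.2.1‖ ^ 2 = Real.exp s * ‖x.2.1‖ ^ 2 := by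
    rw [norm_mul, mul_pow, Complex.norm_real, Real.norm_eq_abs, sq_abs, ← Real.exp_nat_mul]
    congr 2
    push_cast
    ring
  simp only [psiPrime, psiStab, stabFlow, h]

lemma hasDerivAt_psiPrime_stabFlow (hW : IsWeinstein om Z psi) (x : Stab F) (s : ℝ) :
    HasDerivAt (fun s ↦ psiPrime psi (stabFlow hW.complete s x))
      (liouvilleRate Z psi (stabFlow hW.complete s x)) s := by
  have h1 : HasDerivAt (fun s ↦ psi (flow hW.complete s x.1))
      (mvfderiv 𝓘(ℝ, E) psi (flow hW.complete s x.1) (Z (flow hW.complete s x.1))) s := by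
    have h2 := HasMFDerivAt.comp s (g := psi)
      (hW.morse.1.mdifferentiableAt (x := flow hW.complete s x.1) (by simp)).hasMFDerivAt
      (isMIntegralCurve_flow hW.complete x.1 s)
    have h3 : HasFDerivAt (fun s ↦ psi (flow hW.complete s x.1)) (_ : ℝ →L[ℝ] ℝ) s :=
      hasMFDerivAt_iff_hasFDerivAt.1 h2
    refine h3.hasDerivAt.congr_deriv ?_
    exact (congrArg (mvfderiv 𝓘(ℝ, E) psi (flow hW.complete s x.1))
      (one_smul ℝ (Z (flow hW.complete s x.1) : E)))
  have h4 : HasDerivAt (fun s ↦ Real.exp s * ‖x.2.1‖ ^ 2) (Real.exp s * ‖x.2.1‖ ^ 2) s :=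
    (Real.hasDerivAt_exp s).mul_const _
  have h5 : HasDerivAt (fun s ↦ (Real.exp s * x.2.2.1) ^ 2) (2 * (Real.exp s * x.2.2.1) ^ 2) s := by
    have h := ((Real.hasDerivAt_exp s).mul_const x.2.2.1).pow 2
    refine h.congr_deriv ?_
    simp only [Nat.cast_ofNat]
    ring
  have h6 : ∀ s, ‖(Real.exp (s / 2) : ℂ) * x.2.1‖ ^ 2 = Real.exp s * ‖x.2.1‖ ^ 2 := by
    intro s
    rw [norm_mul, mul_pow, Complex.norm_real, Real.norm_eq_abs, sq_abs, ← Real.exp_nat_mul]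
    congr 2
    push_cast
    ring
  have h7 := (h1.add h4).add h5
  rw [funext fun s ↦ psiPrime_stabFlow hW.complete s x]
  refine h7.congr_deriv ?_
  simp only [liouvilleRate, stabFlow, h6]
  rfl

lemma liouvilleRate_nonneg (hW : IsWeinstein om Z psi) (x : Stab F) :
    0 ≤ liouvilleRate Z psi x := by
  have h := hW.gradientLike.mfderiv_nonneg x.1
  unfold liouvilleRate
  positivity

lemma monotone_psiPrime_stabFlow (hW : IsWeinstein om Z psi) (x : Stab F) :
    Monotone fun s ↦ psiPrime psi (stabFlow hW.complete s x) := by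
  have hder := hasDerivAt_psiPrime_stabFlow hW x
  refine monotone_of_deriv_nonneg (fun s ↦ (hder s).differentiableAt) fun s ↦ ?_
  rw [(hder s).deriv]
  exact liouvilleRate_nonneg hW _

omit [IsManifold 𝓘(ℝ, E) ∞ F] in
lemma contMDiff_psiStab (hpsi : ContMDiff 𝓘(ℝ, E) 𝓘(ℝ, ℝ) ∞ psi) :
    ContMDiff (𝓘(ℝ, E).prod 𝓘(ℝ, ℂ)) 𝓘(ℝ, ℝ) ∞ (psiStab psi) :=
  (hpsi.comp contMDiff_fst).add
    ((contDiff_norm_sq ℝ (E := ℂ) (n := ∞)).contMDiff.comp contMDiff_snd)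

omit [IsManifold 𝓘(ℝ, E) ∞ F] in
lemma contMDiff_psiPrime (hpsi : ContMDiff 𝓘(ℝ, E) 𝓘(ℝ, ℝ) ∞ psi) :
    ContMDiff (modelStab E) 𝓘(ℝ, ℝ) ∞ (psiPrime psi) := by
  have h : ContMDiff (modelStab E) (modelStab E) ∞ (fun x : Stab F ↦ x) := contMDiff_id
  exact ((contMDiff_psiStab hpsi).comp (h.fst.prodMk h.snd.fst)).add
    ((contDiff_id.pow 2).contMDiff.comp h.snd.snd.fst)

/-- The rate is a sum of three nonnegative terms. If it vanished, then `z = 0`, `s = 0` and `dψ_F =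
0`, giving a critical point of `ψ` on the regular level `c`. -/
lemma liouvilleRate_pos (hW : IsWeinstein om Z psi) (hreg : IsRegularValueStab E (psiStab psi) c)
    {x : Stab F} (hx : x ∈ doubleCircle psi c) : 0 < liouvilleRate Z psi x := by
  refine lt_of_le_of_ne (liouvilleRate_nonneg hW x) fun h0 ↦ ?_
  have h1 := hW.gradientLike.mfderiv_nonneg x.1
  have h2 : mvfderiv 𝓘(ℝ, E) psi x.1 (Z x.1) = 0 ∧ ‖x.2.1‖ ^ 2 = 0 ∧ x.2.2.1 ^ 2 = 0 := by
    unfold liouvilleRate at h0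
    have := sq_nonneg ‖x.2.1‖
    have := sq_nonneg x.2.2.1
    refine ⟨?_, ?_, ?_⟩ <;> linarith
  obtain ⟨h3, -⟩ := hW.gradientLike.mfderiv_eq_zero h2.1
  have hz : x.2.1 = 0 := by simpa using h2.2.1
  have hx' : psiStab psi (x.1, x.2.1) = c := by
    have h5 : psiStab psi (x.1, x.2.1) + x.2.2.1 ^ 2 = c := hx
    linarith [h2.2.2]
  refine hreg _ hx' ?_
  have hd1 : HasMFDerivAt 𝓘(ℝ, E) 𝓘(ℝ, ℝ) psi x.1 0 := by
    rw [← h3]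
    exact (hW.morse.1.mdifferentiableAt (by simp)).hasMFDerivAt
  have hd2 : HasFDerivAt (fun z : ℂ ↦ ‖z‖ ^ 2) (0 : ℂ →L[ℝ] ℝ) x.2.1 := by
    have h := (hasStrictFDerivAt_norm_sq (F := ℂ) x.2.1).hasFDerivAt
    rw [hz] at h ⊢
    simpa using h
  have hd3 := (HasMFDerivAt.comp (x.1, x.2.1) hd1
      (hasMFDerivAt_fst (I := 𝓘(ℝ, E)) (I' := 𝓘(ℝ, ℂ)) (x.1, x.2.1))).add
    (HasMFDerivAt.comp (x.1, x.2.1) (f := Prod.snd) hd2.hasMFDerivAt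
      (hasMFDerivAt_snd (I := 𝓘(ℝ, E)) (I' := 𝓘(ℝ, ℂ)) (x.1, x.2.1)))
  have hd4 : HasMFDerivAt (𝓘(ℝ, E).prod 𝓘(ℝ, ℂ)) 𝓘(ℝ, ℝ) (psiStab psi) (x.1, x.2.1) 0 := by
    refine HasMFDerivAt.congr_mfderiv hd3 ?_
    ext v
    change (0 : ℝ) + 0 = 0
    simp
  exact hd4.mfderiv

/-- `ψ'` is nondecreasing along trajectories. Between two hitting times it would be constant,
contradicting the positive rate on the level set. -/
lemma stabFlow_mem_unique (hW : IsWeinstein om Z psi)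
    (hreg : IsRegularValueStab E (psiStab psi) c) {x : Stab F} {s t : ℝ}
    (hs : stabFlow hW.complete s x ∈ doubleCircle psi c)
    (ht : stabFlow hW.complete t x ∈ doubleCircle psi c) : s = t := by
  wlog hst : s < t generalizing s t
  · rcases lt_trichotomy s t with h | h | h
    · exact this hs ht h
    · exact h
    · exact (this ht hs h).symm
  exfalso
  set h := fun s ↦ psiPrime psi (stabFlow hW.complete s x) with hh
  have hder := hasDerivAt_psiPrime_stabFlow hW x
  have hmono : Monotone h := monotone_psiPrime_stabFlow hW x
  have hconst : ∀ r ∈ Set.Icc s t, h r = c := fun r hr ↦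
    le_antisymm ((hmono hr.2).trans_eq ht) (hs.symm.le.trans (hmono hr.1))
  have hm : (s + t) / 2 ∈ Set.Ioo s t := ⟨by linarith, by linarith⟩
  have h1 : h =ᶠ[𝓝 ((s + t) / 2)] fun _ ↦ c := by
    filter_upwards [Ioo_mem_nhds hm.1 hm.2] with r hr
    exact hconst r (Set.Ioo_subset_Icc_self hr)
  have h2 := (hder ((s + t) / 2)).unique ((hasDerivAt_const _ c).congr_of_eventuallyEq h1)
  exact (liouvilleRate_pos hW hreg (hconst _ (Set.Ioo_subset_Icc_self hm))).ne' h2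

/-- The points whose trajectory under the flow of `Z'` meets `{ψ' = c}`. -/
def hitDomain (hZ : IsCompleteVectorField Z) (psi : F → ℝ) (c : ℝ) : Set (Stab F) :=
  {x | ∃ s, stabFlow hZ s x ∈ doubleCircle psi c}

open Classical in
/-- The time at which the trajectory of `x` under the flow of `Z'` meets `{ψ' = c}`. -/
noncomputable def hitTime (hZ : IsCompleteVectorField Z) (psi : F → ℝ) (c : ℝ) (x : Stab F) : ℝ :=
  if h : ∃ s, stabFlow hZ s x ∈ doubleCircle psi c then h.choose else 0

/-- The projection to `{ψ' = c}` along the flow of `Z'`. -/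
noncomputable def hitPoint (hZ : IsCompleteVectorField Z) (psi : F → ℝ) (c : ℝ) (x : Stab F) :
    Stab F := stabFlow hZ (hitTime hZ psi c x) x

omit [IsManifold 𝓘(ℝ, E) ∞ F] in
lemma hitPoint_mem {hZ : IsCompleteVectorField Z} {x : Stab F} (hx : x ∈ hitDomain hZ psi c) :
    hitPoint hZ psi c x ∈ doubleCircle psi c := by
  have h : ∃ s, stabFlow hZ s x ∈ doubleCircle psi c := hx
  rw [hitPoint, hitTime, dif_pos h]
  exact h.choose_spec

omit [IsManifold 𝓘(ℝ, E) ∞ F] in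
lemma doubleCircle_subset_hitDomain (hZ : IsCompleteVectorField Z) :
    doubleCircle psi c ⊆ hitDomain hZ psi c := fun x hx ↦ ⟨0, by simpa using hx⟩

section

variable (hW : IsWeinstein om Z psi) (hreg : IsRegularValueStab E (psiStab psi) c)
include hreg

lemma hitTime_eq {x : Stab F} {s : ℝ} (hs : stabFlow hW.complete s x ∈ doubleCircle psi c) :
    hitTime hW.complete psi c x = s :=
  stabFlow_mem_unique hW hreg (hitPoint_mem ⟨s, hs⟩) hs

lemma hitTime_of_mem {x : Stab F} (hx : x ∈ doubleCircle psi c) :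
    hitTime hW.complete psi c x = 0 := hitTime_eq hW hreg (by simpa using hx)

lemma hitPoint_of_mem {x : Stab F} (hx : x ∈ doubleCircle psi c) :
    hitPoint hW.complete psi c x = x := by
  rw [hitPoint, hitTime_of_mem hW hreg hx, stabFlow_zero]

lemma hitPoint_stabFlow_of_mem [T2Space F] {x : Stab F} (hx : x ∈ doubleCircle psi c) (s : ℝ) :
    hitPoint hW.complete psi c (stabFlow hW.complete s x) = x := by
  have h1 : stabFlow hW.complete (-s) (stabFlow hW.complete s x) = x := by
    rw [← stabFlow_add hW.complete hW.smooth_field, neg_add_cancel, stabFlow_zero]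
  have h2 : hitTime hW.complete psi c (stabFlow hW.complete s x) = -s :=
    hitTime_eq hW hreg (by rwa [h1])
  rw [hitPoint, h2, h1]

lemma hitPoint_stabFlow [T2Space F] {x : Stab F} (hx : x ∈ hitDomain hW.complete psi c) (s : ℝ) :
    hitPoint hW.complete psi c (stabFlow hW.complete s x) = hitPoint hW.complete psi c x := by
  set τ := hitTime hW.complete psi c x with hτ
  have h : stabFlow hW.complete s x =
      stabFlow hW.complete (s - τ) (hitPoint hW.complete psi c x) := by
    rw [hitPoint, ← stabFlow_add hW.complete hW.smooth_field, sub_add_cancel]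
  rw [h, hitPoint_stabFlow_of_mem hW hreg (hitPoint_mem hx)]

variable [T2Space F] [FiniteDimensional ℝ E]

/-- The positive rate allows solving `ψ' = c` for the time by the implicit function theorem;
uniqueness of the hitting time identifies the local solution with `hitTime`. The domain is open for
the same reason. -/
lemma exists_contMDiffAt_hitTime {x : Stab F} (hx : x ∈ hitDomain hW.complete psi c) :
    ContMDiffAt (modelStab E) 𝓘(ℝ, ℝ) ∞ (hitTime hW.complete psi c) x ∧
      hitDomain hW.complete psi c ∈ 𝓝 x := by
  have : CompleteSpace E := FiniteDimensional.complete ℝ E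
  let f : Stab F × ℝ → ℝ := fun p ↦ psiPrime psi (stabFlow hW.complete p.2 p.1)
  have hf : ContMDiff ((modelStab E).prod 𝓘(ℝ, ℝ)) 𝓘(ℝ, ℝ) ∞ f :=
    ContMDiff.comp (g := psiPrime psi) (contMDiff_psiPrime hW.morse.1)
      (ContMDiff.comp (g := fun p : ℝ × Stab F ↦ stabFlow hW.complete p.1 p.2)
        (I' := 𝓘(ℝ, ℝ).prod (modelStab E)) (contMDiff_stabFlow hW.complete hW.smooth_field)
        (contMDiff_snd.prodMk contMDiff_fst))
  set s₀ := hitTime hW.complete psi c x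
  have hmem : stabFlow hW.complete s₀ x ∈ doubleCircle psi c := hitPoint_mem hx
  obtain ⟨τ, h1, h2, h3⟩ := exists_contMDiffAt_implicit (hf.contMDiffAt (x := (x, s₀)))
    (hasDerivAt_psiPrime_stabFlow hW x s₀) (liouvilleRate_pos hW hreg hmem).ne'
  have h4 : ∀ᶠ y in 𝓝 x, stabFlow hW.complete (τ y) y ∈ doubleCircle psi c := by
    filter_upwards [h3] with y hy
    exact hy.trans hmem
  constructor
  · refine h1.congr_of_eventuallyEq ?_
    filter_upwards [h4] with y hy
    exact hitTime_eq hW hreg hy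
  · filter_upwards [h4] with y hy
    exact ⟨_, hy⟩

lemma isOpen_hitDomain : IsOpen (hitDomain hW.complete psi c) :=
  isOpen_iff_mem_nhds.2 fun _ hx ↦ (exists_contMDiffAt_hitTime hW hreg hx).2

lemma contMDiffAt_hitPoint {x : Stab F} (hx : x ∈ hitDomain hW.complete psi c) :
    ContMDiffAt (modelStab E) (modelStab E) ∞ (hitPoint hW.complete psi c) x :=
  ContMDiffAt.comp x (g := fun p : ℝ × Stab F ↦ stabFlow hW.complete p.1 p.2)
    (I' := 𝓘(ℝ, ℝ).prod (modelStab E))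
    (contMDiff_stabFlow hW.complete hW.smooth_field).contMDiffAt
    ((exists_contMDiffAt_hitTime hW hreg hx).1.prodMk contMDiffAt_id)

lemma contMDiffOn_hitPoint :
    ContMDiffOn (modelStab E) (modelStab E) ∞ (hitPoint hW.complete psi c)
      (hitDomain hW.complete psi c) :=
  fun _ hx ↦ (contMDiffAt_hitPoint hW hreg hx).contMDiffWithinAt

end

end HittingTime

end WeinsteinStab

namespace WeinsteinStab

/-! ### The derivative of the projection -/

section HitDerivative

variable {E : Type*} [NormedAddCommGroup E] [NormedSpace ℝ E]
  {F : Type*} [TopologicalSpace F] [ChartedSpace E F] [IsManifold 𝓘(ℝ, E) ∞ F]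
  {Z : ∀ q : F, TangentSpace 𝓘(ℝ, E) q}
  {om : ∀ q : F, TangentSpace 𝓘(ℝ, E) q →L[ℝ] TangentSpace 𝓘(ℝ, E) q →L[ℝ] ℝ} {psi : F → ℝ}
  {c : ℝ}

lemma mvfderiv_psiPrime_zPrime (hW : IsWeinstein om Z psi) (x : Stab F) :
    mvfderiv (modelStab E) (psiPrime psi) x (zPrime Z x) = liouvilleRate Z psi x := by
  have h1 := hasDerivAt_psiPrime_stabFlow hW x 0
  have h2 := hasMFDerivAt_stabFlow_left hW.complete 0 x
  have h3 := HasMFDerivAt.comp (0 : ℝ) (g := psiPrime psi)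
    ((contMDiff_psiPrime hW.morse.1).mdifferentiableAt
      (x := stabFlow hW.complete 0 x) (by simp)).hasMFDerivAt h2
  have h4 : HasFDerivAt (fun s ↦ psiPrime psi (stabFlow hW.complete s x)) (_ : ℝ →L[ℝ] ℝ) 0 :=
    hasMFDerivAt_iff_hasFDerivAt.1 h3
  have h5 := h4.hasDerivAt.unique h1
  have h6 : ∀ y : Stab F, y = x →
      (mvfderiv (modelStab E) (psiPrime psi) y ((1 : ℝ) • zPrime Z y) : ℝ) =
        liouvilleRate Z psi y →
      mvfderiv (modelStab E) (psiPrime psi) x (zPrime Z x) = liouvilleRate Z psi x := by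
    rintro y rfl hy
    rwa [one_smul] at hy
  exact h6 _ (stabFlow_zero hW.complete x) h5

lemma zPrime_ne_zero (hW : IsWeinstein om Z psi) (hreg : IsRegularValueStab E (psiStab psi) c)
    {x : Stab F} (hx : x ∈ doubleCircle psi c) : zPrime Z x ≠ 0 := by
  intro h
  have h1 := mvfderiv_psiPrime_zPrime hW x
  rw [h, map_zero] at h1
  exact (liouvilleRate_pos hW hreg hx).ne h1

omit [IsManifold 𝓘(ℝ, E) ∞ F] in
lemma mfderiv_psiPrime_mfderiv_of_mapsTo (hpsi : ContMDiff 𝓘(ℝ, E) 𝓘(ℝ, ℝ) ∞ psi)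
    {N : Type*} [TopologicalSpace N] {D K : Type*}
    [NormedAddCommGroup D] [NormedSpace ℝ D] [TopologicalSpace K] {I : ModelWithCorners ℝ D K}
    [ChartedSpace K N] {g : N → Stab F} {x : N}
    (hg : MDifferentiableAt I (modelStab E) g x) (hgV : ∀ᶠ y in 𝓝 x, g y ∈ doubleCircle psi c)
    (v : TangentSpace I x) :
    mvfderiv (modelStab E) (psiPrime psi) (g x) (mfderiv I (modelStab E) g x v) = 0 := by
  have h1 := HasMFDerivAt.comp x (g := psiPrime psi)
    ((contMDiff_psiPrime hpsi).mdifferentiableAt (x := g x) (by simp)).hasMFDerivAt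
    hg.hasMFDerivAt
  have h2 : HasMFDerivAt I 𝓘(ℝ, ℝ) (psiPrime psi ∘ g) x 0 :=
    (hasMFDerivAt_const c x).congr_of_eventuallyEq hgV
  exact DFunLike.congr_fun (hasMFDerivAt_unique h1 h2) v

variable (hW : IsWeinstein om Z psi) (hreg : IsRegularValueStab E (psiStab psi) c)
  [T2Space F] [FiniteDimensional ℝ E]
include hW hreg

/-- The chain rule: besides the derivative of the flow at a fixed time, the variation of the hitting
time contributes a multiple of `Z'`. -/
lemma mfderiv_hitPoint {x : Stab F} (hx : x ∈ hitDomain hW.complete psi c)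
    (v : TangentSpace (modelStab E) x) :
    (mfderiv (modelStab E) (modelStab E) (hitPoint hW.complete psi c) x v :
      E × ℂ × ℝ × EuclideanSpace ℝ (Fin 1)) =
    mvfderiv (modelStab E) (hitTime hW.complete psi c) x v •
      zPrime Z (stabFlow hW.complete (hitTime hW.complete psi c x) x) +
    mfderiv (modelStab E) (modelStab E) (stabFlow hW.complete (hitTime hW.complete psi c x)) x v := by
  have h1 : MDifferentiableAt (modelStab E) 𝓘(ℝ, ℝ) (hitTime hW.complete psi c) x :=
    (exists_contMDiffAt_hitTime hW hreg hx).1.mdifferentiableAt (by simp)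
  have h2 := h1.hasMFDerivAt.prodMk (hasMFDerivAt_id x)
  have h3 := HasMFDerivAt.comp x (g := fun p : ℝ × Stab F ↦ stabFlow hW.complete p.1 p.2)
    (I' := 𝓘(ℝ, ℝ).prod (modelStab E))
    ((contMDiff_stabFlow hW.complete hW.smooth_field).mdifferentiableAt (by simp)).hasMFDerivAt h2
  have h4 := DFunLike.congr_fun h3.mfderiv v
  exact h4.trans (mfderiv_stabFlow hW.complete hW.smooth_field
    (hitTime hW.complete psi c x, x) _ v)

lemma eventually_hitPoint_mem {x : Stab F} (hx : x ∈ hitDomain hW.complete psi c) :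
    ∀ᶠ y in 𝓝 x, hitPoint hW.complete psi c y ∈ doubleCircle psi c := by
  filter_upwards [(isOpen_hitDomain hW hreg).mem_nhds hx] with y hy using hitPoint_mem hy

lemma mfderiv_psiPrime_mfderiv_hitPoint {x : Stab F} (hx : x ∈ hitDomain hW.complete psi c)
    (v : TangentSpace (modelStab E) x) :
    mvfderiv (modelStab E) (psiPrime psi) (hitPoint hW.complete psi c x)
      (mfderiv (modelStab E) (modelStab E) (hitPoint hW.complete psi c) x v) = 0 :=
  mfderiv_psiPrime_mfderiv_of_mapsTo hW.morse.1
    ((contMDiffAt_hitPoint hW hreg hx).mdifferentiableAt (by simp))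
    (eventually_hitPoint_mem hW hreg hx) v

/-- The difference between the image of `v` and `v` is a multiple of `Z'`. Both vectors are tangent
to the level set and `Z'` is transverse to it, so the multiple is zero. -/
lemma mfderiv_hitPoint_of_mem {x : Stab F} (hx : x ∈ doubleCircle psi c)
    {v : TangentSpace (modelStab E) x} (hv : mvfderiv (modelStab E) (psiPrime psi) x v = 0) :
    (mfderiv (modelStab E) (modelStab E) (hitPoint hW.complete psi c) x v :
      E × ℂ × ℝ × EuclideanSpace ℝ (Fin 1)) = v := by
  have hx' := doubleCircle_subset_hitDomain hW.complete hx
  have h1 := mfderiv_hitPoint hW hreg hx' v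
  have h2 := mfderiv_psiPrime_mfderiv_hitPoint hW hreg hx' v
  have h3 : stabFlow hW.complete (hitTime hW.complete psi c x) = id := by
    funext y
    rw [hitTime_of_mem hW hreg hx, stabFlow_zero, id]
  rw [h3, mfderiv_id] at h1
  have h4 : ∀ y : Stab F, y = x → ∀ w z : E × ℂ × ℝ × EuclideanSpace ℝ (Fin 1),
      z = zPrime Z x → ∀ v' : E × ℂ × ℝ × EuclideanSpace ℝ (Fin 1), v = v' →
      w = mvfderiv (modelStab E) (hitTime hW.complete psi c) x v • z + v' →
      (mvfderiv (modelStab E) (psiPrime psi) y w = 0) → w = v := by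
    rintro y rfl w _ rfl _ rfl rfl hw
    have h5 : mvfderiv (modelStab E) (psiPrime psi) y
      (mvfderiv (modelStab E) (hitTime hW.complete psi c) y v • zPrime Z y + v) = 0 := hw
    rw [map_add, map_smul, hv, mvfderiv_psiPrime_zPrime hW, add_zero, smul_eq_mul] at h5
    have h6 := (mul_eq_zero.1 h5).resolve_right (liouvilleRate_pos hW hreg hx).ne'
    simp only [h6]
    erw [zero_smul, zero_add]
  exact h4 _ (hitPoint_of_mem hW hreg hx) _ _ rfl _ rfl h1 h2

/-- The projection along the Liouville flow rescales the Liouville form. -/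
lemma alphaForm_mfderiv_hitPoint {x : Stab F} (hx : x ∈ hitDomain hW.complete psi c)
    (v : TangentSpace (modelStab E) x) :
    alphaForm om Z (hitPoint hW.complete psi c x)
      (mfderiv (modelStab E) (modelStab E) (hitPoint hW.complete psi c) x v) =
    Real.exp (hitTime hW.complete psi c x) * alphaForm om Z x v := by
  rw [← alphaForm_mfderiv_stabFlow hW]
  refine (congrArg (alphaForm om Z (hitPoint hW.complete psi c x))
    (mfderiv_hitPoint hW hreg hx v)).trans ?_
  refine ((alphaForm om Z (hitPoint hW.complete psi c x)).map_add _ _).trans ?_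
  -- The component coming from the variable hitting time is invisible, because `α(Z') = 0`.
  have h : alphaForm om Z (stabFlow hW.complete (hitTime hW.complete psi c x) x)
      (mvfderiv (modelStab E) (hitTime hW.complete psi c) x v •
        zPrime Z (stabFlow hW.complete (hitTime hW.complete psi c x) x)) = 0 := by
    rw [map_smul, alphaForm_zPrime hW.symplectic.alternating, smul_zero]
  exact (congrArg (· + _) h).trans (zero_add _)

end HitDerivative

/-! ### Extending maps of the hypersurface to an open set -/

section PermExt

variable {E : Type*} [NormedAddCommGroup E] [NormedSpace ℝ E]
  {F : Type*} [TopologicalSpace F] [ChartedSpace E F]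
  {Z : ∀ q : F, TangentSpace 𝓘(ℝ, E) q}
  {om : ∀ q : F, TangentSpace 𝓘(ℝ, E) q →L[ℝ] TangentSpace 𝓘(ℝ, E) q →L[ℝ] ℝ} {psi : F → ℝ}
  {c : ℝ}

open Classical in
/-- The extension of a permutation of `{ψ' = c}` which is constant along the flow of `Z'`. -/
noncomputable def permExt (hZ : IsCompleteVectorField Z) (f : Equiv.Perm (doubleCircle psi c))
    (x : Stab F) : Stab F :=
  if h : x ∈ hitDomain hZ psi c then f ⟨hitPoint hZ psi c x, hitPoint_mem h⟩ else x

lemma permExt_apply {hZ : IsCompleteVectorField Z} (f : Equiv.Perm (doubleCircle psi c))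
    {x : Stab F} (hx : x ∈ hitDomain hZ psi c) :
    permExt hZ f x = f ⟨hitPoint hZ psi c x, hitPoint_mem hx⟩ := dif_pos hx

lemma permExt_mem {hZ : IsCompleteVectorField Z} (f : Equiv.Perm (doubleCircle psi c))
    {x : Stab F} (hx : x ∈ hitDomain hZ psi c) : permExt hZ f x ∈ doubleCircle psi c := by
  rw [permExt_apply f hx]
  exact (f _).2

lemma permExt_one {hZ : IsCompleteVectorField Z} {x : Stab F} (hx : x ∈ hitDomain hZ psi c) :
    permExt hZ (1 : Equiv.Perm (doubleCircle psi c)) x = hitPoint hZ psi c x := by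
  rw [permExt_apply 1 hx]
  rfl

variable [IsManifold 𝓘(ℝ, E) ∞ F]

section

variable (hW : IsWeinstein om Z psi) (hreg : IsRegularValueStab E (psiStab psi) c)
  (f g : Equiv.Perm (doubleCircle psi c))
include hreg

lemma permExt_of_mem (x : doubleCircle psi c) : permExt hW.complete f x = f x := by
  rw [permExt_apply f (doubleCircle_subset_hitDomain _ x.2)]
  congr
  exact hitPoint_of_mem hW hreg x.2

lemma permExt_mul {x : Stab F} (hx : x ∈ hitDomain hW.complete psi c) :
    permExt hW.complete (f * g) x = permExt hW.complete f (permExt hW.complete g x) := by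
  rw [permExt_apply (f * g) hx, permExt_apply g hx, permExt_of_mem hW hreg]
  rfl

lemma permExt_hitPoint {x : Stab F} (hx : x ∈ hitDomain hW.complete psi c) :
    permExt hW.complete f (hitPoint hW.complete psi c x) = permExt hW.complete f x := by
  rw [← permExt_one hx, ← permExt_mul hW hreg f 1 hx, mul_one]

variable [T2Space F] [FiniteDimensional ℝ E]

variable {f}

/-- After projection to the hypersurface only the values of the map itself matter, so every local
extension yields the same germ. Smoothness and derivatives of `permExt` are read off from it. -/
lemma IsLocalExtension.eventuallyEq_permExt {U : Set (Stab F)} {e : Stab F → Stab F}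
    (he : IsLocalExtension (modelStab E) (modelStab E) (fun y : doubleCircle psi c ↦ (f y : Stab F))
      U e) {x : Stab F} (hx : x ∈ hitDomain hW.complete psi c)
    (hxU : hitPoint hW.complete psi c x ∈ U) :
    permExt hW.complete f =ᶠ[𝓝 x] e ∘ hitPoint hW.complete psi c := by
  have h1 := (contMDiffAt_hitPoint hW hreg hx).continuousAt.preimage_mem_nhds (he.1.mem_nhds hxU)
  filter_upwards [h1, (isOpen_hitDomain hW hreg).mem_nhds hx] with y hy1 hy2
  rw [permExt_apply f hy2]
  exact he.2.2 ⟨_, hitPoint_mem hy2⟩ hy1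

lemma contMDiffAt_permExt
    (hf : IsSmoothOnSubset (modelStab E) (modelStab E) (fun y : doubleCircle psi c ↦ (f y : Stab F)))
    {x : Stab F} (hx : x ∈ hitDomain hW.complete psi c) :
    ContMDiffAt (modelStab E) (modelStab E) ∞ (permExt hW.complete f) x := by
  obtain ⟨U, e, hxU, he⟩ := hf ⟨_, hitPoint_mem hx⟩
  refine ContMDiffAt.congr_of_eventuallyEq ?_ (he.eventuallyEq_permExt hW hreg hx hxU)
  exact ContMDiffAt.comp x (he.2.1.contMDiffAt (he.1.mem_nhds hxU)) (contMDiffAt_hitPoint hW hreg hx)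

lemma isLocalExtension_permExt
    (hf : IsSmoothOnSubset (modelStab E) (modelStab E) (fun y : doubleCircle psi c ↦ (f y : Stab F))) :
    IsLocalExtension (modelStab E) (modelStab E) (fun y : doubleCircle psi c ↦ (f y : Stab F))
      (hitDomain hW.complete psi c) (permExt hW.complete f) :=
  ⟨isOpen_hitDomain hW hreg, fun _ hx ↦ (contMDiffAt_permExt hW hreg hf hx).contMDiffWithinAt,
    fun y _ ↦ (permExt_of_mem hW hreg f y).symm⟩

/-- The derivative of a local extension in directions tangent to `{ψ' = c}` does not depend on the
extension. -/
lemma IsLocalExtension.mfderiv_eq_permExt {U : Set (Stab F)} {e : Stab F → Stab F}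
    (he : IsLocalExtension (modelStab E) (modelStab E) (fun y : doubleCircle psi c ↦ (f y : Stab F))
      U e) {x : Stab F} (hx : x ∈ doubleCircle psi c) (hxU : x ∈ U)
    {v : TangentSpace (modelStab E) x} (hv : mvfderiv (modelStab E) (psiPrime psi) x v = 0) :
    (mfderiv (modelStab E) (modelStab E) (permExt hW.complete f) x v :
      E × ℂ × ℝ × EuclideanSpace ℝ (Fin 1)) = mfderiv (modelStab E) (modelStab E) e x v := by
  have hx' := doubleCircle_subset_hitDomain hW.complete hx
  have hπ := hitPoint_of_mem hW hreg hx
  have hxU' : hitPoint hW.complete psi c x ∈ U := by rwa [hπ]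
  have h1 := (he.eventuallyEq_permExt hW hreg hx' hxU').mfderiv_eq (I := modelStab E)
    (I' := modelStab E)
  have h2 := mfderiv_comp x (g := e) (f := hitPoint hW.complete psi c) (I' := modelStab E)
    ((he.2.1.contMDiffAt (he.1.mem_nhds hxU')).mdifferentiableAt (by simp))
    ((contMDiffAt_hitPoint hW hreg hx').mdifferentiableAt (by simp))
  have h3 := DFunLike.congr_fun (h1.trans h2) v
  refine h3.trans ?_
  -- The projection fixes `x` and its derivative fixes the tangent vector `v`, so composing with it
  -- is harmless.
  have h4 : ∀ y : Stab F, y = x → ∀ w : E × ℂ × ℝ × EuclideanSpace ℝ (Fin 1), w = v →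
      (mfderiv (modelStab E) (modelStab E) e y w : E × ℂ × ℝ × EuclideanSpace ℝ (Fin 1)) =
        mfderiv (modelStab E) (modelStab E) e x v := by
    rintro y rfl w rfl
    rfl
  exact h4 _ hπ _ (mfderiv_hitPoint_of_mem hW hreg hx hv)

lemma mfderiv_psiPrime_mfderiv_permExt
    (hf : IsSmoothOnSubset (modelStab E) (modelStab E) (fun y : doubleCircle psi c ↦ (f y : Stab F)))
    {x : Stab F} (hx : x ∈ hitDomain hW.complete psi c) (v : TangentSpace (modelStab E) x) :
    mvfderiv (modelStab E) (psiPrime psi) (permExt hW.complete f x)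
      (mfderiv (modelStab E) (modelStab E) (permExt hW.complete f) x v) = 0 := by
  refine mfderiv_psiPrime_mfderiv_of_mapsTo (c := c) hW.morse.1
    ((contMDiffAt_permExt hW hreg hf hx).mdifferentiableAt (by simp)) ?_ v
  filter_upwards [(isOpen_hitDomain hW hreg).mem_nhds hx] with y hy using permExt_mem f hy

variable {g}

lemma mfderiv_permExt_mul
    (hf : IsSmoothOnSubset (modelStab E) (modelStab E) (fun y : doubleCircle psi c ↦ (f y : Stab F)))
    (hg : IsSmoothOnSubset (modelStab E) (modelStab E) (fun y : doubleCircle psi c ↦ (g y : Stab F)))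
    {x : Stab F} (hx : x ∈ hitDomain hW.complete psi c) (v : TangentSpace (modelStab E) x) :
    (mfderiv (modelStab E) (modelStab E) (permExt hW.complete (f * g)) x v :
      E × ℂ × ℝ × EuclideanSpace ℝ (Fin 1)) =
    mfderiv (modelStab E) (modelStab E) (permExt hW.complete f) (permExt hW.complete g x)
      (mfderiv (modelStab E) (modelStab E) (permExt hW.complete g) x v) := by
  have h1 : permExt hW.complete (f * g) =ᶠ[𝓝 x] permExt hW.complete f ∘ permExt hW.complete g := by
    filter_upwards [(isOpen_hitDomain hW hreg).mem_nhds hx] with y hy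
    exact permExt_mul hW hreg f g hy
  have h2 := mfderiv_comp x (g := permExt hW.complete f) (f := permExt hW.complete g)
    (I := modelStab E) (I' := modelStab E) (I'' := modelStab E)
    ((contMDiffAt_permExt hW hreg hf (doubleCircle_subset_hitDomain _
      (permExt_mem g hx))).mdifferentiableAt (by simp))
    ((contMDiffAt_permExt hW hreg hg hx).mdifferentiableAt (by simp))
  exact DFunLike.congr_fun (h1.mfderiv_eq.trans h2) v

lemma mfderiv_permExt_one {x : Stab F} (hx : x ∈ doubleCircle psi c)
    {v : TangentSpace (modelStab E) x} (hv : mvfderiv (modelStab E) (psiPrime psi) x v = 0) :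
    (mfderiv (modelStab E) (modelStab E)
      (permExt hW.complete (1 : Equiv.Perm (doubleCircle psi c))) x v :
      E × ℂ × ℝ × EuclideanSpace ℝ (Fin 1)) = v := by
  have hx' := doubleCircle_subset_hitDomain hW.complete hx
  have h1 : permExt hW.complete (1 : Equiv.Perm (doubleCircle psi c)) =ᶠ[𝓝 x]
      hitPoint hW.complete psi c := by
    filter_upwards [(isOpen_hitDomain hW hreg).mem_nhds hx'] with y hy using permExt_one hy
  exact (DFunLike.congr_fun (h1.mfderiv_eq (I := modelStab E) (I' := modelStab E)) v).trans
    (mfderiv_hitPoint_of_mem hW hreg hx hv)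

/-- The derivative of a diffeomorphism of `{ψ' = c}` maps onto the tangent space. -/
lemma exists_mfderiv_permExt_eq (hf : IsDiffeo (modelStab E) f) {x : Stab F}
    (hx : x ∈ doubleCircle psi c)
    {w : TangentSpace (modelStab E) (permExt hW.complete f x)}
    (hw : mvfderiv (modelStab E) (psiPrime psi) (permExt hW.complete f x) w = 0) :
    ∃ v : TangentSpace (modelStab E) x, mvfderiv (modelStab E) (psiPrime psi) x v = 0 ∧
      (mfderiv (modelStab E) (modelStab E) (permExt hW.complete f) x v :
      E × ℂ × ℝ × EuclideanSpace ℝ (Fin 1)) = w := by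
  have hx' := doubleCircle_subset_hitDomain hW.complete hx
  have hyV : permExt hW.complete f x ∈ doubleCircle psi c := permExt_mem f hx'
  have hy' := doubleCircle_subset_hitDomain hW.complete hyV
  have hyx : permExt hW.complete f⁻¹ (permExt hW.complete f x) = x := by
    rw [← permExt_mul hW hreg _ _ hx', inv_mul_cancel, permExt_one hx',
      hitPoint_of_mem hW hreg hx]
  -- The preimage of `w` is its image under the derivative of the extension of `f⁻¹`.
  have h1 := mfderiv_permExt_mul hW hreg (f := f) (g := f⁻¹) hf.1 hf.2 hy' w
  have h2 := mfderiv_psiPrime_mfderiv_permExt hW hreg (f := f⁻¹) hf.2 hy' w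
  have h3 : (mfderiv (modelStab E) (modelStab E) (permExt hW.complete (f * f⁻¹))
      (permExt hW.complete f x) w :
      E × ℂ × ℝ × EuclideanSpace ℝ (Fin 1)) = w := by
    rw [mul_inv_cancel]
    exact mfderiv_permExt_one hW hreg hyV hw
  have h4 : ∀ z : Stab F, z = x → ∀ v : TangentSpace (modelStab E) z,
      mvfderiv (modelStab E) (psiPrime psi) z v = 0 →
      (mfderiv (modelStab E) (modelStab E) (permExt hW.complete f) z v :
        E × ℂ × ℝ × EuclideanSpace ℝ (Fin 1)) = w →
      ∃ v : TangentSpace (modelStab E) x, mvfderiv (modelStab E) (psiPrime psi) x v = 0 ∧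
      (mfderiv (modelStab E) (modelStab E) (permExt hW.complete f) x v :
      E × ℂ × ℝ × EuclideanSpace ℝ (Fin 1)) = w := by
    rintro z rfl v hv1 hv2
    exact ⟨v, hv1, hv2⟩
  exact h4 _ hyx _ h2 (h1.symm.trans h3)

end

end PermExt

end WeinsteinStab

namespace WeinsteinStab

/-! ### The twist as a contactomorphism of the hypersurface -/

section TwistPerm

variable {E : Type*} [NormedAddCommGroup E] [NormedSpace ℝ E]
  {F : Type*} [TopologicalSpace F] [ChartedSpace E F] [IsManifold 𝓘(ℝ, E) ∞ F]
  {Z : ∀ q : F, TangentSpace 𝓘(ℝ, E) q}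
  {om : ∀ q : F, TangentSpace 𝓘(ℝ, E) q →L[ℝ] TangentSpace 𝓘(ℝ, E) q →L[ℝ] ℝ} {psi : F → ℝ}
  {c : ℝ}

/-- Where `z = 0` the twist is the identity. Elsewhere the term `e^t |z|²` drives `ψ'` above `c`
forwards. Backwards the `z` and `s` terms tend to 0, while `ψ_F` does not exceed its initial value,
which is below `c` by at least `|z|²`. The intermediate value theorem concludes. -/
lemma twist_mem_hitDomain (hW : IsWeinstein om Z psi) (a : ℝ) (k : ℤ) {x : Stab F}
    (hx : x ∈ doubleCircle psi c) : twist a k x ∈ hitDomain hW.complete psi c := by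
  by_cases hz : x.2.1 = 0
  · have h : twist a k x = x := by
      obtain ⟨q, z, s, u⟩ := x
      obtain rfl : z = 0 := hz
      simp [twist]
    rw [h]
    exact doubleCircle_subset_hitDomain _ hx
  have hA : 0 < ‖x.2.1‖ ^ 2 := by positivity
  set h : ℝ → ℝ := fun t ↦ psiPrime psi (stabFlow hW.complete t (twist a k x)) with hh
  have hform : ∀ t, h t = psi (flow hW.complete t x.1) + Real.exp t * ‖x.2.1‖ ^ 2 +
      (Real.exp t * (twist a k x).2.2.1) ^ 2 := by
    intro t
    have h1 : ‖((x.2.2.2 ^ k : Circle) : ℂ) * x.2.1‖ = ‖x.2.1‖ := by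
      rw [norm_mul, Circle.norm_coe, one_mul]
    simp only [hh, psiPrime_stabFlow]
    congr 3
    exact congrArg (· ^ 2) h1
  have hcont : Continuous h := continuous_iff_continuousAt.2 fun t ↦
    (hasDerivAt_psiPrime_stabFlow hW (twist a k x) t).continuousAt
  have hlow : ∃ t, h t ≤ c := by
    have h1 : Filter.Tendsto (fun t ↦ Real.exp t * ‖x.2.1‖ ^ 2 +
        (Real.exp t * (twist a k x).2.2.1) ^ 2) Filter.atBot (𝓝 0) := by
      have h2 := (Real.tendsto_exp_atBot.mul_const (‖x.2.1‖ ^ 2)).add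
        ((Real.tendsto_exp_atBot.mul_const (twist a k x).2.2.1).pow 2)
      simpa using h2
    obtain ⟨t, ht1, ht2⟩ :=
      ((h1.eventually (gt_mem_nhds hA)).and (Filter.eventually_le_atBot 0)).exists
    -- On the auxiliary trajectory with `z = s = 0` the function `ψ'` is `ψ_F`, so this is
    -- monotonicity of `ψ_F` along the flow of `Z_F`.
    have h3 := monotone_psiPrime_stabFlow hW ((x.1, 0, 0, 1) : Stab F) ht2
    simp only [psiPrime_stabFlow, flow_zero] at h3
    have h4 : psi x.1 + ‖x.2.1‖ ^ 2 + x.2.2.1 ^ 2 = c := hx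
    refine ⟨t, ?_⟩
    rw [hform]
    have := sq_nonneg x.2.2.1
    norm_num at h3
    linarith
  have hhigh : ∃ t, c ≤ h t := by
    obtain ⟨b, hb⟩ := hW.exhausting.2
    obtain ⟨t, ht⟩ := ((Real.tendsto_exp_atTop.atTop_mul_const hA).eventually_ge_atTop
      (c - b)).exists
    refine ⟨t, ?_⟩
    rw [hform]
    have h1 := hb (Set.mem_range_self (flow hW.complete t x.1))
    have := sq_nonneg (Real.exp t * (twist a k x).2.2.1)
    linarith
  exact mem_range_of_exists_le_of_exists_ge hcont hlow hhigh

variable (hW : IsWeinstein om Z psi) (hreg : IsRegularValueStab E (psiStab psi) c) [T2Space F]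

include hreg in
-- The twist commutes with the flow, so an intermediate projection changes only the point on the
-- trajectory. This transfers the composition law of twists to the hypersurface.
lemma hitPoint_twist_hitPoint (a : ℝ) (k : ℤ) {x : Stab F}
    (hx' : twist a k x ∈ hitDomain hW.complete psi c) :
    hitPoint hW.complete psi c (twist a k (hitPoint hW.complete psi c x)) =
      hitPoint hW.complete psi c (twist a k x) := by
  rw [hitPoint.eq_1 hW.complete psi c x, ← stabFlow_twist, hitPoint_stabFlow hW hreg hx']

include hreg in
lemma hitPoint_twist_twist (a b : ℝ) (k l : ℤ) {x : Stab F} (hx : x ∈ doubleCircle psi c) :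
    hitPoint hW.complete psi c (twist a k (hitPoint hW.complete psi c (twist b l x))) =
      hitPoint hW.complete psi c (twist (a + b) (k + l) x) := by
  rw [hitPoint_twist_hitPoint hW hreg a k, twist_twist]
  rw [twist_twist]
  exact twist_mem_hitDomain hW _ _ hx

/-- The permutation of `{ψ' = c}` obtained by twisting and projecting along the flow of `Z'`. -/
noncomputable def twistPerm (a : ℝ) (k : ℤ) : Equiv.Perm (doubleCircle psi c) where
  toFun x := ⟨hitPoint hW.complete psi c (twist a k x), hitPoint_mem (twist_mem_hitDomain hW a k x.2)⟩
  invFun x := ⟨hitPoint hW.complete psi c (twist (-a) (-k) x),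
    hitPoint_mem (twist_mem_hitDomain hW (-a) (-k) x.2)⟩
  left_inv x := by
    apply Subtype.ext
    simp only [hitPoint_twist_twist hW hreg _ _ _ _ x.2, neg_add_cancel, twist_zero,
      hitPoint_of_mem hW hreg x.2]
  right_inv x := by
    apply Subtype.ext
    simp only [hitPoint_twist_twist hW hreg _ _ _ _ x.2, add_neg_cancel, twist_zero,
      hitPoint_of_mem hW hreg x.2]

lemma twistPerm_apply (a : ℝ) (k : ℤ) (x : doubleCircle psi c) :
    (twistPerm hW hreg a k x : Stab F) = hitPoint hW.complete psi c (twist a k x) := rfl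

lemma twistPerm_symm (a : ℝ) (k : ℤ) :
    (twistPerm hW hreg a k).symm = twistPerm hW hreg (-a) (-k) := Equiv.ext fun _ ↦ rfl

lemma twistPerm_mul (a b : ℝ) (k l : ℤ) :
    twistPerm hW hreg a k * twistPerm hW hreg b l = twistPerm hW hreg (a + b) (k + l) :=
  Equiv.ext fun x ↦ Subtype.ext (hitPoint_twist_twist hW hreg a b k l x.2)

lemma twistPerm_zpow (k : ℤ) : twistPerm hW hreg 1 1 ^ k = twistPerm hW hreg k k := by
  have h0 : twistPerm hW hreg 0 0 = 1 := Equiv.ext fun x ↦ Subtype.ext <| by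
    rw [twistPerm_apply, twist_zero, hitPoint_of_mem hW hreg x.2]
    rfl
  have h1 : (twistPerm hW hreg 1 1)⁻¹ = twistPerm hW hreg (-1) (-1) := twistPerm_symm hW hreg 1 1
  induction k using Int.induction_on with
  | zero => simpa using h0.symm
  | succ n ih =>
    rw [zpow_add_one, ih, twistPerm_mul]
    push_cast
    rfl
  | pred n ih =>
    rw [zpow_sub_one, ih, h1, twistPerm_mul]
    push_cast
    rfl

lemma twistPerm_zero_one : twistPerm hW hreg 0 1 = PsiMap psi c := Equiv.ext fun x ↦ by
  have h : twist 0 1 (x : Stab F) = PsiMap psi c x := by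
    simp [twist, PsiMap]
  apply Subtype.ext
  rw [twistPerm_apply, h, hitPoint_of_mem hW hreg (PsiMap psi c x).2]

section

variable [FiniteDimensional ℝ E]

lemma isLocalExtension_twistPerm (a : ℝ) (k : ℤ) :
    IsLocalExtension (modelStab E) (modelStab E)
      (fun y : doubleCircle psi c ↦ (twistPerm hW hreg a k y : Stab F))
      (twist a k ⁻¹' hitDomain hW.complete psi c) (hitPoint hW.complete psi c ∘ twist a k) :=
  ⟨(isOpen_hitDomain hW hreg).preimage (contMDiff_twist_right (E := E) a k).continuous,
    (contMDiffOn_hitPoint hW hreg).comp (contMDiff_twist_right a k).contMDiffOn fun _ h ↦ h,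
    fun _ _ ↦ rfl⟩

lemma isDiffeo_twistPerm (a : ℝ) (k : ℤ) : IsDiffeo (modelStab E) (twistPerm hW hreg a k) := by
  have h : ∀ (a : ℝ) (k : ℤ), IsSmoothOnSubset (modelStab E) (modelStab E)
      (fun y : doubleCircle psi c ↦ (twistPerm hW hreg a k y : Stab F)) := fun a k x ↦
    ⟨_, _, twist_mem_hitDomain hW a k x.2, isLocalExtension_twistPerm hW hreg a k⟩
  exact ⟨h a k, h (-a) (-k)⟩

/-- The shear coefficient is a real parameter on which twist and projection depend smoothly. The
rotation number stays fixed, and the intermediate maps are not required to preserve `ξ`. -/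
lemma isIsotopy_twistPerm (k : ℤ) :
    IsIsotopy (modelStab E) (fun a ↦ twistPerm hW hreg a k) := by
  refine ⟨fun t _ ↦ isDiffeo_twistPerm hW hreg t k, fun x ↦
    ⟨(fun p : ℝ × Stab F ↦ twist p.1 k p.2) ⁻¹' hitDomain hW.complete psi c,
      fun p ↦ hitPoint hW.complete psi c (twist p.1 k p.2),
      twist_mem_hitDomain hW _ k x.2.2, ?_, ?_, fun _ _ ↦ rfl⟩⟩
  · exact (isOpen_hitDomain hW hreg).preimage (contMDiff_twist (E := E) k).continuous
  · exact (contMDiffOn_hitPoint hW hreg).comp (contMDiff_twist k).contMDiffOn fun _ h ↦ h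

lemma smoothlyIsotopic_twistPerm (k : ℤ) :
    SmoothlyIsotopic (modelStab E) (twistPerm hW hreg 0 k) (twistPerm hW hreg 1 k) :=
  ⟨fun a ↦ twistPerm hW hreg a k, isIsotopy_twistPerm hW hreg k, rfl, rfl⟩

omit [T2Space F] [FiniteDimensional ℝ E] [IsManifold 𝓘(ℝ, E) ∞ F] in
lemma mem_xiStab {x : Stab F} {v : TangentSpace (modelStab E) x} :
    v ∈ xiStab om Z psi x ↔
      mvfderiv (modelStab E) (psiPrime psi) x v = 0 ∧ alphaForm om Z x v = 0 := Iff.rfl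

include hreg in
/-- A diffeomorphism rescaling the contact form is a contactomorphism. -/
lemma isContactomorphism_of_alphaForm {f : Equiv.Perm (doubleCircle psi c)}
    (hf : IsDiffeo (modelStab E) f)
    (hα : ∀ x ∈ doubleCircle psi c, ∃ r : ℝ, r ≠ 0 ∧ ∀ v : TangentSpace (modelStab E) x,
      mvfderiv (modelStab E) (psiPrime psi) x v = 0 →
      alphaForm om Z (permExt hW.complete f x)
        (mfderiv (modelStab E) (modelStab E) (permExt hW.complete f) x v) =
        r * alphaForm om Z x v) :
    IsContactomorphism (modelStab E) (xiStab om Z psi) f := by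
  refine ⟨hf, fun x U g hxU hg ↦ ?_⟩
  have hx' := doubleCircle_subset_hitDomain hW.complete x.2
  obtain ⟨r, hr, hrα⟩ := hα x x.2
  have hgx : g x = permExt hW.complete f x := by
    rw [permExt_of_mem hW hreg f x]
    exact (hg.2.2 x hxU).symm
  have key : ∀ {v : TangentSpace (modelStab E) (x : Stab F)},
      mvfderiv (modelStab E) (psiPrime psi) x v = 0 → _ :=
    fun {v} hv ↦ hg.mfderiv_eq_permExt hW hreg x.2 hxU hv
  have aux : ∀ y : Stab F, y = permExt hW.complete f x →
      ∀ w w' : E × ℂ × ℝ × EuclideanSpace ℝ (Fin 1), w = w' →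
      ((w' ∈ xiStab om Z psi (permExt hW.complete f x)) ↔ (w ∈ xiStab om Z psi y)) := by
    rintro y rfl w _ rfl
    rfl
  ext w
  constructor
  · rintro ⟨v, hv, rfl⟩
    rw [SetLike.mem_coe, mem_xiStab] at hv
    refine (aux _ hgx _ _ (key hv.1).symm).1 ?_
    refine mem_xiStab.2 ⟨mfderiv_psiPrime_mfderiv_permExt hW hreg hf.1 hx' v, ?_⟩
    exact (hrα v hv.1).trans (by rw [hv.2, mul_zero])
  · intro hw
    have hw' := mem_xiStab.1 ((aux _ hgx _ _ rfl).2 hw)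
    obtain ⟨v, hv1, hv2⟩ := exists_mfderiv_permExt_eq hW hreg hf x.2 hw'.1
    refine ⟨v, mem_xiStab.2 ⟨hv1, ?_⟩, (key hv1).symm.trans hv2⟩
    have h1 := hrα v hv1
    have h2 : alphaForm om Z (permExt hW.complete f x)
        (mfderiv (modelStab E) (modelStab E) (permExt hW.complete f) x v) = 0 :=
      (congrArg (alphaForm om Z (permExt hW.complete f x)) hv2).trans hw'.2
    exact (mul_eq_zero.1 (h1.symm.trans h2)).resolve_left hr

include hreg in
lemma mfderiv_hitPoint_comp_twist (a : ℝ) (k : ℤ) {x : Stab F} (hx : x ∈ doubleCircle psi c)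
    (v : TangentSpace (modelStab E) x) :
    (mfderiv (modelStab E) (modelStab E) (hitPoint hW.complete psi c ∘ twist a k) x v :
      E × ℂ × ℝ × EuclideanSpace ℝ (Fin 1)) =
    mfderiv (modelStab E) (modelStab E) (hitPoint hW.complete psi c) (twist a k x)
      (mfderiv (modelStab E) (modelStab E) (twist a k) x v) :=
  DFunLike.congr_fun (mfderiv_comp x (g := hitPoint hW.complete psi c) (f := twist a k)
    (I' := modelStab E) ((contMDiffAt_hitPoint hW hreg
      (twist_mem_hitDomain hW a k hx)).mdifferentiableAt (by simp))
    ((contMDiff_twist_right a k).mdifferentiableAt (by simp))) v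

lemma mfderiv_permExt_twistPerm (a : ℝ) (k : ℤ) {x : Stab F} (hx : x ∈ doubleCircle psi c)
    {v : TangentSpace (modelStab E) x} (hv : mvfderiv (modelStab E) (psiPrime psi) x v = 0) :
    (mfderiv (modelStab E) (modelStab E) (permExt hW.complete (twistPerm hW hreg a k)) x v :
      E × ℂ × ℝ × EuclideanSpace ℝ (Fin 1)) =
    mfderiv (modelStab E) (modelStab E) (hitPoint hW.complete psi c) (twist a k x)
      (mfderiv (modelStab E) (modelStab E) (twist a k) x v) :=
  ((isLocalExtension_twistPerm hW hreg a k).mfderiv_eq_permExt hW hreg hx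
    (twist_mem_hitDomain hW a k hx) hv).trans (mfderiv_hitPoint_comp_twist hW hreg a k hx v)

/-- The twist preserves `α` and the projection multiplies it by the exponential of the hitting time,
which never vanishes. -/
lemma isContactomorphism_twistPerm (k : ℤ) :
    IsContactomorphism (modelStab E) (xiStab om Z psi) (twistPerm hW hreg (k : ℝ) k) := by
  refine isContactomorphism_of_alphaForm hW hreg (isDiffeo_twistPerm hW hreg k k) fun x hx ↦
    ⟨Real.exp (hitTime hW.complete psi c (twist k k x)), (Real.exp_pos _).ne', fun v hv ↦ ?_⟩
  have h1 := alphaForm_mfderiv_hitPoint hW hreg (twist_mem_hitDomain hW k k hx)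
    (mfderiv (modelStab E) (modelStab E) (twist (k : ℝ) k) x v)
  rw [alphaForm_mfderiv_twist] at h1
  have h2 := permExt_of_mem hW hreg (twistPerm hW hreg (k : ℝ) k) ⟨x, hx⟩
  have aux : ∀ y y' : Stab F, y = y' → ∀ w w' : E × ℂ × ℝ × EuclideanSpace ℝ (Fin 1), w = w' →
      alphaForm om Z y w = alphaForm om Z y' w' := by
    rintro y _ rfl w _ rfl
    rfl
  exact (aux _ _ h2 _ _ (mfderiv_permExt_twistPerm hW hreg k k hx hv)).trans h1

end

end TwistPerm

end WeinsteinStab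

namespace WeinsteinStab

/-! ### The identity `dα = ω'` on parametrised surfaces -/

section StabSurfaceFormula

variable {D : Type*} [NormedAddCommGroup D] [NormedSpace ℝ D]

/-- This is `d(Im(z̄ dz)) = 2 dx ∧ dy` pulled back by `f`. It serves for the ℂ-factor and, with
values in the unit circle, for `dθ`. -/
lemma fderiv_sub_fderiv_im_conj_mul {f : D → ℂ} {a : D} (hf : ContDiffAt ℝ 2 f a) :
    (∀ e : D, DifferentiableAt ℝ (fun p ↦ (conj (f p) * fderiv ℝ f p e).im) a) ∧
    ∀ e e' : D, fderiv ℝ (fun p ↦ (conj (f p) * fderiv ℝ f p e').im) a e -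
      fderiv ℝ (fun p ↦ (conj (f p) * fderiv ℝ f p e).im) a e' =
      2 * (conj (fderiv ℝ f a e) * fderiv ℝ f a e').im := by
  have hd1 : HasFDerivAt f (fderiv ℝ f a) a := (hf.differentiableAt (by simp)).hasFDerivAt
  have hd2 : HasFDerivAt (fderiv ℝ f) (fderiv ℝ (fderiv ℝ f) a) a :=
    ((hf.fderiv_right (m := 1) (by norm_num)).differentiableAt (by simp)).hasFDerivAt
  have hsymm : ∀ e e' : D, fderiv ℝ (fderiv ℝ f) a e e' = fderiv ℝ (fderiv ℝ f) a e' e :=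
    fun e e' ↦ (hf.isSymmSndFDerivAt (by simp)).eq e e'
  have hder : ∀ e : D, HasFDerivAt (fun p ↦ (conj (f p) * fderiv ℝ f p e).im)
      ((f a).re • Complex.imCLM.comp ((fderiv ℝ (fderiv ℝ f) a).flip e) +
        (fderiv ℝ f a e).im • Complex.reCLM.comp (fderiv ℝ f a) -
        ((f a).im • Complex.reCLM.comp ((fderiv ℝ (fderiv ℝ f) a).flip e) +
        (fderiv ℝ f a e).re • Complex.imCLM.comp (fderiv ℝ f a))) a := by
    intro e
    have h1 : HasFDerivAt (fun p ↦ fderiv ℝ f p e) ((fderiv ℝ (fderiv ℝ f) a).flip e) a := by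
      simpa using hd2.clm_apply (hasFDerivAt_const e a)
    have h2 := ((Complex.reCLM.hasFDerivAt.comp a hd1).mul (Complex.imCLM.hasFDerivAt.comp a h1)).sub
      ((Complex.imCLM.hasFDerivAt.comp a hd1).mul (Complex.reCLM.hasFDerivAt.comp a h1))
    refine HasFDerivAt.congr_of_eventuallyEq h2 (Filter.Eventually.of_forall fun p ↦ ?_)
    simp [Complex.mul_im]
    ring
  refine ⟨fun e ↦ (hder e).differentiableAt, fun e e' ↦ ?_⟩
  rw [(hder e).fderiv, (hder e').fderiv]
  simp only [sub_apply, add_apply,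
    smul_apply, ContinuousLinearMap.comp_apply, ContinuousLinearMap.flip_apply,
    Complex.reCLM_apply, Complex.imCLM_apply, smul_eq_mul, Complex.mul_im, Complex.conj_re,
    Complex.conj_im]
  rw [hsymm e' e]
  ring

variable {E : Type*} [NormedAddCommGroup E] [NormedSpace ℝ E] [FiniteDimensional ℝ E]
  {F : Type*} [TopologicalSpace F] [ChartedSpace E F] [IsManifold 𝓘(ℝ, E) ∞ F]
  {Z : ∀ q : F, TangentSpace 𝓘(ℝ, E) q}
  {om : ∀ q : F, TangentSpace 𝓘(ℝ, E) q →L[ℝ] TangentSpace 𝓘(ℝ, E) q →L[ℝ] ℝ} {psi : F → ℝ}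

/-- The identity `dα = ω'` computed on a parametrised surface. -/
lemma fderiv_sub_fderiv_alphaForm (hW : IsWeinstein om Z psi) {γ : D → Stab F} {a : D}
    (hγ : ContMDiffAt 𝓘(ℝ, D) (modelStab E) 2 γ a) :
    (∀ e : D, DifferentiableAt ℝ
      (fun p ↦ alphaForm om Z (γ p) (mfderiv 𝓘(ℝ, D) (modelStab E) γ p e)) a) ∧
    ∀ e e' : D,
      fderiv ℝ (fun p ↦ alphaForm om Z (γ p) (mfderiv 𝓘(ℝ, D) (modelStab E) γ p e')) a e
        - fderiv ℝ (fun p ↦ alphaForm om Z (γ p) (mfderiv 𝓘(ℝ, D) (modelStab E) γ p e)) a e' =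
      omegaPrime om (γ a) (mfderiv 𝓘(ℝ, D) (modelStab E) γ a e)
        (mfderiv 𝓘(ℝ, D) (modelStab E) γ a e') := by
  have : IsManifold 𝓘(ℝ, E) 2 F := .of_le (n := ∞) two_le_infty
  have hγ1 : ContMDiffAt 𝓘(ℝ, D) 𝓘(ℝ, E) 2 (fun p ↦ (γ p).1) a := hγ.fst
  have hγ2 : ContDiffAt ℝ 2 (fun p ↦ (γ p).2.1) a := contMDiffAt_iff_contDiffAt.1 hγ.snd.fst
  have hγ3 : ContDiffAt ℝ 2 (fun p ↦ (γ p).2.2.1) a := contMDiffAt_iff_contDiffAt.1 hγ.snd.snd.fst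
  have hγ4 : ContMDiffAt 𝓘(ℝ, D) (𝓡 1) 2 (fun p ↦ (γ p).2.2.2) a := hγ.snd.snd.snd
  have hγ4' : ContDiffAt ℝ 2 (fun p ↦ ((γ p).2.2.2 : ℂ)) a := contMDiffAt_iff_contDiffAt.1
    (ContMDiffAt.comp a (g := fun u : Circle ↦ (u : ℂ)) (f := fun p ↦ (γ p).2.2.2)
      ((contMDiff_circle_coe.of_le two_le_infty).contMDiffAt) hγ4)
  have hmd : MDifferentiableAt 𝓘(ℝ, D) (modelStab E) γ a := hγ.mdifferentiableAt (by simp)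
  have c2 : ∀ {p : D}, MDifferentiableAt 𝓘(ℝ, D) (modelStab E) γ p → ∀ e : D,
      (mfderiv 𝓘(ℝ, D) (modelStab E) γ p e).2.1 = fderiv ℝ (fun p ↦ (γ p).2.1) p e := by
    intro p hp e
    exact (mfderiv_stab_complex hp e).symm.trans (DFunLike.congr_fun mfderiv_eq_fderiv e)
  have c3 : ∀ {p : D}, MDifferentiableAt 𝓘(ℝ, D) (modelStab E) γ p → ∀ e : D,
      (mfderiv 𝓘(ℝ, D) (modelStab E) γ p e).2.2.1 = fderiv ℝ (fun p ↦ (γ p).2.2.1) p e := by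
    intro p hp e
    exact (mfderiv_stab_real hp e).symm.trans (DFunLike.congr_fun mfderiv_eq_fderiv e)
  have c4 : ∀ {p : D}, MDifferentiableAt 𝓘(ℝ, D) (modelStab E) γ p → ∀ e : D,
      dTheta (γ p).2.2.2 (mfderiv 𝓘(ℝ, D) (modelStab E) γ p e).2.2.2 =
        (conj ((γ p).2.2.2 : ℂ) * fderiv ℝ (fun p ↦ ((γ p).2.2.2 : ℂ)) p e).im := by
    intro p hp e
    rw [← Circle.coe_inv_eq_conj]
    refine Eq.trans (congrArg (dTheta (γ p).2.2.2) (mfderiv_stab_circle hp e).symm) ?_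
    refine (dTheta_mfderiv (f := fun p ↦ (γ p).2.2.2) hp.snd.snd.snd e).trans ?_
    exact congrArg (fun w : ℂ ↦ ((((γ p).2.2.2⁻¹ : Circle) : ℂ) * w).im)
      (DFunLike.congr_fun mfderiv_eq_fderiv e)
  have c4' : ∀ e : D, fderiv ℝ (fun p ↦ ((γ p).2.2.2 : ℂ)) a e = Complex.I * (γ a).2.2.2 *
      dTheta (γ a).2.2.2 (mfderiv 𝓘(ℝ, D) (modelStab E) γ a e).2.2.2 := by
    intro e
    refine Eq.trans ?_ (mvfderiv_circle_coe _ _)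
    have h1 := mfderiv_comp a (mdifferentiableAt_circle_coe (γ a).2.2.2)
      (f := fun p ↦ (γ p).2.2.2) hmd.snd.snd.snd
    have h2 := DFunLike.congr_fun h1 e
    refine (DFunLike.congr_fun mfderiv_eq_fderiv e).symm.trans (h2.trans ?_)
    exact congrArg (mfderiv (𝓡 1) 𝓘(ℝ, ℂ) (fun u : Circle ↦ (u : ℂ)) (γ a).2.2.2)
      (mfderiv_stab_circle hmd e)
  obtain ⟨hd1, hs1⟩ := fderiv_sub_fderiv_eq_extDerivOne (lam := fun q ↦ om q (Z q))
    (differentiableAt_chartOneForm hW.symplectic.smooth hW.smooth_field _) hγ1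
  obtain ⟨hd2, hs2⟩ := fderiv_sub_fderiv_im_conj_mul hγ2
  obtain ⟨hd4, hs4⟩ := fderiv_sub_fderiv_im_conj_mul hγ4'
  have hd3 := hγ3.differentiableAt (by simp)
  have hev : ∀ e : D, (fun p ↦ alphaForm om Z (γ p) (mfderiv 𝓘(ℝ, D) (modelStab E) γ p e)) =ᶠ[𝓝 a]
      fun p ↦ om (γ p).1 (Z (γ p).1) (mfderiv 𝓘(ℝ, D) 𝓘(ℝ, E) (fun p ↦ (γ p).1) p e)
        + 1 / 2 * (conj (γ p).2.1 * fderiv ℝ (fun p ↦ (γ p).2.1) p e).im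
        + 2 * ((γ p).2.2.1 *
          (conj ((γ p).2.2.2 : ℂ) * fderiv ℝ (fun p ↦ ((γ p).2.2.2 : ℂ)) p e).im) := by
    intro e
    filter_upwards [(contMDiffAt_iff_contMDiffAt_nhds (by simp)).1 hγ] with p hp
    have hp' : MDifferentiableAt 𝓘(ℝ, D) (modelStab E) γ p := hp.mdifferentiableAt (by simp)
    rw [alphaForm_apply, c2 hp', c4 hp', mul_assoc 2]
    exact congrArg (fun w : E ↦ (om (γ p).1 (Z (γ p).1) : E →L[ℝ] ℝ) w + _ + _)
      (mfderiv_stab_fst hp' e).symm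
  have hder : ∀ e : D, HasFDerivAt
      (fun p ↦ alphaForm om Z (γ p) (mfderiv 𝓘(ℝ, D) (modelStab E) γ p e)) _ a := fun e ↦
    (((hd1 e).hasFDerivAt.add ((hd2 e).hasFDerivAt.const_mul (1 / 2))).add
      ((hd3.hasFDerivAt.mul (hd4 e).hasFDerivAt).const_mul 2)).congr_of_eventuallyEq (hev e)
  refine ⟨fun e ↦ (hder e).differentiableAt, fun e e' ↦ ?_⟩
  rw [(hder e).fderiv, (hder e').fderiv, omegaPrime, c2 hmd, c2 hmd, c3 hmd, c3 hmd, c4 hmd, c4 hmd]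
  have h1 := hs1 e e'
  rw [hW.liouville] at h1
  have h1' : om (γ a).1 (mfderiv 𝓘(ℝ, D) (modelStab E) γ a e).1
      (mfderiv 𝓘(ℝ, D) (modelStab E) γ a e').1 = _ := Eq.trans (congrArg₂
    (fun v w : E ↦ (om (γ a).1 : E →L[ℝ] E →L[ℝ] ℝ) v w) (mfderiv_stab_fst hmd e).symm
    (mfderiv_stab_fst hmd e').symm) h1.symm
  have h2 := hs2 e e'
  have h4 := hs4 e e'
  -- Both derivatives are real multiples of `i u`, so the area term vanishes: `dθ` is closed.
  have h5 : (conj (fderiv ℝ (fun p ↦ ((γ p).2.2.2 : ℂ)) a e) *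
      fderiv ℝ (fun p ↦ ((γ p).2.2.2 : ℂ)) a e').im = 0 := by
    rw [c4' e, c4' e']
    simp [Complex.mul_im, Complex.mul_re]
    ring
  rw [h5, mul_zero] at h4
  have h6 : ∀ z w : ℂ, (conj z * w).im = z.re * w.im - z.im * w.re := by
    intro z w
    simp only [Complex.mul_im, Complex.conj_re, Complex.conj_im]
    ring
  rw [h6 (fderiv ℝ (fun p ↦ (γ p).2.1) a e)] at h2
  rw [h1']
  simp only [add_apply, smul_apply, smul_eq_mul]
  linear_combination (1 / 2 : ℝ) * h2 + 2 * (γ a).2.2.1 * h4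

end StabSurfaceFormula

end WeinsteinStab

namespace WeinsteinStab

/-- At a zero of `b` the product rule needs only continuity of the other factor, since the increment
of `f` is multiplied by a quantity of first order. It is used for a conformal factor times `α`. -/
lemma HasFDerivAt.mul_of_eq_zero {D : Type*} [NormedAddCommGroup D] [NormedSpace ℝ D]
    {f b : D → ℝ} {b' : D →L[ℝ] ℝ} {a : D} (hf : ContinuousAt f a) (hb : HasFDerivAt b b' a)
    (h0 : b a = 0) : HasFDerivAt (fun p ↦ f p * b p) (f a • b') a := by
  rw [hasFDerivAt_iff_isLittleO] at hb ⊢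
  have h1 : (fun p ↦ f p * (b p - b a - b' (p - a))) =o[𝓝 a] fun p ↦ p - a := by
    have h := (hf.isBigO_one ℝ).mul_isLittleO hb.norm_right
    simp only [one_mul] at h
    exact h.of_norm_right
  have h2 : (fun p ↦ (f p - f a) * b' (p - a)) =o[𝓝 a] fun p ↦ p - a := by
    have h3 : (fun p ↦ f p - f a) =o[𝓝 a] fun _ ↦ (1 : ℝ) := by
      rw [Asymptotics.isLittleO_one_iff]
      simpa using hf.tendsto.sub_const (f a)
    have h := h3.mul_isBigO (b'.isBigO_sub (𝓝 a) a).norm_right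
    simp only [one_mul] at h
    exact h.of_norm_right
  refine (h1.add h2).congr_left fun p ↦ ?_
  simp only [h0, smul_apply, smul_eq_mul]
  ring

lemma dTheta_mfderiv_circleExp (t ρ : ℝ) :
    dTheta (Circle.exp t) (mfderiv 𝓘(ℝ, ℝ) (𝓡 1) Circle.exp t ρ) = ρ := by
  have h1 : MDifferentiableAt 𝓘(ℝ, ℝ) (𝓡 1) Circle.exp t :=
    (contMDiff_circleExp (m := ∞)).mdifferentiableAt (by simp)
  have h2 : HasDerivAt (fun t : ℝ ↦ (Circle.exp t : ℂ))
      (Complex.exp (t * Complex.I) * Complex.I) t := by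
    simp only [Circle.coe_exp]
    simpa using ((hasDerivAt_id t).ofReal_comp.mul_const Complex.I).cexp
  have h3 : mvfderiv 𝓘(ℝ, ℝ) (fun t : ℝ ↦ (Circle.exp t : ℂ)) t ρ =
      ρ • (Complex.exp (t * Complex.I) * Complex.I) :=
    DFunLike.congr_fun h2.hasFDerivAt.hasMFDerivAt.mfderiv ρ
  refine (dTheta_mfderiv h1 ρ).trans ((congrArg
    (fun w : ℂ ↦ ((((Circle.exp t)⁻¹ : Circle) : ℂ) * w).im) h3).trans ?_)
  rw [← Circle.coe_exp, mul_smul_comm, ← mul_assoc, ← Circle.coe_mul, inv_mul_cancel]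
  simp

lemma exists_circleExp_eq (u : Circle) : ∃ t : ℝ, Circle.exp t = u := ⟨_, Circle.exp_arg u⟩

lemma exists_dTheta_eq (u : Circle) (ρ : ℝ) : ∃ w : TangentSpace (𝓡 1) u, dTheta u w = ρ := by
  obtain ⟨t, rfl⟩ := exists_circleExp_eq u
  exact ⟨_, dTheta_mfderiv_circleExp t ρ⟩

lemma dTheta_injective (u : Circle) : Function.Injective (dTheta u) := by
  let L : EuclideanSpace ℝ (Fin 1) →ₗ[ℝ] ℝ := (dTheta u).toLinearMap
  have h : Function.Surjective L := exists_dTheta_eq u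
  have h' : Function.Injective L :=
    (LinearMap.injective_iff_surjective_of_finrank_eq_finrank (by simp)).2 h
  exact h'

/-! ### Continuity of the forms on the total tangent space -/

section TangentContinuity

variable {E : Type*} [NormedAddCommGroup E] [NormedSpace ℝ E]
  {F : Type*} [TopologicalSpace F] [ChartedSpace E F] [IsManifold 𝓘(ℝ, E) ∞ F]

lemma continuous_mvfderiv_apply {H M B W : Type*} [NormedAddCommGroup B] [NormedSpace ℝ B]
    [TopologicalSpace H] {I : ModelWithCorners ℝ B H} [TopologicalSpace M] [ChartedSpace H M]
    [IsManifold I 1 M] [NormedAddCommGroup W] [NormedSpace ℝ W] {f : M → W}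
    (hf : ContMDiff I 𝓘(ℝ, W) ∞ f) :
    Continuous (fun v : TangentBundle I M ↦ (mvfderiv I f v.1 v.2 : W)) := by
  have h := hf.continuous_tangentMap (by simp)
  exact ((tangentBundleModelSpaceHomeomorph 𝓘(ℝ, W)).continuous.comp h).snd

lemma continuous_tangentBundle_stab_fst :
    Continuous (fun v : TangentBundle (modelStab E) (Stab F) ↦
      (⟨v.1.1, v.2.1⟩ : TangentBundle 𝓘(ℝ, E) F)) := by
  have : IsManifold 𝓘(ℝ, E) 1 F := .of_le (n := ∞) (by simp)
  have h := (contMDiff_fst (I := 𝓘(ℝ, E)) (J := 𝓘(ℝ, ℂ).prod (𝓘(ℝ, ℝ).prod (𝓡 1))) (M := F)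
    (N := ℂ × ℝ × Circle) (n := ∞)).continuous_tangentMap (by simp)
  refine h.congr fun v ↦ ?_
  rw [tangentMap, mfderiv_fst]
  rfl

lemma continuous_tangentBundle_stab_complex :
    Continuous (fun v : TangentBundle (modelStab E) (Stab F) ↦ (v.2.2.1 : ℂ)) := by
  have : IsManifold 𝓘(ℝ, E) 1 F := .of_le (n := ∞) (by simp)
  have h : ContMDiff (modelStab E) (modelStab E) ∞ (fun x : Stab F ↦ x) := contMDiff_id
  refine (continuous_mvfderiv_apply h.snd.fst).congr fun v ↦ ?_
  exact DFunLike.congr_fun (hasMFDerivAt_stab_complex v.1).mfderiv v.2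

lemma continuous_tangentBundle_stab_real :
    Continuous (fun v : TangentBundle (modelStab E) (Stab F) ↦ (v.2.2.2.1 : ℝ)) := by
  have : IsManifold 𝓘(ℝ, E) 1 F := .of_le (n := ∞) (by simp)
  have h : ContMDiff (modelStab E) (modelStab E) ∞ (fun x : Stab F ↦ x) := contMDiff_id
  refine (continuous_mvfderiv_apply h.snd.snd.fst).congr fun v ↦ ?_
  exact DFunLike.congr_fun (hasMFDerivAt_stab_real v.1).mfderiv v.2

lemma continuous_tangentBundle_stab_circle :
    Continuous (fun v : TangentBundle (modelStab E) (Stab F) ↦ dTheta v.1.2.2.2 v.2.2.2.2) := by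
  have : IsManifold 𝓘(ℝ, E) 1 F := .of_le (n := ∞) (by simp)
  have h : ContMDiff (modelStab E) (modelStab E) ∞ (fun x : Stab F ↦ x) := contMDiff_id
  have h1 := continuous_mvfderiv_apply (contMDiff_circle_coe.comp h.snd.snd.snd)
  have h2 : Continuous (fun v : TangentBundle (modelStab E) (Stab F) ↦
      ((v.1.2.2.2⁻¹ : Circle) : ℂ)) :=
    continuous_subtype_val.comp
      (FiberBundle.continuous_proj _ _ : Continuous
        (fun v : TangentBundle (modelStab E) (Stab F) ↦ v.1)).snd.snd.snd.inv
  refine (Complex.continuous_im.comp (h2.mul h1)).congr fun v ↦ ?_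
  have h3 := (HasMFDerivAt.comp v.1 (g := fun u : Circle ↦ (u : ℂ))
    (f := fun x : Stab F ↦ x.2.2.2)
    (mdifferentiableAt_circle_coe v.1.2.2.2).hasMFDerivAt (hasMFDerivAt_stab_circle (E := E) v.1)).mfderiv
  exact congrArg (fun w : ℂ ↦ (((v.1.2.2.2⁻¹ : Circle) : ℂ) * w).im) (DFunLike.congr_fun h3 v.2)

variable {Z : ∀ q : F, TangentSpace 𝓘(ℝ, E) q}
  {om : ∀ q : F, TangentSpace 𝓘(ℝ, E) q →L[ℝ] TangentSpace 𝓘(ℝ, E) q →L[ℝ] ℝ} {psi : F → ℝ}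

lemma continuous_alphaForm (hW : IsWeinstein om Z psi) :
    Continuous (fun v : TangentBundle (modelStab E) (Stab F) ↦ alphaForm om Z v.1 v.2) := by
  have hp : Continuous (fun v : TangentBundle (modelStab E) (Stab F) ↦ v.1) :=
    FiberBundle.continuous_proj _ _
  have h1 : Continuous (fun v : TangentBundle 𝓘(ℝ, E) F ↦ om v.1 (Z v.1) v.2) := by
    have hπ : ContMDiff 𝓘(ℝ, E).tangent 𝓘(ℝ, E) ∞ (fun v : TangentBundle 𝓘(ℝ, E) F ↦ v.1) :=
      Bundle.contMDiff_proj _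
    have h := ContMDiff.clm_bundle_apply₂ (F₁ := E) (F₂ := E) (F₃ := ℝ)
      (E₁ := fun q : F ↦ TangentSpace 𝓘(ℝ, E) q) (E₂ := fun q : F ↦ TangentSpace 𝓘(ℝ, E) q)
      (E₃ := fun _ : F ↦ ℝ) (hW.symplectic.smooth.comp hπ) (hW.smooth_field.comp hπ)
      (contMDiff_id : ContMDiff 𝓘(ℝ, E).tangent 𝓘(ℝ, E).tangent ∞
        (fun v : TangentBundle 𝓘(ℝ, E) F ↦ (⟨v.1, v.2⟩ : TangentBundle 𝓘(ℝ, E) F)))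
    refine continuous_iff_continuousAt.2 fun v ↦ ?_
    have h' := h v
    rw [Bundle.contMDiffAt_totalSpace] at h'
    exact h'.2.continuousAt
  have h2 := ((h1.comp continuous_tangentBundle_stab_fst).add
    ((Complex.continuous_im.comp ((Complex.continuous_conj.comp hp.snd.fst).mul
      continuous_tangentBundle_stab_complex)).const_mul (1 / 2))).add
    ((hp.snd.snd.fst.const_mul 2).mul continuous_tangentBundle_stab_circle)
  refine h2.congr fun v ↦ ?_
  rw [alphaForm_apply]
  rfl

end TangentContinuity

end WeinsteinStab

namespace WeinsteinStab

/-! ### Homotopy invariance of the winding number -/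

section Winding

lemma eq_of_circleExp_comp_eq {A : Type*} [TopologicalSpace A] [PreconnectedSpace A]
    {f g : A → ℝ} (hf : Continuous f) (hg : Continuous g)
    (h : ∀ x, Circle.exp (f x) = Circle.exp (g x)) {a : A} (ha : f a = g a) (x : A) : f x = g x :=
  congrFun (Circle.isCoveringMap_exp.eq_of_comp_eq hf hg (funext h) a ha) x

/-- Loops in the punctured plane which are freely homotopic have the same winding number. -/
lemma winding_eq_zero {D : ℝ × ℝ → ℂ}
    (hD : ContinuousOn D (Set.Icc (0 : ℝ) 1 ×ˢ Set.univ))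
    (hD0 : ∀ t ∈ Set.Icc (0 : ℝ) 1, ∀ r, D (t, r) ≠ 0)
    (hper : ∀ t ∈ Set.Icc (0 : ℝ) 1, ∀ r, D (t, r + 2 * Real.pi) = D (t, r)) {k : ℤ} {a : ℝ}
    (ha : 0 < a) (h0 : ∀ r, D (0, r) = ((Circle.exp r ^ k : Circle) : ℂ) * a)
    (h1 : ∀ r, D (1, r) = a) : k = 0 := by
  -- Clamping the time extends the homotopy to the whole plane, which is simply connected, so its
  -- normalised values lift through `Circle.exp`.
  let P : ℝ → ℝ := fun t ↦ (Set.projIcc (0 : ℝ) 1 zero_le_one t : ℝ)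
  have hP : ∀ t, P t ∈ Set.Icc (0 : ℝ) 1 := fun t ↦ Subtype.coe_prop _
  have hPc : Continuous P := continuous_subtype_val.comp continuous_projIcc
  have hP0 : P 0 = 0 := by simp [P]
  have hP1 : P 1 = 1 := by simp [P]
  have hDc : Continuous fun p : ℝ × ℝ ↦ D (P p.1, p.2) := by
    rw [← continuousOn_univ]
    exact hD.comp ((hPc.comp continuous_fst).prodMk continuous_snd).continuousOn
      fun p _ ↦ ⟨hP p.1, Set.mem_univ _⟩
  have hn : ∀ p : ℝ × ℝ, ‖D (P p.1, p.2)‖ ≠ 0 := fun p ↦ norm_ne_zero_iff.2 (hD0 _ (hP p.1) _)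
  let f : C(ℝ × ℝ, Circle) :=
    { toFun := fun p ↦ ⟨D (P p.1, p.2) / ‖D (P p.1, p.2)‖, mem_sphere_zero_iff_norm.2 <| by
        rw [norm_div, Complex.norm_real, norm_norm, div_self (hn p)]⟩
      continuous_toFun := (hDc.div (Complex.continuous_ofReal.comp hDc.norm) fun p ↦
        Complex.ofReal_ne_zero.2 (hn p)).subtype_mk _ }
  obtain ⟨e₀, he₀⟩ : ∃ e₀, Circle.exp e₀ = f (0, 0) := ⟨_, Circle.exp_arg _⟩
  obtain ⟨L, ⟨-, hL⟩, -⟩ :=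
    Circle.isCoveringMap_exp.existsUnique_continuousMap_lifts f (0, 0) e₀ he₀
  have hL' : ∀ p, Circle.exp (L p) = f p := fun p ↦ congrFun hL p
  have hf : ∀ t r, f (t, r + 2 * Real.pi) = f (t, r) := by
    intro t r
    apply Subtype.ext
    change D (P t, _) / ‖D (P t, _)‖ = D (P t, _) / ‖D (P t, _)‖
    rw [hper _ (hP t)]
  have hf0 : ∀ r, f (0, r) = Circle.exp r ^ k := by
    intro r
    apply Subtype.ext
    change D (P 0, r) / ‖D (P 0, r)‖ = _
    rw [hP0, h0, norm_mul, Circle.norm_coe, one_mul, Complex.norm_real, Real.norm_of_nonneg ha.le,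
      mul_div_assoc, div_self (Complex.ofReal_ne_zero.2 ha.ne'), mul_one]
  have hf1 : ∀ r, f (1, r) = 1 := by
    intro r
    apply Subtype.ext
    change D (P 1, r) / ‖D (P 1, r)‖ = _
    rw [hP1, h1, Complex.norm_real, Real.norm_of_nonneg ha.le,
      div_self (Complex.ofReal_ne_zero.2 ha.ne'), Circle.coe_one]
  have hL0 : ∀ r, L (0, r) = k * r + L (0, 0) := by
    intro r
    refine eq_of_circleExp_comp_eq (f := fun r ↦ L (0, r)) (g := fun r ↦ k * r + L (0, 0))
      (by fun_prop) (by fun_prop) (fun r ↦ ?_) (a := 0) (by simp) r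
    rw [hL', Circle.exp_add, hL', hf0, hf0, Circle.exp_zero, one_zpow, mul_one, ← zsmul_eq_mul,
      Circle.exp_zsmul]
  have hL1 : ∀ r, L (1, r) = L (1, 0) := by
    intro r
    refine eq_of_circleExp_comp_eq (f := fun r ↦ L (1, r)) (g := fun _ ↦ L (1, 0))
      (by fun_prop) (by fun_prop) (fun r ↦ ?_) (a := 0) rfl r
    rw [hL', hL', hf1, hf1]
  -- By periodicity this increment exponentiates to 1, so it does not depend on `t`. It equals `2πk`
  -- at time 0 and `0` at time 1.
  have hdiff := eq_of_circleExp_comp_eq (f := fun t ↦ L (t, 2 * Real.pi) - L (t, 0))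
    (g := fun _ ↦ L (1, 2 * Real.pi) - L (1, 0))
      (by fun_prop) (by fun_prop) (fun t ↦ by
        have h2 := hf t 0
        have h3 := hf 1 0
        rw [zero_add] at h2 h3
        rw [Circle.exp_sub, Circle.exp_sub, hL', hL', hL', hL', h2, h3, div_self', div_self'])
      (a := 1) rfl 0
  simp only [hL1, hL0 (2 * Real.pi), sub_self, add_sub_cancel_right] at hdiff
  have := Real.pi_pos
  have h4 : (k : ℝ) = 0 := by
    rcases mul_eq_zero.1 hdiff with h | h
    · exact h
    · linarith
  exact_mod_cast h4

end Winding

/-! ### Determinants and complex linear parts -/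

section Determinant

lemma continuousOn_linearMap_det {X V : Type*} [TopologicalSpace X] [NormedAddCommGroup V]
    [NormedSpace ℂ V] [FiniteDimensional ℂ V] {C : X → V →ₗ[ℂ] V} {s : Set X}
    (h : ∀ v, ContinuousOn (fun x ↦ C x v) s) : ContinuousOn (fun x ↦ LinearMap.det (C x)) s := by
  let b := Module.finBasis ℂ V
  have h1 : ∀ x, LinearMap.det (C x) = (LinearMap.toMatrix b b (C x)).det := fun x ↦
    (LinearMap.det_toMatrix b (C x)).symm
  simp only [h1]
  rw [continuousOn_iff_continuous_domRestrict]
  refine Continuous.matrix_det (continuous_matrix fun i j ↦ ?_)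
  simp only [LinearMap.toMatrix_apply, ← Module.Basis.coord_apply]
  exact continuousOn_iff_continuous_domRestrict.1
    ((LinearMap.continuous_of_finiteDimensional (b.coord i)).comp_continuousOn (h (b j)))

/-- The complex linear part of a real linear map. -/
noncomputable def complexPart {V W : Type*} [AddCommGroup V] [Module ℂ V] [AddCommGroup W] [Module ℂ W]
    (B : V →ₗ[ℝ] W) : V →ₗ[ℂ] W where
  toFun v := (1 / 2 : ℂ) • (B v - Complex.I • B (Complex.I • v))
  map_add' v w := by
    rw [smul_add, map_add, map_add]
    module
  map_smul' c v := by
    have h1 : ∀ v, B (c • v) = (c.re : ℂ) • B v + (c.im : ℂ) • B (Complex.I • v) := by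
      intro v
      have h2 : c • v = c.re • v + c.im • (Complex.I • v) := by
        conv_lhs => rw [← Complex.re_add_im c, add_smul, mul_smul]
        rfl
      rw [h2, map_add, map_smul, map_smul]
      rfl
    have h3 : Complex.I • Complex.I • v = -v := by
      rw [smul_smul, Complex.I_mul_I, neg_one_smul]
    have h4 : Complex.I • c • v = c • Complex.I • v := smul_comm _ _ _
    rw [h4, h1, h1, h3, map_neg, RingHom.id_apply]
    conv_rhs => rw [← Complex.re_add_im c]
    simp only [smul_sub, smul_add, smul_smul, smul_neg]
    match_scalars <;> ring_nf
    simp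
    ring

end Determinant

end WeinsteinStab

namespace WeinsteinStab

/-! ### Conformal factors of contactomorphisms -/

section Conformal

variable {E : Type*} [NormedAddCommGroup E] [NormedSpace ℝ E]
  {F : Type*} [TopologicalSpace F] [ChartedSpace E F]
  {Z : ∀ q : F, TangentSpace 𝓘(ℝ, E) q}
  {om : ∀ q : F, TangentSpace 𝓘(ℝ, E) q →L[ℝ] TangentSpace 𝓘(ℝ, E) q →L[ℝ] ℝ} {psi : F → ℝ}
  {c : ℝ}

lemma alphaForm_congr {x y : Stab F} (h : x = y) {v w : E × ℂ × ℝ × EuclideanSpace ℝ (Fin 1)}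
    (h' : v = w) : alphaForm om Z x v = alphaForm om Z y w := by
  subst h h'
  rfl

lemma alphaForm_mk (x : Stab F) (e : E) (z : ℂ) (s : ℝ) (w : EuclideanSpace ℝ (Fin 1)) :
    alphaForm om Z x ((e, z, s, w) : E × ℂ × ℝ × EuclideanSpace ℝ (Fin 1)) =
      om x.1 (Z x.1) e + 1 / 2 * (conj x.2.1 * z).im + 2 * x.2.2.1 * dTheta x.2.2.2 w :=
  alphaForm_apply x _

lemma omegaPrime_congr {x y : Stab F} (h : x = y)
    {v w v' w' : E × ℂ × ℝ × EuclideanSpace ℝ (Fin 1)} (hv : v = w) (hv' : v' = w') :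
    omegaPrime om x v v' = omegaPrime om y w w' := by
  subst h hv hv'
  rfl

lemma mfderiv_congr_apply {g : Stab F → Stab F} {x y : Stab F} (h : x = y)
    {v w : E × ℂ × ℝ × EuclideanSpace ℝ (Fin 1)} (h' : v = w) :
    (mfderiv (modelStab E) (modelStab E) g x v : E × ℂ × ℝ × EuclideanSpace ℝ (Fin 1)) =
      mfderiv (modelStab E) (modelStab E) g y w := by
  subst h h'
  rfl

/-- A local parametrisation of `{s = s₀}`. -/
noncomputable def stabParam (q₀ : F) (s₀ : ℝ) (p : E × ℂ × ℝ) : Stab F :=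
  ((extChartAt 𝓘(ℝ, E) q₀).symm (extChartAt 𝓘(ℝ, E) q₀ q₀ + p.1), p.2.1, s₀, Circle.exp p.2.2)

lemma stabParam_apply (q₀ : F) (s₀ r : ℝ) (z : ℂ) :
    stabParam q₀ s₀ ((0, z, r) : E × ℂ × ℝ) = (q₀, z, s₀, Circle.exp r) := by
  simp [stabParam]

lemma hasMFDerivAt_stabParam (q₀ : F) (s₀ r : ℝ) :
    HasMFDerivAt 𝓘(ℝ, E × ℂ × ℝ) (modelStab E) (stabParam q₀ s₀) ((0, 0, r) : E × ℂ × ℝ)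
      ((ContinuousLinearMap.fst ℝ E (ℂ × ℝ)).prod
        (((ContinuousLinearMap.fst ℝ ℂ ℝ).comp (ContinuousLinearMap.snd ℝ E (ℂ × ℝ))).prod
        ((0 : E × ℂ × ℝ →L[ℝ] ℝ).prod
        ((mfderiv 𝓘(ℝ, ℝ) (𝓡 1) Circle.exp r : ℝ →L[ℝ] EuclideanSpace ℝ (Fin 1)).comp
          ((ContinuousLinearMap.snd ℝ ℂ ℝ).comp (ContinuousLinearMap.snd ℝ E (ℂ × ℝ))))))) := by
  set φ := extChartAt 𝓘(ℝ, E) q₀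
  have hfst : HasFDerivAt (fun p : E × ℂ × ℝ ↦ φ q₀ + p.1)
      (ContinuousLinearMap.fst ℝ E (ℂ × ℝ)) ((0, 0, r) : E × ℂ × ℝ) :=
    (ContinuousLinearMap.fst ℝ E (ℂ × ℝ)).hasFDerivAt.const_add _
  have h1 : HasMFDerivAt 𝓘(ℝ, E × ℂ × ℝ) 𝓘(ℝ, E) (fun p : E × ℂ × ℝ ↦ φ.symm (φ q₀ + p.1))
      ((0, 0, r) : E × ℂ × ℝ) (ContinuousLinearMap.fst ℝ E (ℂ × ℝ)) := by
    refine HasMFDerivAt.comp (g := φ.symm) (g' := ContinuousLinearMap.id ℝ E) _ ?_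
      hfst.hasMFDerivAt
    have h : φ q₀ + ((0, 0, r) : E × ℂ × ℝ).1 = φ q₀ := add_zero _
    rw [h]
    exact hasMFDerivAt_extChartAt_symm_self (E := E) q₀
  have h2 : HasMFDerivAt 𝓘(ℝ, E × ℂ × ℝ) 𝓘(ℝ, ℂ) (fun p : E × ℂ × ℝ ↦ p.2.1) (0, 0, r)
      ((ContinuousLinearMap.fst ℝ ℂ ℝ).comp (ContinuousLinearMap.snd ℝ E (ℂ × ℝ))) :=
    ((ContinuousLinearMap.fst ℝ ℂ ℝ).comp
      (ContinuousLinearMap.snd ℝ E (ℂ × ℝ))).hasFDerivAt.hasMFDerivAt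
  have h3 : HasMFDerivAt 𝓘(ℝ, E × ℂ × ℝ) 𝓘(ℝ, ℝ) (fun _ : E × ℂ × ℝ ↦ s₀) (0, 0, r)
      (0 : E × ℂ × ℝ →L[ℝ] ℝ) := (hasFDerivAt_const s₀ _).hasMFDerivAt
  have h4 : HasMFDerivAt 𝓘(ℝ, E × ℂ × ℝ) (𝓡 1) (fun p : E × ℂ × ℝ ↦ Circle.exp p.2.2) (0, 0, r)
      ((mfderiv 𝓘(ℝ, ℝ) (𝓡 1) Circle.exp r : ℝ →L[ℝ] EuclideanSpace ℝ (Fin 1)).comp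
          ((ContinuousLinearMap.snd ℝ ℂ ℝ).comp (ContinuousLinearMap.snd ℝ E (ℂ × ℝ)))) :=
    HasMFDerivAt.comp (g := Circle.exp) (f := fun p : E × ℂ × ℝ ↦ p.2.2) (I' := 𝓘(ℝ, ℝ)) _
      ((contMDiff_circleExp (m := ∞)).mdifferentiableAt (by simp)).hasMFDerivAt
      ((ContinuousLinearMap.snd ℝ ℂ ℝ).comp
      (ContinuousLinearMap.snd ℝ E (ℂ × ℝ))).hasFDerivAt.hasMFDerivAt
  exact h1.prodMk (h2.prodMk (h3.prodMk h4))

variable [IsManifold 𝓘(ℝ, E) ∞ F]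

lemma contMDiffAt_stabParam (q₀ : F) (s₀ r : ℝ) :
    ContMDiffAt 𝓘(ℝ, E × ℂ × ℝ) (modelStab E) ∞ (stabParam q₀ s₀) ((0, 0, r) : E × ℂ × ℝ) := by
  set φ := extChartAt 𝓘(ℝ, E) q₀
  have h1 : ContMDiffAt 𝓘(ℝ, E × ℂ × ℝ) 𝓘(ℝ, E) ∞ (fun p : E × ℂ × ℝ ↦ φ.symm (φ q₀ + p.1))
      ((0, 0, r) : E × ℂ × ℝ) := by
    refine ContMDiffAt.comp (g := φ.symm) (I' := 𝓘(ℝ, E)) _ ?_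
      (contDiff_const.add contDiff_fst).contMDiff.contMDiffAt
    simp only [add_zero]
    exact (contMDiffOn_extChartAt_symm q₀).contMDiffAt (extChartAt_target_mem_nhds q₀)
  exact h1.prodMk ((contDiff_fst.comp contDiff_snd).contMDiff.contMDiffAt.prodMk
    (contMDiffAt_const.prodMk (ContMDiffAt.comp (g := Circle.exp) (I' := 𝓘(ℝ, ℝ)) _
      contMDiff_circleExp.contMDiffAt (contDiff_snd.comp contDiff_snd).contMDiff.contMDiffAt)))

omit [IsManifold 𝓘(ℝ, E) ∞ F] in
lemma mfderiv_comp_stabParam {g : Stab F → Stab F} {q₀ : F} {s₀ r : ℝ}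
    (hg : MDifferentiableAt (modelStab E) (modelStab E) g (q₀, 0, s₀, Circle.exp r))
    (d : E × ℂ × ℝ) :
    (mfderiv 𝓘(ℝ, E × ℂ × ℝ) (modelStab E) (g ∘ stabParam q₀ s₀) ((0, 0, r) : E × ℂ × ℝ) d :
      E × ℂ × ℝ × EuclideanSpace ℝ (Fin 1)) =
    mfderiv (modelStab E) (modelStab E) g (q₀, 0, s₀, Circle.exp r)
      ((d.1, d.2.1, 0, mfderiv 𝓘(ℝ, ℝ) (𝓡 1) Circle.exp r d.2.2) :
        E × ℂ × ℝ × EuclideanSpace ℝ (Fin 1)) := by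
  have h := stabParam_apply (E := E) q₀ s₀ r 0
  have h1 := HasMFDerivAt.comp ((0, 0, r) : E × ℂ × ℝ) (g := g) (f := stabParam q₀ s₀)
    (g' := (mfderiv (modelStab E) (modelStab E) g (q₀, 0, s₀, Circle.exp r) :
      (E × ℂ × ℝ × EuclideanSpace ℝ (Fin 1)) →L[ℝ] (E × ℂ × ℝ × EuclideanSpace ℝ (Fin 1))))
    (by rw [h]; exact hg.hasMFDerivAt) (hasMFDerivAt_stabParam q₀ s₀ r)
  exact DFunLike.congr_fun h1.mfderiv d

variable (hW : IsWeinstein om Z psi) (hreg : IsRegularValueStab E (psiStab psi) c)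
include hreg

/-- The contact form does not vanish identically on the tangent spaces of `{ψ' = c}`. -/
lemma exists_alphaForm_ne_zero (hW : IsWeinstein om Z psi) {x : Stab F}
    (hx : x ∈ doubleCircle psi c) :
    ∃ v : TangentSpace (modelStab E) x, mvfderiv (modelStab E) (psiPrime psi) x v = 0 ∧
      alphaForm om Z x v ≠ 0 := by
  by_contra! hcon
  have hrate := liouvilleRate_pos hW hreg hx
  -- `Z'` lies in the kernel of `α` and is transverse to the hypersurface, so vanishing on tangent
  -- vectors implies vanishing on all ambient vectors. Testing each factor then gives `Z' = 0`,
  -- which is excluded.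
  have h0 : ∀ v : TangentSpace (modelStab E) x, alphaForm om Z x v = 0 := by
    intro v
    have h1 := hcon (v - (mvfderiv (modelStab E) (psiPrime psi) x v / liouvilleRate Z psi x) •
      zPrime Z x) (by
        rw [map_sub, map_smul, mvfderiv_psiPrime_zPrime hW, smul_eq_mul,
          div_mul_cancel₀ _ hrate.ne', sub_self])
    rwa [map_sub, map_smul, alphaForm_zPrime hW.symplectic.alternating, smul_zero, sub_zero] at h1
  refine zPrime_ne_zero hW hreg hx ?_
  have h1 : ∀ (e : E) (z : ℂ) (w : EuclideanSpace ℝ (Fin 1)),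
      om x.1 (Z x.1) e + 1 / 2 * (conj x.2.1 * z).im + 2 * x.2.2.1 * dTheta x.2.2.2 w = 0 :=
    fun e z w ↦ (alphaForm_mk x e z 0 w).symm.trans (h0 _)
  have hθ : dTheta x.2.2.2 (0 : EuclideanSpace ℝ (Fin 1)) = 0 := (dTheta x.2.2.2).map_zero
  have hom : om x.1 (Z x.1) (0 : E) = 0 := (om x.1 (Z x.1)).map_zero
  have hZ : Z x.1 = 0 := hW.symplectic.nondegenerate _ _ fun w ↦ by
    have h2 := h1 w 0 0
    rw [hθ] at h2
    simpa using h2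
  have hz : x.2.1 = 0 := by
    have h2 := h1 0 (Complex.I * x.2.1) 0
    have h3 : conj x.2.1 * (Complex.I * x.2.1) = Complex.I * Complex.normSq x.2.1 := by
      rw [Complex.normSq_eq_conj_mul_self]
      ring
    rw [hθ, hom, h3] at h2
    simpa using h2
  have hs : x.2.2.1 = 0 := by
    obtain ⟨w, hw⟩ := exists_dTheta_eq x.2.2.2 1
    have h2 := h1 0 0 w
    rw [hom] at h2
    change 0 + 1 / 2 * (conj x.2.1 * 0).im + 2 * x.2.2.1 * dTheta x.2.2.2 w = 0 at h2
    rw [hw] at h2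
    simpa using h2
  rw [zPrime, hZ, hz, hs, mul_zero]
  rfl

variable [T2Space F] [FiniteDimensional ℝ E] {f : Equiv.Perm (doubleCircle psi c)}

/-- On the hypersurface the derivative sends `ker α` into `ker α`, hence rescales `α` on tangent
vectors. As `permExt` factors through the projection, which itself rescales `α`, the factor exists
at every point of the open domain and for all ambient vectors. -/
lemma exists_conformal_factor (hf : IsContactomorphism (modelStab E) (xiStab om Z psi) f)
    {x : Stab F} (hx : x ∈ hitDomain hW.complete psi c) :
    ∃ κ : ℝ, ∀ v : TangentSpace (modelStab E) x, alphaForm om Z (permExt hW.complete f x)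
      (mfderiv (modelStab E) (modelStab E) (permExt hW.complete f) x v) =
        κ * alphaForm om Z x v := by
  set y := hitPoint hW.complete psi c x with hy
  have hyV : y ∈ doubleCircle psi c := hitPoint_mem hx
  have hyD := doubleCircle_subset_hitDomain hW.complete hyV
  let L : TangentSpace (modelStab E) y →ₗ[ℝ] ℝ := (alphaForm om Z (permExt hW.complete f y)).comp
    (mfderiv (modelStab E) (modelStab E) (permExt hW.complete f) y).toLinearMap
  have hL : ∀ v : TangentSpace (modelStab E) y, v ∈ xiStab om Z psi y → L v = 0 := by
    intro v hv
    have h1 := hf.2 ⟨y, hyV⟩ _ _ hyD (isLocalExtension_permExt hW hreg hf.1.1)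
    have h2 : mfderiv (modelStab E) (modelStab E) (permExt hW.complete f) y v ∈
        xiStab om Z psi (permExt hW.complete f y) := by
      rw [← h1]
      exact ⟨v, hv, rfl⟩
    exact h2.2
  obtain ⟨w₀, hw₀, hw₀'⟩ := exists_alphaForm_ne_zero hreg hW hyV
  have hκ : ∀ v : TangentSpace (modelStab E) y, mvfderiv (modelStab E) (psiPrime psi) y v = 0 →
      L v = L w₀ / alphaForm om Z y w₀ * alphaForm om Z y v := by
    intro v hv
    have h1 := hL (v - (alphaForm om Z y v / alphaForm om Z y w₀) • w₀) (mem_xiStab.2 ⟨by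
      rw [map_sub, map_smul, hv, hw₀, smul_zero, sub_zero], by
      rw [map_sub, map_smul, smul_eq_mul, div_mul_cancel₀ _ hw₀', sub_self]⟩)
    rw [map_sub, map_smul, smul_eq_mul, sub_eq_zero] at h1
    rw [h1]
    ring
  refine ⟨L w₀ / alphaForm om Z y w₀ * Real.exp (hitTime hW.complete psi c x), fun v ↦ ?_⟩
  have h1 : permExt hW.complete f =ᶠ[𝓝 x]
      permExt hW.complete f ∘ hitPoint hW.complete psi c := by
    filter_upwards [(isOpen_hitDomain hW hreg).mem_nhds hx] with p hp
    exact (permExt_hitPoint hW hreg f hp).symm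
  have h2 := mfderiv_comp x (g := permExt hW.complete f) (f := hitPoint hW.complete psi c)
    (I' := modelStab E) (I'' := modelStab E) (I := modelStab E)
    ((contMDiffAt_permExt hW hreg hf.1.1 hyD).mdifferentiableAt (by simp))
    ((contMDiffAt_hitPoint hW hreg hx).mdifferentiableAt (by simp))
  have h3 := DFunLike.congr_fun (h1.mfderiv_eq.trans h2) v
  rw [mul_assoc, ← alphaForm_mfderiv_hitPoint hW hreg hx]
  rw [← hκ _ (mfderiv_psiPrime_mfderiv_hitPoint hW hreg hx v)]
  exact alphaForm_congr (permExt_hitPoint hW hreg f hx).symm h3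

/-- The derivative reaches every tangent vector at the image point, and `α` is nonzero on one of
them. -/
lemma conformal_factor_ne_zero (hf : IsDiffeo (modelStab E) f) {x : Stab F}
    (hx : x ∈ doubleCircle psi c) {κ : ℝ}
    (hκ : ∀ v : TangentSpace (modelStab E) x, alphaForm om Z (permExt hW.complete f x)
      (mfderiv (modelStab E) (modelStab E) (permExt hW.complete f) x v) =
        κ * alphaForm om Z x v) : κ ≠ 0 := by
  rintro rfl
  obtain ⟨w, hw, hw'⟩ := exists_alphaForm_ne_zero hreg hW
    (permExt_mem f (doubleCircle_subset_hitDomain hW.complete hx))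
  obtain ⟨v, -, hv⟩ := exists_mfderiv_permExt_eq hW hreg hf hx hw
  have h := hκ v
  rw [zero_mul] at h
  exact hw' ((alphaForm_congr rfl hv.symm).trans h)

end Conformal

end WeinsteinStab

namespace WeinsteinStab

/-! ### Contactomorphisms are conformally symplectic on `ξ` -/

section ConformalSymplectic

variable {E : Type*} [NormedAddCommGroup E] [NormedSpace ℝ E]
  {F : Type*} [TopologicalSpace F] [ChartedSpace E F] [IsManifold 𝓘(ℝ, E) ∞ F]
  {Z : ∀ q : F, TangentSpace 𝓘(ℝ, E) q}
  {om : ∀ q : F, TangentSpace 𝓘(ℝ, E) q →L[ℝ] TangentSpace 𝓘(ℝ, E) q →L[ℝ] ℝ} {psi : F → ℝ}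
  {c : ℝ}

omit [IsManifold 𝓘(ℝ, E) ∞ F] in
lemma mfderiv_stabParam (q₀ : F) (s₀ r : ℝ) (d : E × ℂ × ℝ) :
    (mfderiv 𝓘(ℝ, E × ℂ × ℝ) (modelStab E) (stabParam q₀ s₀) ((0, 0, r) : E × ℂ × ℝ) d :
      E × ℂ × ℝ × EuclideanSpace ℝ (Fin 1)) =
      ((d.1, d.2.1, 0, mfderiv 𝓘(ℝ, ℝ) (𝓡 1) Circle.exp r d.2.2) :
        E × ℂ × ℝ × EuclideanSpace ℝ (Fin 1)) :=
  DFunLike.congr_fun (hasMFDerivAt_stabParam q₀ s₀ r).mfderiv d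

omit [IsManifold 𝓘(ℝ, E) ∞ F] in
lemma mfderiv_circleExp_zero_apply (r : ℝ) :
    (mfderiv 𝓘(ℝ, ℝ) (𝓡 1) Circle.exp r (0 : ℝ) : EuclideanSpace ℝ (Fin 1)) = 0 :=
  (mfderiv 𝓘(ℝ, ℝ) (𝓡 1) Circle.exp r).map_zero

variable (hW : IsWeinstein om Z psi) (hreg : IsRegularValueStab E (psiStab psi) c)
  [T2Space F] [FiniteDimensional ℝ E] {f : Equiv.Perm (doubleCircle psi c)}
include hreg

/-- A contactomorphism acts conformally on the contact planes at a zero of the Liouville field. -/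
lemma omegaPrime_mfderiv_permExt (hf : IsContactomorphism (modelStab E) (xiStab om Z psi) f)
    {q₀ : F} {s₀ r : ℝ} (hx : ((q₀, 0, s₀, Circle.exp r) : Stab F) ∈ doubleCircle psi c)
    (hZ : Z q₀ = 0) (hs : s₀ ≠ 0) {κ : ℝ}
    (hκ : ∀ v : TangentSpace (modelStab E) ((q₀, 0, s₀, Circle.exp r) : Stab F),
      alphaForm om Z (permExt hW.complete f (q₀, 0, s₀, Circle.exp r))
        (mfderiv (modelStab E) (modelStab E) (permExt hW.complete f) (q₀, 0, s₀, Circle.exp r) v) =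
        κ * alphaForm om Z (q₀, 0, s₀, Circle.exp r) v)
    (e e' : E) (ζ ζ' : ℂ) :
    omegaPrime om (permExt hW.complete f (q₀, 0, s₀, Circle.exp r))
      (mfderiv (modelStab E) (modelStab E) (permExt hW.complete f) (q₀, 0, s₀, Circle.exp r)
        ((e, ζ, 0, 0) : E × ℂ × ℝ × EuclideanSpace ℝ (Fin 1)))
      (mfderiv (modelStab E) (modelStab E) (permExt hW.complete f) (q₀, 0, s₀, Circle.exp r)
        ((e', ζ', 0, 0) : E × ℂ × ℝ × EuclideanSpace ℝ (Fin 1))) =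
      κ * (om q₀ e e' + (conj ζ * ζ').im) := by
  have hxD := doubleCircle_subset_hitDomain hW.complete hx
  set γ : E × ℂ × ℝ → Stab F := stabParam q₀ s₀ with hγ
  set a : E × ℂ × ℝ := (0, 0, r) with ha
  have hγa : γ a = (q₀, 0, s₀, Circle.exp r) := stabParam_apply q₀ s₀ r 0
  set g := permExt hW.complete f with hg
  have hgx : ContMDiffAt (modelStab E) (modelStab E) ∞ g (q₀, 0, s₀, Circle.exp r) :=
    contMDiffAt_permExt hW hreg hf.1.1 hxD
  have hγ2 : ContMDiffAt 𝓘(ℝ, E × ℂ × ℝ) (modelStab E) 2 γ a :=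
    (contMDiffAt_stabParam q₀ s₀ r).of_le two_le_infty
  have hG2 : ContMDiffAt 𝓘(ℝ, E × ℂ × ℝ) (modelStab E) 2 (g ∘ γ) a := by
    refine ContMDiffAt.comp a (g := g) ?_ hγ2
    rw [hγa]
    exact hgx.of_le two_le_infty
  obtain ⟨hd, hω⟩ := fderiv_sub_fderiv_alphaForm hW hγ2
  obtain ⟨-, hω'⟩ := fderiv_sub_fderiv_alphaForm hW hG2
  set β : E × ℂ × ℝ → E × ℂ × ℝ → ℝ := fun d p ↦
    alphaForm om Z (γ p) (mfderiv 𝓘(ℝ, E × ℂ × ℝ) (modelStab E) γ p d) with hβ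
  set β' : E × ℂ × ℝ → E × ℂ × ℝ → ℝ := fun d p ↦
    alphaForm om Z ((g ∘ γ) p) (mfderiv 𝓘(ℝ, E × ℂ × ℝ) (modelStab E) (g ∘ γ) p d) with hβ'
  -- At the base point `Z_F = 0` and `z = 0`, so only the term `2 s dθ` of `α` remains.
  have hβa : ∀ d, β d a = 2 * s₀ * d.2.2 := by
    intro d
    refine (alphaForm_congr hγa (mfderiv_stabParam q₀ s₀ r d)).trans ((alphaForm_mk _ _ _ _ _).trans ?_)
    have h1 : om q₀ (Z q₀) d.1 = 0 := by
      rw [hZ, map_zero]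
      rfl
    have h2 := dTheta_mfderiv_circleExp r d.2.2
    change om q₀ (Z q₀) d.1 + 1 / 2 * (conj 0 * d.2.1).im + 2 * s₀ *
      dTheta (Circle.exp r) (mfderiv 𝓘(ℝ, ℝ) (𝓡 1) Circle.exp r d.2.2) = _
    rw [h1, h2]
    simp
  -- The parametrised slice `{s = s₀}` leaves the hypersurface away from the base point, so the
  -- conformal factor is needed on the open domain of `permExt`.
  have hev : ∀ᶠ p in 𝓝 a, ∃ κ : ℝ, ∀ d, β' d p = κ * β d p := by
    have h1 : ∀ᶠ p in 𝓝 a, γ p ∈ hitDomain hW.complete psi c :=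
      hγ2.continuousAt.eventually_mem ((isOpen_hitDomain hW hreg).mem_nhds (by rwa [hγa]))
    have : IsManifold 𝓘(ℝ, E) 2 F := .of_le (n := ∞) two_le_infty
    filter_upwards [h1, (contMDiffAt_iff_contMDiffAt_nhds (by simp)).1 hγ2] with p hp1 hp2
    obtain ⟨κ, hκ⟩ := exists_conformal_factor hW hreg hf hp1
    refine ⟨κ, fun d ↦ ?_⟩
    have h2 := mfderiv_comp p (g := g) (f := γ) (I' := modelStab E)
      ((contMDiffAt_permExt hW hreg hf.1.1 hp1).mdifferentiableAt (by simp))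
      (hp2.mdifferentiableAt (by simp))
    exact (alphaForm_congr rfl (DFunLike.congr_fun h2 d)).trans (hκ _)
  set d₁ : E × ℂ × ℝ := (0, 0, 1) with hd₁
  have hβ1 : β d₁ a = 2 * s₀ := by
    rw [hβa]
    simp [hd₁]
  have hβ1' : β d₁ a ≠ 0 := by
    rw [hβ1]
    simpa using hs
  have hd' : ∀ d, DifferentiableAt ℝ (β' d) a := (fderiv_sub_fderiv_alphaForm hW hG2).1
  -- The quotient of the values on the angular direction, where `α` equals `2 s₀ ≠ 0` at the base
  -- point, recovers the conformal factor as a continuous function.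
  have hcont : ContinuousAt (fun p ↦ β' d₁ p / β d₁ p) a :=
    (hd' d₁).continuousAt.div (hd d₁).continuousAt hβ1'
  have hev' : ∀ d, β' d =ᶠ[𝓝 a] fun p ↦ β' d₁ p / β d₁ p * β d p := by
    intro d
    filter_upwards [hev, (hd d₁).continuousAt.eventually_ne hβ1'] with p hp1 hp2
    obtain ⟨κ, hκ⟩ := hp1
    rw [hκ d, hκ d₁, mul_div_cancel_right₀ _ hp2]
  have hGd : ∀ d : E × ℂ × ℝ, (mfderiv 𝓘(ℝ, E × ℂ × ℝ) (modelStab E) (g ∘ γ) a d :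
      E × ℂ × ℝ × EuclideanSpace ℝ (Fin 1)) = mfderiv (modelStab E) (modelStab E) g
        (q₀, 0, s₀, Circle.exp r) ((d.1, d.2.1, 0, mfderiv 𝓘(ℝ, ℝ) (𝓡 1) Circle.exp r d.2.2) :
        E × ℂ × ℝ × EuclideanSpace ℝ (Fin 1)) :=
    fun d ↦ mfderiv_comp_stabParam (hgx.mdifferentiableAt (by simp)) d
  have hGa : (g ∘ γ) a = g (q₀, 0, s₀, Circle.exp r) := congrArg g hγa
  have hκa : β' d₁ a / β d₁ a = κ := by
    rw [div_eq_iff hβ1']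
    refine (alphaForm_congr hGa (hGd d₁)).trans ((hκ _).trans ?_)
    exact congrArg (κ * ·) (alphaForm_congr hγa (mfderiv_stabParam q₀ s₀ r d₁)).symm
  -- `α` vanishes at the base point on directions without angular component, so the derivative of
  -- the factor drops out. Antisymmetrising turns this into the relation between the values of `ω'`.
  have hfd : ∀ d : E × ℂ × ℝ, d.2.2 = 0 → fderiv ℝ (β' d) a = κ • fderiv ℝ (β d) a := by
    intro d hd0
    have h := (HasFDerivAt.mul_of_eq_zero hcont (hd d).hasFDerivAt ((hβa d).trans (by
      rw [hd0, mul_zero]))).congr_of_eventuallyEq (hev' d)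
    rw [h.fderiv, hκa]
  have h1 := hω (e, ζ, 0) (e', ζ', 0)
  have h2 := hω' (e, ζ, 0) (e', ζ', 0)
  rw [hfd _ rfl, hfd _ rfl] at h2
  have hv : ∀ (e : E) (ζ : ℂ), ((e, ζ, 0, mfderiv 𝓘(ℝ, ℝ) (𝓡 1) Circle.exp r (0 : ℝ)) :
      E × ℂ × ℝ × EuclideanSpace ℝ (Fin 1)) = (e, ζ, 0, 0) := fun e ζ ↦
    congrArg (fun w : EuclideanSpace ℝ (Fin 1) ↦ (e, ζ, (0 : ℝ), w)) (mfderiv_circleExp_zero_apply r)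
  have h3 : ∀ (e : E) (ζ : ℂ), (mfderiv 𝓘(ℝ, E × ℂ × ℝ) (modelStab E) (g ∘ γ) a (e, ζ, 0) :
      E × ℂ × ℝ × EuclideanSpace ℝ (Fin 1)) = mfderiv (modelStab E) (modelStab E) g
        (q₀, 0, s₀, Circle.exp r) ((e, ζ, 0, 0) : E × ℂ × ℝ × EuclideanSpace ℝ (Fin 1)) :=
    fun e ζ ↦ (hGd (e, ζ, 0)).trans (mfderiv_congr_apply rfl (hv e ζ))
  have h4 : omegaPrime om (γ a) (mfderiv 𝓘(ℝ, E × ℂ × ℝ) (modelStab E) γ a (e, ζ, 0))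
      (mfderiv 𝓘(ℝ, E × ℂ × ℝ) (modelStab E) γ a (e', ζ', 0)) =
      om q₀ e e' + (conj ζ * ζ').im := by
    refine (omegaPrime_congr hγa ((mfderiv_stabParam q₀ s₀ r (e, ζ, 0)).trans (hv e ζ))
      ((mfderiv_stabParam q₀ s₀ r (e', ζ', 0)).trans (hv e' ζ'))).trans ?_
    have h5 : dTheta (Circle.exp r) (0 : EuclideanSpace ℝ (Fin 1)) = 0 :=
      (dTheta (Circle.exp r)).map_zero
    change om q₀ e e' + (ζ.re * ζ'.im - ζ.im * ζ'.re) +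
      2 * (0 * dTheta (Circle.exp r) (0 : EuclideanSpace ℝ (Fin 1)) -
        dTheta (Circle.exp r) (0 : EuclideanSpace ℝ (Fin 1)) * 0) = _
    rw [h5]
    simp [Complex.mul_im]
    ring
  rw [← h4, ← h1]
  refine (omegaPrime_congr hGa (h3 e ζ) (h3 e' ζ')).symm.trans (h2.symm.trans ?_)
  simp only [smul_apply, smul_eq_mul]
  ring

end ConformalSymplectic

/-! ### Continuity of the derivatives of an isotopy -/

section IsotopyContinuity

variable {E : Type*} [NormedAddCommGroup E] [NormedSpace ℝ E] [FiniteDimensional ℝ E]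
  {F : Type*} [TopologicalSpace F] [ChartedSpace E F] [IsManifold 𝓘(ℝ, E) ∞ F] [T2Space F]
  {Z : ∀ q : F, TangentSpace 𝓘(ℝ, E) q}
  {om : ∀ q : F, TangentSpace 𝓘(ℝ, E) q →L[ℝ] TangentSpace 𝓘(ℝ, E) q →L[ℝ] ℝ} {psi : F → ℝ}
  {c : ℝ}

/-- The derivatives of an isotopy depend continuously on all parameters. -/
lemma continuousOn_mfderiv_isotopy (hW : IsWeinstein om Z psi)
    (hreg : IsRegularValueStab E (psiStab psi) c) {Φ : ℝ → Equiv.Perm (doubleCircle psi c)}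
    (hΦ : IsIsotopy (modelStab E) Φ) {q₀ : F} {s₀ : ℝ}
    (hx : ∀ u : Circle, ((q₀, 0, s₀, u) : Stab F) ∈ doubleCircle psi c) (d : E × ℂ × ℝ) :
    ContinuousOn (fun p : ℝ × ℝ ↦ (⟨permExt hW.complete (Φ p.1) (q₀, 0, s₀, Circle.exp p.2),
      mfderiv (modelStab E) (modelStab E) (permExt hW.complete (Φ p.1))
        (q₀, 0, s₀, Circle.exp p.2)
        ((d.1, d.2.1, 0, mfderiv 𝓘(ℝ, ℝ) (𝓡 1) Circle.exp p.2 d.2.2) :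
          E × ℂ × ℝ × EuclideanSpace ℝ (Fin 1))⟩ : TangentBundle (modelStab E) (Stab F)))
      (Set.Icc (0 : ℝ) 1 ×ˢ Set.univ) := by
  have : IsManifold 𝓘(ℝ, E) 1 F := .of_le (n := ∞) (by simp)
  rintro ⟨t₀, r₀⟩ ⟨ht₀, -⟩
  have ht₀' : t₀ ∈ Set.Icc (0 : ℝ) 1 := ht₀
  set γ : E × ℂ × ℝ → Stab F := stabParam q₀ s₀ with hγ
  have hγa : ∀ r, γ (0, 0, r) = (q₀, 0, s₀, Circle.exp r) := fun r ↦ stabParam_apply q₀ s₀ r 0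
  have hxD : ∀ r, γ (0, 0, r) ∈ hitDomain hW.complete psi c := fun r ↦ by
    rw [hγa]
    exact doubleCircle_subset_hitDomain hW.complete (hx _)
  have hπx : hitPoint hW.complete psi c (γ (0, 0, r₀)) = (q₀, 0, s₀, Circle.exp r₀) := by
    rw [hγa, hitPoint_of_mem hW hreg (hx _)]
  obtain ⟨U, g, hxU, hU, hgU, hgΦ⟩ := hΦ.2 ⟨(t₀, (q₀, 0, s₀, Circle.exp r₀)), ht₀', hx _⟩
  -- A smooth local extension of the isotopy, precomposed with the projection, is smooth jointly in
  -- all variables, including times outside `[0, 1]`. For times in `[0, 1]` it agrees with `permExt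
  -- (Φ t)` near the parameters considered, hence has the same derivative.
  let h : ℝ → E × ℂ × ℝ → Stab F := fun t p ↦ g (t, hitPoint hW.complete psi c (γ p))
  have hin : ContMDiffAt (𝓘(ℝ, ℝ).prod 𝓘(ℝ, E × ℂ × ℝ)) (𝓘(ℝ, ℝ).prod (modelStab E)) ∞
      (fun p : ℝ × (E × ℂ × ℝ) ↦ (p.1, hitPoint hW.complete psi c (γ p.2)))
      (t₀, ((0, 0, r₀) : E × ℂ × ℝ)) := by
    refine contMDiffAt_fst.prodMk ?_
    refine ContMDiffAt.comp (t₀, ((0, 0, r₀) : E × ℂ × ℝ))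
      (g := fun p ↦ hitPoint hW.complete psi c (γ p)) (f := Prod.snd)
      (I' := 𝓘(ℝ, E × ℂ × ℝ)) ?_ contMDiffAt_snd
    exact ContMDiffAt.comp ((0, 0, r₀) : E × ℂ × ℝ) (g := hitPoint hW.complete psi c)
      (I' := modelStab E) (contMDiffAt_hitPoint hW hreg (hxD r₀)) (contMDiffAt_stabParam q₀ s₀ r₀)
  have hinU : ∀ᶠ p in 𝓝 (t₀, ((0, 0, r₀) : E × ℂ × ℝ)),
      (p.1, hitPoint hW.complete psi c (γ p.2)) ∈ U :=
    hin.continuousAt.eventually_mem (hU.mem_nhds (by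
      change (t₀, hitPoint hW.complete psi c (γ (0, 0, r₀))) ∈ U
      rwa [hπx]))
  have hh : ContMDiffAt (𝓘(ℝ, ℝ).prod 𝓘(ℝ, E × ℂ × ℝ)) (modelStab E) ∞ (Function.uncurry h)
      (t₀, ((0, 0, r₀) : E × ℂ × ℝ)) :=
    ContMDiffAt.comp (t₀, ((0, 0, r₀) : E × ℂ × ℝ)) (g := g)
      (hgU.contMDiffAt (hU.mem_nhds hinU.self_of_nhds)) hin
  have hγD : ∀ᶠ p in 𝓝 (t₀, ((0, 0, r₀) : E × ℂ × ℝ)),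
      γ p.2 ∈ hitDomain hW.complete psi c := by
    have h1 := (contMDiffAt_stabParam q₀ s₀ r₀).continuousAt.eventually_mem
      ((isOpen_hitDomain hW hreg).mem_nhds (hxD r₀))
    have h2 : Filter.Tendsto Prod.snd (𝓝 (t₀, ((0, 0, r₀) : E × ℂ × ℝ)))
      (𝓝 ((0, 0, r₀) : E × ℂ × ℝ)) := continuousAt_snd
    exact h2.eventually h1
  have key : ContinuousAt (fun p : ℝ × ℝ ↦ (⟨h p.1 (0, 0, p.2), mfderiv 𝓘(ℝ, E × ℂ × ℝ)
      (modelStab E) (h p.1) (0, 0, p.2) d⟩ : TangentBundle (modelStab E) (Stab F))) (t₀, r₀) := by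
    have hb : ContMDiff (𝓘(ℝ, ℝ).prod 𝓘(ℝ, ℝ)) 𝓘(ℝ, E × ℂ × ℝ) 0
        (fun p : ℝ × ℝ ↦ ((0, 0, p.2) : E × ℂ × ℝ)) := by
      rw [contMDiff_zero_iff]
      fun_prop
    refine (contMDiffAt_mfderiv_section (J := 𝓘(ℝ, ℝ).prod 𝓘(ℝ, ℝ)) (I := 𝓘(ℝ, E × ℂ × ℝ))
      (f := fun p : ℝ × ℝ ↦ h p.1) (g := fun p : ℝ × ℝ ↦ ((0, 0, p.2) : E × ℂ × ℝ))
      (v := fun _ ↦ d) (x₀ := (t₀, r₀)) (m := 0) (n := ∞) ?_ hb.contMDiffAt ?_ (by simp)).continuousAt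
    · refine ContMDiffAt.comp ((t₀, r₀), ((0, 0, r₀) : E × ℂ × ℝ)) (g := Function.uncurry h)
        (f := fun p : (ℝ × ℝ) × (E × ℂ × ℝ) ↦ (p.1.1, p.2))
        (I' := 𝓘(ℝ, ℝ).prod 𝓘(ℝ, E × ℂ × ℝ)) hh ?_
      exact (contMDiffAt_fst.fst).prodMk contMDiffAt_snd
    · have hv : ContMDiff 𝓘(ℝ, E × ℂ × ℝ) 𝓘(ℝ, E × ℂ × ℝ).tangent 0
          (fun p ↦ (⟨p, d⟩ : TangentBundle 𝓘(ℝ, E × ℂ × ℝ) (E × ℂ × ℝ))) :=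
        contMDiff_vectorSpace_iff_contDiff.2 contDiff_const
      exact hv.contMDiffAt.comp (t₀, r₀) hb.contMDiffAt
  have hr : ContinuousAt (fun p : ℝ × ℝ ↦ (p.1, ((0, 0, p.2) : E × ℂ × ℝ))) (t₀, r₀) := by
    fun_prop
  have hev := hr.eventually (hinU.and hγD).eventually_nhds
  refine key.continuousWithinAt.congr_of_eventuallyEq_of_mem ?_ ⟨ht₀, Set.mem_univ _⟩
  filter_upwards [nhdsWithin_le_nhds hev, self_mem_nhdsWithin] with p hp hpt
  have hpt' : p.1 ∈ Set.Icc (0 : ℝ) 1 := hpt.1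
  have h1 : permExt hW.complete (Φ p.1) ∘ γ =ᶠ[𝓝 ((0, 0, p.2) : E × ℂ × ℝ)] h p.1 := by
    have h2 : ContinuousAt (fun y : E × ℂ × ℝ ↦ (p.1, y)) (0, 0, p.2) := by fun_prop
    filter_upwards [h2.eventually hp] with y hy
    rw [Function.comp_apply, permExt_apply _ hy.2]
    exact hgΦ ⟨(p.1, hitPoint hW.complete psi c (γ y)), hpt', hitPoint_mem hy.2⟩ hy.1
  have h3 : h p.1 (0, 0, p.2) = permExt hW.complete (Φ p.1) (q₀, 0, s₀, Circle.exp p.2) := by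
    rw [← h1.self_of_nhds, Function.comp_apply, hγa]
  have h4 := mfderiv_comp_stabParam (q₀ := q₀) (s₀ := s₀) (r := p.2)
    ((contMDiffAt_permExt hW hreg (hΦ.1 p.1 hpt').1 (by
      rw [← hγa]; exact hxD p.2)).mdifferentiableAt (by simp)) d
  have h5 : ∀ x y : Stab F, x = y → ∀ v w : E × ℂ × ℝ × EuclideanSpace ℝ (Fin 1), v = w →
      (⟨x, v⟩ : TangentBundle (modelStab E) (Stab F)) = ⟨y, w⟩ := by
    rintro x _ rfl v _ rfl
    rfl
  refine (h5 _ _ h3 _ _ ?_).symm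
  exact (DFunLike.congr_fun h1.mfderiv_eq d).symm.trans h4

end IsotopyContinuity

end WeinsteinStab

namespace WeinsteinStab

/-! ### The base circle over a minimum of `ψ_F` -/

section CriticalPoint

variable {E : Type*} [NormedAddCommGroup E] [NormedSpace ℝ E]
  {F : Type*} [TopologicalSpace F] [ChartedSpace E F]
  {Z : ∀ q : F, TangentSpace 𝓘(ℝ, E) q}
  {om : ∀ q : F, TangentSpace 𝓘(ℝ, E) q →L[ℝ] TangentSpace 𝓘(ℝ, E) q →L[ℝ] ℝ} {psi : F → ℝ}
  {c : ℝ}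

lemma mfderiv_twist_of_eq_zero (a : ℝ) (k : ℤ) {x : Stab F} (hx : x.2.1 = 0)
    (v : TangentSpace (modelStab E) x) :
    (mfderiv (modelStab E) (modelStab E) (twist a k) x v :
      E × ℂ × ℝ × EuclideanSpace ℝ (Fin 1)) =
    (v.1, ((x.2.2.2 ^ k : Circle) : ℂ) * v.2.1, v.2.2.1, v.2.2.2) := by
  have hd : MDifferentiableAt (modelStab E) (modelStab E) (fun x : Stab F ↦ twist a k x) x :=
    (contMDiff_twist_right a k).mdifferentiableAt (by simp)
  have e1 : (mfderiv (modelStab E) (modelStab E) (twist a k) x v).1 = v.1 :=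
    (mfderiv_stab_fst hd v).symm.trans (DFunLike.congr_fun (hasMFDerivAt_stab_fst x).mfderiv v)
  have e2 : (mfderiv (modelStab E) (modelStab E) (twist a k) x v).2.1 =
      ((x.2.2.2 ^ k : Circle) : ℂ) * v.2.1 := by
    refine (mfderiv_stab_complex hd v).symm.trans ((mvfderiv_twist_complex k x v).trans ?_)
    rw [hx, mul_zero, add_zero]
  have e3 : (mfderiv (modelStab E) (modelStab E) (twist a k) x v).2.2.1 = v.2.2.1 := by
    refine (mfderiv_stab_real hd v).symm.trans ?_
    have h1 : HasFDerivAt (fun p : ℂ × ℝ ↦ p.2 - a * Complex.normSq p.1 / 4)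
        (ContinuousLinearMap.snd ℝ ℂ ℝ) ((0 : ℂ), x.2.2.1) := by
      have h2 : HasFDerivAt (fun p : ℂ × ℝ ↦ ‖p.1‖ ^ 2) (0 : ℂ × ℝ →L[ℝ] ℝ)
          ((0 : ℂ), x.2.2.1) := by
        have h := (hasFDerivAt_fst (𝕜 := ℝ) (p := ((0 : ℂ), x.2.2.1))).norm_sq
        simpa using h
      have h3 := (hasFDerivAt_snd (𝕜 := ℝ) (p := ((0 : ℂ), x.2.2.1))).sub (h2.const_mul (a / 4))
      rw [smul_zero, sub_zero] at h3
      refine h3.congr_of_eventuallyEq (Filter.Eventually.of_forall fun p ↦ ?_)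
      change p.2 - a * Complex.normSq p.1 / 4 = p.2 - a / 4 * ‖p.1‖ ^ 2
      rw [Complex.normSq_eq_norm_sq]
      ring
    rw [← hx] at h1
    have h4 := HasMFDerivAt.comp x (g := fun p : ℂ × ℝ ↦ p.2 - a * Complex.normSq p.1 / 4)
      (f := fun x : Stab F ↦ (x.2.1, x.2.2.1)) (I' := 𝓘(ℝ, ℂ × ℝ)) h1.hasMFDerivAt
      ⟨(hasMFDerivAt_stab_complex (E := E) x).1.prodMk (hasMFDerivAt_stab_real (E := E) x).1,
        (hasMFDerivAt_stab_complex (E := E) x).2.prodMk (hasMFDerivAt_stab_real (E := E) x).2⟩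
    exact DFunLike.congr_fun h4.mfderiv v
  have e4 : (mfderiv (modelStab E) (modelStab E) (twist a k) x v).2.2.2 = v.2.2.2 :=
    (mfderiv_stab_circle hd v).symm.trans
      (DFunLike.congr_fun (hasMFDerivAt_stab_circle x).mfderiv v)
  exact Prod.ext e1 (Prod.ext e2 (Prod.ext e3 e4))

lemma mvfderiv_psiPrime_of_critical (hpsi : ContMDiff 𝓘(ℝ, E) 𝓘(ℝ, ℝ) ∞ psi) {x : Stab F}
    (hq : mfderiv 𝓘(ℝ, E) 𝓘(ℝ, ℝ) psi x.1 = 0) (hz : x.2.1 = 0)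
    (v : TangentSpace (modelStab E) x) :
    mvfderiv (modelStab E) (psiPrime psi) x v = 2 * x.2.2.1 * v.2.2.1 := by
  have hd1 : HasMFDerivAt 𝓘(ℝ, E) 𝓘(ℝ, ℝ) psi x.1 0 := by
    rw [← hq]
    exact (hpsi.mdifferentiableAt (by simp)).hasMFDerivAt
  have hd2 : HasFDerivAt (fun z : ℂ ↦ ‖z‖ ^ 2) (0 : ℂ →L[ℝ] ℝ) x.2.1 := by
    have h := (hasStrictFDerivAt_norm_sq (F := ℂ) x.2.1).hasFDerivAt
    rw [hz] at h ⊢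
    simpa using h
  have hd3 : HasFDerivAt (fun s : ℝ ↦ s ^ 2)
      (ContinuousLinearMap.toSpanSingleton ℝ (2 * x.2.2.1)) x.2.2.1 := by
    simpa using (hasDerivAt_pow 2 x.2.2.1).hasFDerivAt
  have h := ((HasMFDerivAt.comp x hd1 (hasMFDerivAt_stab_fst (E := E) x)).add
    (HasMFDerivAt.comp x (f := fun x : Stab F ↦ x.2.1) hd2.hasMFDerivAt
      (hasMFDerivAt_stab_complex (E := E) x))).add
    (HasMFDerivAt.comp x (f := fun x : Stab F ↦ x.2.2.1) hd3.hasMFDerivAt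
      (hasMFDerivAt_stab_real (E := E) x))
  refine (DFunLike.congr_fun h.mfderiv v).trans ?_
  change (0 : ℝ) + 0 + v.2.2.1 * (2 * x.2.2.1) = _
  ring

/-- A minimum of `ψ_F` exists because `ψ_F` is exhausting. There the derivative of `ψ_F` along the
flow is zero, and the gradient-like inequality makes both `dψ_F` and `Z_F` vanish. -/
lemma exists_critical_le [IsManifold 𝓘(ℝ, E) ∞ F] (hW : IsWeinstein om Z psi) (q₁ : F) :
    ∃ q, psi q ≤ psi q₁ ∧ mfderiv 𝓘(ℝ, E) 𝓘(ℝ, ℝ) psi q = 0 ∧ Z q = 0 := by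
  obtain ⟨b, hb⟩ := hW.exhausting.2
  have hK : IsCompact (psi ⁻¹' Set.Icc b (psi q₁)) := hW.exhausting.1.isCompact_preimage isCompact_Icc
  obtain ⟨q, hq, hmin⟩ := hK.exists_isMinOn ⟨q₁, hb (Set.mem_range_self _), le_refl (psi q₁)⟩
    hW.morse.1.continuous.continuousOn
  have hglob : ∀ p, psi q ≤ psi p := by
    intro p
    by_cases hp : psi p ≤ psi q₁
    · exact hmin ⟨hb (Set.mem_range_self _), hp⟩
    · exact hq.2.trans (not_le.1 hp).le
  refine ⟨q, hq.2, hW.gradientLike.mfderiv_eq_zero ?_⟩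
  have h1 := hasDerivAt_psiPrime_stabFlow hW ((q, 0, 0, 1) : Stab F) 0
  have h2 : IsLocalMin (fun s ↦ psiPrime psi (stabFlow hW.complete s ((q, 0, 0, 1) : Stab F))) 0 := by
    refine Filter.Eventually.of_forall fun s ↦ ?_
    simp only [psiPrime_stabFlow, flow_zero]
    simpa using hglob _
  have h3 := h2.hasDerivAt_eq_zero h1
  rw [stabFlow_zero, liouvilleRate] at h3
  simpa using h3

end CriticalPoint

/-! ### Linear algebra of `ω'` -/

section OmegaAlgebra

variable {E : Type*} [NormedAddCommGroup E] [NormedSpace ℝ E]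
  {F : Type*} [TopologicalSpace F] [ChartedSpace E F]
  {Z : ∀ q : F, TangentSpace 𝓘(ℝ, E) q}
  {om : ∀ q : F, TangentSpace 𝓘(ℝ, E) q →L[ℝ] TangentSpace 𝓘(ℝ, E) q →L[ℝ] ℝ}

lemma omegaPrime_add_smul_left (x : Stab F) (a : ℝ) (u v w : TangentSpace (modelStab E) x) :
    omegaPrime om x (u + a • v) w = omegaPrime om x u w + a * omegaPrime om x v w := by
  have h1 : om x.1 (u.1 + a • v.1) w.1 = om x.1 u.1 w.1 + a * om x.1 v.1 w.1 := by
    have h : ∀ (B : E →L[ℝ] E →L[ℝ] ℝ) (u v w : E), B (u + a • v) w = B u w + a * B v w := by simp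
    exact h _ _ _ _
  have h2 : dTheta x.2.2.2 (u.2.2.2 + a • v.2.2.2) =
      dTheta x.2.2.2 u.2.2.2 + a * dTheta x.2.2.2 v.2.2.2 := by
    have h : ∀ (B : EuclideanSpace ℝ (Fin 1) →L[ℝ] ℝ) (u v : EuclideanSpace ℝ (Fin 1)),
        B (u + a • v) = B u + a * B v := by simp
    exact h _ _ _
  have h3 : omegaPrime om x (u + a • v) w = om x.1 (u.1 + a • v.1) w.1 +
      ((u.2.1 + a • v.2.1).re * w.2.1.im - (u.2.1 + a • v.2.1).im * w.2.1.re)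
    + 2 * ((u.2.2.1 + a * v.2.2.1) * dTheta x.2.2.2 w.2.2.2 -
      dTheta x.2.2.2 (u.2.2.2 + a • v.2.2.2) * w.2.2.1) := rfl
  rw [h3, h1, h2, omegaPrime, omegaPrime]
  simp only [Complex.add_re, Complex.add_im, Complex.smul_re, Complex.smul_im, smul_eq_mul]
  ring

lemma omegaPrime_swap (hom : ∀ (q : F) (v : TangentSpace 𝓘(ℝ, E) q), om q v v = 0) (x : Stab F)
    (u v : TangentSpace (modelStab E) x) : omegaPrime om x u v = -omegaPrime om x v u := by
  have h1 : om x.1 u.1 v.1 = - om x.1 v.1 u.1 := by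
    have h := hom x.1 (u.1 + v.1)
    have h2 : om x.1 (u.1 + v.1) (u.1 + v.1) =
        om x.1 u.1 u.1 + om x.1 v.1 u.1 + (om x.1 u.1 v.1 + om x.1 v.1 v.1) := by
      have h : ∀ (B : E →L[ℝ] E →L[ℝ] ℝ) (u v : E),
          B (u + v) (u + v) = B u u + B v u + (B u v + B v v) := by
        intro B u v
        simp only [map_add, add_apply]
      exact h _ _ _
    have h3 : om x.1 u.1 u.1 = 0 := hom _ _
    have h4 : om x.1 v.1 v.1 = 0 := hom _ _
    rw [h2, h3, h4] at h
    linarith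
  rw [omegaPrime, omegaPrime, h1]
  ring

/-- Since `ι_{Z'} ω' = α`, the vector `Z'` is `ω'`-orthogonal to `ker α`, including itself. This
freedom absorbs the Liouville component in the injectivity argument. -/
lemma omegaPrime_add_smul_zPrime (hom : ∀ (q : F) (v : TangentSpace 𝓘(ℝ, E) q), om q v v = 0)
    (x : Stab F) {u v : TangentSpace (modelStab E) x} (hu : alphaForm om Z x u = 0)
    (hv : alphaForm om Z x v = 0) (a b : ℝ) :
    omegaPrime om x (u + a • zPrime Z x) (v + b • zPrime Z x) = omegaPrime om x u v := by
  have h1 : ∀ w, omegaPrime om x (zPrime Z x) w = alphaForm om Z x w := fun _ ↦ rfl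
  rw [omegaPrime_add_smul_left, h1, map_add, map_smul, hv, alphaForm_zPrime hom, smul_zero,
    add_zero, mul_zero, add_zero, omegaPrime_swap hom, omegaPrime_add_smul_left, h1, hu, mul_zero,
    add_zero, ← omegaPrime_swap hom]

end OmegaAlgebra

/-! ### The complex frame of the stabilization -/

section Frame

variable {E : Type*} [NormedAddCommGroup E] [NormedSpace ℝ E]
  {F : Type*} [TopologicalSpace F] [ChartedSpace E F] {m : ℕ}
  {Z : ∀ q : F, TangentSpace 𝓘(ℝ, E) q}
  {om : ∀ q : F, TangentSpace 𝓘(ℝ, E) q →L[ℝ] TangentSpace 𝓘(ℝ, E) q →L[ℝ] ℝ}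
  {J : ∀ q : F, TangentSpace 𝓘(ℝ, E) q →L[ℝ] TangentSpace 𝓘(ℝ, E) q}

/-- The complex trivialisation of the tangent bundle of `F × ℂ × ℝ × S¹` induced by one of `TF`. -/
noncomputable def stabFrame (ν : ∀ q : F, TangentSpace 𝓘(ℝ, E) q ≃ₗ[ℝ] (Fin m → ℂ)) (x : Stab F) :
    TangentSpace (modelStab E) x →ₗ[ℝ] ((Fin m → ℂ) × ℂ) × ℂ where
  toFun v := ((ν x.1 v.1, v.2.1), (v.2.2.1 : ℂ) + (dTheta x.2.2.2 v.2.2.2 : ℝ) * Complex.I)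
  map_add' u v := by
    refine Prod.ext (Prod.ext ((ν x.1).map_add u.1 v.1) rfl) ?_
    have h := (dTheta x.2.2.2).map_add u.2.2.2 v.2.2.2
    refine (congrArg (fun t : ℝ ↦ ((u.2.2.1 + v.2.2.1 : ℝ) : ℂ) + t * Complex.I) h).trans ?_
    change _ = ((u.2.2.1 : ℂ) + (dTheta x.2.2.2 u.2.2.2 : ℝ) * Complex.I) +
      ((v.2.2.1 : ℂ) + (dTheta x.2.2.2 v.2.2.2 : ℝ) * Complex.I)
    push_cast
    ring
  map_smul' a v := by
    refine Prod.ext (Prod.ext ((ν x.1).map_smul a v.1) rfl) ?_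
    have h := (dTheta x.2.2.2).map_smul a v.2.2.2
    refine (congrArg (fun t : ℝ ↦ ((a * v.2.2.1 : ℝ) : ℂ) + t * Complex.I) h).trans ?_
    change _ = a • ((v.2.2.1 : ℂ) + (dTheta x.2.2.2 v.2.2.2 : ℝ) * Complex.I)
    rw [Complex.real_smul, smul_eq_mul]
    push_cast
    ring

lemma stabFrame_mk (ν : ∀ q : F, TangentSpace 𝓘(ℝ, E) q ≃ₗ[ℝ] (Fin m → ℂ)) (x : Stab F)
    (e : E) (z : ℂ) (s : ℝ) (w : EuclideanSpace ℝ (Fin 1)) :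
    stabFrame ν x ((e, z, s, w) : E × ℂ × ℝ × EuclideanSpace ℝ (Fin 1)) =
      ((ν x.1 e, z), (s : ℂ) + (dTheta x.2.2.2 w : ℝ) * Complex.I) := rfl

lemma stabFrame_congr (ν : ∀ q : F, TangentSpace 𝓘(ℝ, E) q ≃ₗ[ℝ] (Fin m → ℂ)) {x y : Stab F}
    (h : x = y) {v w : E × ℂ × ℝ × EuclideanSpace ℝ (Fin 1)} (h' : v = w) :
    stabFrame ν x v = stabFrame ν y w := by
  subst h h'
  rfl

lemma stabFrame_injective (ν : ∀ q : F, TangentSpace 𝓘(ℝ, E) q ≃ₗ[ℝ] (Fin m → ℂ)) (x : Stab F) :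
    Function.Injective (stabFrame ν x) := by
  rw [injective_iff_map_eq_zero]
  intro v hv
  have h1 : ν x.1 v.1 = 0 := congrArg (fun p ↦ p.1.1) hv
  have h2 : v.2.1 = 0 := congrArg (fun p ↦ p.1.2) hv
  have h3 : (v.2.2.1 : ℂ) + (dTheta x.2.2.2 v.2.2.2 : ℝ) * Complex.I = 0 := congrArg Prod.snd hv
  have h4 : v.2.2.1 = 0 := by simpa using congrArg Complex.re h3
  have h5 : dTheta x.2.2.2 v.2.2.2 = 0 := by simpa using congrArg Complex.im h3
  have h6 : v.1 = 0 := (ν x.1).map_eq_zero_iff.1 h1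
  have h7 : v.2.2.2 = 0 := dTheta_injective _ (h5.trans (map_zero (dTheta x.2.2.2)).symm)
  exact Prod.ext h6 (Prod.ext h2 (Prod.ext h4 h7))

/-- The complex structure induced by the frame is tamed by `ω'`. -/
lemma omegaPrime_nonneg_of_stabFrame (hJ : IsTamed om J)
    {ν : ∀ q : F, TangentSpace 𝓘(ℝ, E) q ≃ₗ[ℝ] (Fin m → ℂ)}
    (hν : ∀ (q : F) (v : TangentSpace 𝓘(ℝ, E) q), ν q (J q v) = Complex.I • ν q v) (x : Stab F)
    {u v : TangentSpace (modelStab E) x}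
    (h : stabFrame ν x v = Complex.I • stabFrame ν x u) : 0 ≤ omegaPrime om x u v := by
  have h1 : ν x.1 v.1 = Complex.I • ν x.1 u.1 := congrArg (fun p ↦ p.1.1) h
  have h2 : v.2.1 = Complex.I * u.2.1 := congrArg (fun p ↦ p.1.2) h
  have h3 : (v.2.2.1 : ℂ) + (dTheta x.2.2.2 v.2.2.2 : ℝ) * Complex.I =
    Complex.I * ((u.2.2.1 : ℂ) + (dTheta x.2.2.2 u.2.2.2 : ℝ) * Complex.I) := congrArg Prod.snd h
  have h4 : v.2.2.1 = - dTheta x.2.2.2 u.2.2.2 := by simpa using congrArg Complex.re h3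
  have h5 : dTheta x.2.2.2 v.2.2.2 = u.2.2.1 := by simpa using congrArg Complex.im h3
  have h6 : v.1 = J x.1 u.1 := (ν x.1).injective (h1.trans (hν x.1 u.1).symm)
  have h7 : 0 ≤ om x.1 u.1 v.1 := by
    have h8 : om x.1 u.1 v.1 = om x.1 u.1 (J x.1 u.1) := congrArg (om x.1 u.1) h6
    rw [h8]
    by_cases hu : u.1 = 0
    · have h9 : om x.1 u.1 (J x.1 u.1) = om x.1 0 (J x.1 u.1) :=
        congrArg (fun w : TangentSpace 𝓘(ℝ, E) x.1 ↦ om x.1 w (J x.1 u.1)) hu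
      rw [h9, map_zero]
      exact le_refl (0 : ℝ)
    · exact (hJ x.1 u.1 hu).le
  rw [omegaPrime, h2, h4, h5]
  simp only [Complex.mul_re, Complex.mul_im, Complex.I_re, Complex.I_im]
  -- In the frame, pairing `u` with `i u` gives `ω_F(u, Ju)` plus sums of squares from ℂ and from
  -- `(s, θ)`.
  have h10 : om x.1 u.1 v.1 + (u.2.1.re * (0 * u.2.1.im + 1 * u.2.1.re) -
      u.2.1.im * (0 * u.2.1.re - 1 * u.2.1.im)) +
      2 * (u.2.2.1 * u.2.2.1 - dTheta x.2.2.2 u.2.2.2 * -dTheta x.2.2.2 u.2.2.2) =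
      om x.1 u.1 v.1 + (u.2.1.re ^ 2 + u.2.1.im ^ 2) +
        2 * (u.2.2.1 ^ 2 + (dTheta x.2.2.2 u.2.2.2) ^ 2) := by ring
  rw [h10]
  positivity

lemma continuous_stabFrame [IsManifold 𝓘(ℝ, E) ∞ F]
    {ν : ∀ q : F, TangentSpace 𝓘(ℝ, E) q ≃ₗ[ℝ] (Fin m → ℂ)}
    (hν : Continuous (fun v : TangentBundle 𝓘(ℝ, E) F ↦ ν v.1 v.2)) :
    Continuous (fun v : TangentBundle (modelStab E) (Stab F) ↦ stabFrame ν v.1 v.2) :=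
  ((hν.comp continuous_tangentBundle_stab_fst).prodMk continuous_tangentBundle_stab_complex).prodMk
    ((Complex.continuous_ofReal.comp continuous_tangentBundle_stab_real).add
      ((Complex.continuous_ofReal.comp continuous_tangentBundle_stab_circle).mul continuous_const))

lemma continuous_stabFrame_zPrime [IsManifold 𝓘(ℝ, E) ∞ F]
    {ν : ∀ q : F, TangentSpace 𝓘(ℝ, E) q ≃ₗ[ℝ] (Fin m → ℂ)}
    (hν : Continuous (fun v : TangentBundle 𝓘(ℝ, E) F ↦ ν v.1 v.2))
    (hZ : Continuous (fun q ↦ (⟨q, Z q⟩ : TangentBundle 𝓘(ℝ, E) F))) :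
    Continuous (fun x : Stab F ↦ stabFrame ν x (zPrime Z x)) := by
  have h : ∀ x : Stab F, stabFrame ν x (zPrime Z x) =
      ((ν x.1 (Z x.1), (1 / 2 : ℂ) * x.2.1), (x.2.2.1 : ℂ)) := by
    intro x
    have h0 : dTheta x.2.2.2 (0 : EuclideanSpace ℝ (Fin 1)) = 0 := (dTheta x.2.2.2).map_zero
    refine (stabFrame_mk ν x _ _ _ _).trans ?_
    rw [h0]
    simp
  simp only [h]
  exact (((hν.comp hZ).comp continuous_fst).prodMk (by fun_prop)).prodMk (by fun_prop)

end Frame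

end WeinsteinStab

namespace WeinsteinStab

/-! ### The determinant loop and the obstruction -/

section Obstruction

variable {E : Type*} [NormedAddCommGroup E] [NormedSpace ℝ E]
  {F : Type*} [TopologicalSpace F] [ChartedSpace E F] {m : ℕ}
  {Z : ∀ q : F, TangentSpace 𝓘(ℝ, E) q}
  {om : ∀ q : F, TangentSpace 𝓘(ℝ, E) q →L[ℝ] TangentSpace 𝓘(ℝ, E) q →L[ℝ] ℝ} {psi : F → ℝ}
  {J : ∀ q : F, TangentSpace 𝓘(ℝ, E) q →L[ℝ] TangentSpace 𝓘(ℝ, E) q} {c : ℝ}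
  (ν : ∀ q : F, TangentSpace 𝓘(ℝ, E) q ≃ₗ[ℝ] (Fin m → ℂ))

/-- The derivative of `g` on the contact plane at `(q₀, 0, s₀, u)`, read in the frame. -/
noncomputable def frameDeriv (g : Stab F → Stab F) (q₀ : F) (s₀ : ℝ) (u : Circle) :
    (Fin m → ℂ) × ℂ →ₗ[ℝ] ((Fin m → ℂ) × ℂ) × ℂ where
  toFun k := stabFrame ν (g (q₀, 0, s₀, u)) (mfderiv (modelStab E) (modelStab E) g (q₀, 0, s₀, u)
    (((ν q₀).symm k.1, k.2, 0, 0) : E × ℂ × ℝ × EuclideanSpace ℝ (Fin 1)))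
  map_add' k k' := by
    have h : (((ν q₀).symm (k + k').1, (k + k').2, 0, 0) :
        E × ℂ × ℝ × EuclideanSpace ℝ (Fin 1)) =
        ((ν q₀).symm k.1, k.2, 0, 0) + ((ν q₀).symm k'.1, k'.2, 0, 0) :=
      Prod.ext ((ν q₀).symm.map_add k.1 k'.1) (Prod.ext rfl
        (Prod.ext (add_zero _).symm (add_zero _).symm))
    refine (stabFrame_congr ν rfl ((mfderiv_congr_apply rfl h).trans (map_add _ _ _))).trans ?_
    exact map_add (stabFrame ν (g (q₀, 0, s₀, u))) _ _
  map_smul' a k := by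
    have h : (((ν q₀).symm (a • k).1, (a • k).2, 0, 0) :
        E × ℂ × ℝ × EuclideanSpace ℝ (Fin 1)) =
        a • (((ν q₀).symm k.1, k.2, 0, 0) : E × ℂ × ℝ × EuclideanSpace ℝ (Fin 1)) :=
      Prod.ext ((ν q₀).symm.map_smul a k.1) (Prod.ext rfl
        (Prod.ext (smul_zero a).symm (smul_zero a).symm))
    refine (stabFrame_congr ν rfl ((mfderiv_congr_apply rfl h).trans (map_smul _ _ _))).trans ?_
    exact map_smul (stabFrame ν (g (q₀, 0, s₀, u))) _ _

/-- The complex linear part of the derivative of `g` on the contact plane, completed by the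
Liouville direction. -/
noncomputable def frameMap (Z : ∀ q : F, TangentSpace 𝓘(ℝ, E) q) (g : Stab F → Stab F) (q₀ : F)
    (s₀ : ℝ) (u : Circle) : ((Fin m → ℂ) × ℂ) × ℂ →ₗ[ℂ] ((Fin m → ℂ) × ℂ) × ℂ :=
  (complexPart (frameDeriv ν g q₀ s₀ u)).coprod (LinearMap.toSpanSingleton ℂ _
    (stabFrame ν (g (q₀, 0, s₀, u)) (zPrime Z (g (q₀, 0, s₀, u)))))

lemma frameMap_apply (g : Stab F → Stab F) (q₀ : F) (s₀ : ℝ) (u : Circle)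
    (k : ((Fin m → ℂ) × ℂ) × ℂ) : frameMap ν Z g q₀ s₀ u k =
    (1 / 2 : ℂ) • (frameDeriv ν g q₀ s₀ u k.1 -
      Complex.I • frameDeriv ν g q₀ s₀ u (Complex.I • k.1)) +
    k.2 • stabFrame ν (g (q₀, 0, s₀, u)) (zPrime Z (g (q₀, 0, s₀, u))) := rfl

variable {ν} [IsManifold 𝓘(ℝ, E) ∞ F] [T2Space F] [FiniteDimensional ℝ E]
  (hW : IsWeinstein om Z psi) (hreg : IsRegularValueStab E (psiStab psi) c)
  {q₀ : F} {s₀ : ℝ} (hx : ∀ u : Circle, ((q₀, 0, s₀, u) : Stab F) ∈ doubleCircle psi c)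

include hreg hx

lemma continuousOn_frameMap (hν : Continuous (fun v : TangentBundle 𝓘(ℝ, E) F ↦ ν v.1 v.2))
    {Φ : ℝ → Equiv.Perm (doubleCircle psi c)} (hΦ : IsIsotopy (modelStab E) Φ)
    (k : ((Fin m → ℂ) × ℂ) × ℂ) :
    ContinuousOn (fun p : ℝ × ℝ ↦
      frameMap ν Z (permExt hW.complete (Φ p.1)) q₀ s₀ (Circle.exp p.2) k)
      (Set.Icc (0 : ℝ) 1 ×ˢ Set.univ) := by
  have h1 : ∀ k : (Fin m → ℂ) × ℂ, ContinuousOn (fun p : ℝ × ℝ ↦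
      frameDeriv ν (permExt hW.complete (Φ p.1)) q₀ s₀ (Circle.exp p.2) k)
      (Set.Icc (0 : ℝ) 1 ×ˢ Set.univ) := by
    intro k
    refine ((continuous_stabFrame hν).comp_continuousOn
      (continuousOn_mfderiv_isotopy hW hreg hΦ hx ((ν q₀).symm k.1, k.2, 0))).congr fun p _ ↦ ?_
    exact stabFrame_congr ν rfl (mfderiv_congr_apply rfl (congrArg
      (fun w : EuclideanSpace ℝ (Fin 1) ↦ (((ν q₀).symm k.1 : E), k.2, (0 : ℝ), w))
      (mfderiv_circleExp_zero_apply p.2).symm))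
  have h2 : ContinuousOn (fun p : ℝ × ℝ ↦
      permExt hW.complete (Φ p.1) (q₀, 0, s₀, Circle.exp p.2)) (Set.Icc (0 : ℝ) 1 ×ˢ Set.univ) := by
    have hp : Continuous (fun v : TangentBundle (modelStab E) (Stab F) ↦ v.1) :=
      FiberBundle.continuous_proj _ _
    exact hp.comp_continuousOn (continuousOn_mfderiv_isotopy hW hreg hΦ hx 0)
  have h3 := (continuous_stabFrame_zPrime hν hW.smooth_field.continuous).comp_continuousOn h2
  exact (((h1 k.1).sub ((h1 _).const_smul Complex.I)).const_smul (1 / 2 : ℂ)).add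
    (h3.const_smul k.2)

/-- The twist fixes the base circle. There its derivative on `TF ⊕ ℂ` is `id ⊕ u^k`, since the shear
is quadratic in `z`, and the projection is the identity on these tangent vectors. `Z'` reads `(0, 0,
s₀)` in the frame, so the map is block diagonal. -/
lemma frameMap_twistPerm (hq : mfderiv 𝓘(ℝ, E) 𝓘(ℝ, ℝ) psi q₀ = 0) (hZ : Z q₀ = 0) (a : ℝ) (k : ℤ)
    (u : Circle) :
    LinearMap.det (frameMap ν Z (permExt hW.complete (twistPerm hW hreg a k)) q₀ s₀ u) =
      ((u ^ k : Circle) : ℂ) * s₀ := by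
  set x : Stab F := (q₀, 0, s₀, u) with hxdef
  set g := permExt hW.complete (twistPerm hW hreg a k) with hg
  have htw : twist a k x = x := by simp [twist, hxdef]
  have hgx : g x = x := by
    have h := permExt_of_mem hW hreg (twistPerm hW hreg a k) ⟨x, hx u⟩
    rw [twistPerm_apply] at h
    refine h.trans ?_
    rw [htw, hitPoint_of_mem hW hreg (hx u)]
  have hψ : ∀ v : TangentSpace (modelStab E) x,
      mvfderiv (modelStab E) (psiPrime psi) x v = 2 * s₀ * v.2.2.1 :=
    mvfderiv_psiPrime_of_critical hW.morse.1 hq rfl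
  have hder : ∀ (e : E) (ζ : ℂ), (mfderiv (modelStab E) (modelStab E) g x
      ((e, ζ, 0, 0) : E × ℂ × ℝ × EuclideanSpace ℝ (Fin 1)) :
        E × ℂ × ℝ × EuclideanSpace ℝ (Fin 1)) = (e, ((u ^ k : Circle) : ℂ) * ζ, 0, 0) := by
    intro e ζ
    have h1 := mfderiv_permExt_twistPerm hW hreg a k (hx u)
      (v := ((e, ζ, 0, 0) : E × ℂ × ℝ × EuclideanSpace ℝ (Fin 1))) ((hψ _).trans (mul_zero _))
    have h2 := mfderiv_twist_of_eq_zero a k (x := x) rfl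
      ((e, ζ, 0, 0) : E × ℂ × ℝ × EuclideanSpace ℝ (Fin 1))
    refine h1.trans ((mfderiv_congr_apply htw h2).trans ?_)
    exact mfderiv_hitPoint_of_mem hW hreg (hx u) ((hψ _).trans (mul_zero _))
  have hθ : dTheta u (0 : EuclideanSpace ℝ (Fin 1)) = 0 := (dTheta u).map_zero
  have hB : ∀ l : (Fin m → ℂ) × ℂ, frameDeriv ν g q₀ s₀ u l =
      ((l.1, ((u ^ k : Circle) : ℂ) * l.2), 0) := by
    intro l
    refine (stabFrame_congr ν hgx (hder ((ν q₀).symm l.1) l.2)).trans ?_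
    refine (stabFrame_mk ν x _ _ _ _).trans ?_
    change ((ν q₀ ((ν q₀).symm l.1), ((u ^ k : Circle) : ℂ) * l.2), ((0 : ℝ) : ℂ) +
      (dTheta u (0 : EuclideanSpace ℝ (Fin 1)) : ℝ) * Complex.I) = _
    rw [hθ, LinearEquiv.apply_symm_apply]
    simp
  have hZ' : stabFrame ν (g x) (zPrime Z (g x)) = ((0, 0), (s₀ : ℂ)) := by
    rw [hgx]
    refine (stabFrame_mk ν x _ _ _ _).trans ?_
    change ((ν q₀ (Z q₀), (1 / 2 : ℂ) * 0), (s₀ : ℂ) +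
      (dTheta u (0 : EuclideanSpace ℝ (Fin 1)) : ℝ) * Complex.I) = _
    rw [hθ, hZ, map_zero]
    simp
  have hC : frameMap ν Z g q₀ s₀ u = LinearMap.prodMap
      (LinearMap.prodMap (1 : Module.End ℂ (Fin m → ℂ))
        (((u ^ k : Circle) : ℂ) • (1 : Module.End ℂ ℂ))) ((s₀ : ℂ) • (1 : Module.End ℂ ℂ)) := by
    refine LinearMap.ext fun l ↦ ?_
    rw [frameMap_apply, hZ', hB, hB]
    refine Prod.ext (Prod.ext ?_ ?_) ?_
    · ext i
      simp only [Prod.smul_fst, Prod.fst_add, Prod.fst_sub, Pi.add_apply, Pi.smul_apply,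
        Pi.sub_apply, smul_eq_mul, LinearMap.prodMap_apply, Module.End.one_apply, Pi.zero_apply]
      linear_combination (-1 / 2 : ℂ) * l.1.1 i * Complex.I_mul_I
    · simp only [Prod.smul_fst, Prod.fst_add, Prod.fst_sub, Prod.smul_snd, Prod.snd_add,
        Prod.snd_sub, smul_eq_mul, LinearMap.prodMap_apply, Module.End.one_apply,
        LinearMap.smul_apply]
      linear_combination (-1 / 2 : ℂ) * ((u ^ k : Circle) : ℂ) * l.1.2 * Complex.I_mul_I
    · simp [mul_comm]
  rw [hC, LinearMap.det_prodMap, LinearMap.det_prodMap, LinearMap.det_smul, LinearMap.det_smul]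
  simp

omit hx in
/-- The completed complex linear part is invertible for contactomorphisms preserving the
co-orientation. -/
lemma frameMap_injective (hJ : IsTamed om J)
    (hνJ : ∀ (q : F) (v : TangentSpace 𝓘(ℝ, E) q), ν q (J q v) = Complex.I • ν q v)
    {f : Equiv.Perm (doubleCircle psi c)}
    (hf : IsContactomorphism (modelStab E) (xiStab om Z psi) f) {r : ℝ}
    (hx : ((q₀, 0, s₀, Circle.exp r) : Stab F) ∈ doubleCircle psi c)
    (hZ : Z q₀ = 0) (hs : s₀ ≠ 0) {κ : ℝ} (hκ0 : 0 < κ)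
    (hκ : ∀ v : TangentSpace (modelStab E) ((q₀, 0, s₀, Circle.exp r) : Stab F),
      alphaForm om Z (permExt hW.complete f (q₀, 0, s₀, Circle.exp r))
        (mfderiv (modelStab E) (modelStab E) (permExt hW.complete f) (q₀, 0, s₀, Circle.exp r) v) =
        κ * alphaForm om Z (q₀, 0, s₀, Circle.exp r) v) :
    Function.Injective (frameMap ν Z (permExt hW.complete f) q₀ s₀ (Circle.exp r)) := by
  have hxD := doubleCircle_subset_hitDomain hW.complete hx
  rw [injective_iff_map_eq_zero]
  rintro ⟨k, w⟩ h
  rw [frameMap_apply] at h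
  set x : Stab F := (q₀, 0, s₀, Circle.exp r) with hxdef
  set g := permExt hW.complete f with hg
  set y := g x with hy
  let d : (Fin m → ℂ) × ℂ → TangentSpace (modelStab E) y := fun k ↦
    mfderiv (modelStab E) (modelStab E) g x
      (((ν q₀).symm k.1, k.2, 0, 0) : E × ℂ × ℝ × EuclideanSpace ℝ (Fin 1))
  have hθ : dTheta (Circle.exp r) (0 : EuclideanSpace ℝ (Fin 1)) = 0 :=
    (dTheta (Circle.exp r)).map_zero
  have hdα : ∀ k, alphaForm om Z y (d k) = 0 := by
    intro k
    refine (hκ _).trans ?_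
    have h1 : alphaForm om Z x (((ν q₀).symm k.1, k.2, 0, 0) :
        E × ℂ × ℝ × EuclideanSpace ℝ (Fin 1)) = 0 := by
      refine (alphaForm_mk x _ _ _ _).trans ?_
      change om q₀ (Z q₀) ((ν q₀).symm k.1) + 1 / 2 * (conj (0 : ℂ) * k.2).im +
        2 * s₀ * dTheta (Circle.exp r) (0 : EuclideanSpace ℝ (Fin 1)) = 0
      rw [hθ, hZ, map_zero]
      simp
    exact (congrArg (κ * ·) h1).trans (mul_zero _)
  have hω : omegaPrime om y (d k) (d (Complex.I • k)) =
      κ * (om q₀ ((ν q₀).symm k.1) ((ν q₀).symm (Complex.I • k.1)) +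
        (conj k.2 * (Complex.I * k.2)).im) :=
    omegaPrime_mfderiv_permExt hW hreg hf hx hZ hs hκ _ _ _ _
  have hJk : (ν q₀).symm (Complex.I • k.1) = J q₀ ((ν q₀).symm k.1) := by
    rw [LinearEquiv.symm_apply_eq, hνJ, LinearEquiv.apply_symm_apply]
  rw [hJk] at hω
  have him : (conj k.2 * (Complex.I * k.2)).im = Complex.normSq k.2 := by
    have h4 : conj k.2 * (Complex.I * k.2) = Complex.I * Complex.normSq k.2 := by
      rw [Complex.normSq_eq_conj_mul_self]
      ring
    rw [h4]
    simp
  rw [him] at hω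
  -- A kernel element gives `d k = i d(ik) - 2 w Z'` in the frame. Adding `2 Re w` times `Z'` to `d
  -- k` and `-2 Im w` times `Z'` to `d(ik)` makes the first vector `i` times the second without
  -- changing `ω'`. Tameness then gives the sign.
  have hle : omegaPrime om y (d k) (d (Complex.I • k)) ≤ 0 := by
    rw [← omegaPrime_add_smul_zPrime (Z := Z) hW.symplectic.alternating y (hdα k)
      (hdα (Complex.I • k)) (2 * w.re) (-(2 * w.im)), omegaPrime_swap hW.symplectic.alternating,
      neg_nonpos]
    refine omegaPrime_nonneg_of_stabFrame hJ hνJ y ?_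
    rw [map_add, map_add, map_smul, map_smul]
    have h' : (1 / 2 : ℂ) • (stabFrame ν y (d k) - Complex.I • stabFrame ν y (d (Complex.I • k))) +
      w • stabFrame ν y (zPrime Z y) = 0 := h
    have h2 : stabFrame ν y (d k) = Complex.I • stabFrame ν y (d (Complex.I • k)) -
        (2 * w) • stabFrame ν y (zPrime Z y) := by
      have h3 : stabFrame ν y (d k) - Complex.I • stabFrame ν y (d (Complex.I • k)) +
          (2 * w) • stabFrame ν y (zPrime Z y) = (2 : ℂ) • ((1 / 2 : ℂ) • (stabFrame ν y (d k) -
            Complex.I • stabFrame ν y (d (Complex.I • k))) + w • stabFrame ν y (zPrime Z y)) := by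
        module
      rw [h', smul_zero] at h3
      rw [eq_sub_iff_add_eq, ← sub_eq_zero, ← h3]
      abel
    rw [h2]
    have h5 : ∀ (a : ℝ) (v : ((Fin m → ℂ) × ℂ) × ℂ), a • v = (a : ℂ) • v := fun _ _ ↦ rfl
    rw [h5, h5]
    have h6 : (2 * w : ℂ) = ((2 * w.re : ℝ) : ℂ) + Complex.I * ((2 * w.im : ℝ) : ℂ) := by
      conv_lhs => rw [← Complex.re_add_im w]
      push_cast
      ring
    rw [h6]
    push_cast
    module
  -- Conformality makes the same number `κ` times `ω_F(e, Je) + |k.2|²`, where `e` is the vector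
  -- with frame coordinates `k.1`. This is positive unless `k = 0`; the Liouville coefficient must
  -- then vanish because `Z' ≠ 0`.
  have hk : k = 0 := by
    have h7 : 0 ≤ Complex.normSq k.2 := Complex.normSq_nonneg _
    by_cases he : (ν q₀).symm k.1 = 0
    · have hk1 : k.1 = 0 := (ν q₀).symm.map_eq_zero_iff.1 he
      have h8 : om q₀ ((ν q₀).symm k.1) (J q₀ ((ν q₀).symm k.1)) = 0 := by
        rw [he, map_zero]
        rfl
      rw [h8, zero_add] at hω
      have h9 : Complex.normSq k.2 ≤ 0 := by
        rw [hω] at hle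
        exact nonpos_of_mul_nonpos_right hle hκ0
      exact Prod.ext hk1 (Complex.normSq_eq_zero.1 (le_antisymm h9 h7))
    · exfalso
      have h8 : (0 : ℝ) < om q₀ ((ν q₀).symm k.1) (J q₀ ((ν q₀).symm k.1)) := hJ q₀ _ he
      rw [hω] at hle
      have h9 := nonpos_of_mul_nonpos_right hle hκ0
      linarith
  subst hk
  simp only [smul_zero, map_zero, sub_zero, zero_add] at h
  have hne : stabFrame ν y (zPrime Z y) ≠ 0 := fun h0 ↦
    zPrime_ne_zero hW hreg (permExt_mem f hxD)
      (stabFrame_injective ν y (h0.trans (map_zero _).symm))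
  rw [(smul_eq_zero.1 h).resolve_right hne]
  rfl

/-- A contact isotopy starting at the `k`-th power of the twist cannot end at the identity. -/
theorem eq_zero_of_contactIsotopic (hJ : IsTamed om J)
    (hν : Continuous (fun v : TangentBundle 𝓘(ℝ, E) F ↦ ν v.1 v.2))
    (hνJ : ∀ (q : F) (v : TangentSpace 𝓘(ℝ, E) q), ν q (J q v) = Complex.I • ν q v)
    (hq : mfderiv 𝓘(ℝ, E) 𝓘(ℝ, ℝ) psi q₀ = 0) (hZ : Z q₀ = 0) (hs : 0 < s₀) {k : ℤ}
    (h : ContactIsotopic (modelStab E) (xiStab om Z psi) (twistPerm hW hreg 1 1 ^ k) 1) : k = 0 := by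
  obtain ⟨Φ, hΦ, h0, h1, hc⟩ := h
  rw [twistPerm_zpow] at h0
  have h1' : Φ 1 = twistPerm hW hreg (0 : ℝ) 0 := by
    have h2 := twistPerm_zpow hW hreg 0
    rw [zpow_zero, Int.cast_zero] at h2
    rw [h1, h2]
  -- The conformal factor is read off from the angular vector, on which `α` equals `2 s₀`; this
  -- makes it continuous in both parameters.
  let κ : ℝ × ℝ → ℝ := fun p ↦
    alphaForm om Z (permExt hW.complete (Φ p.1) (q₀, 0, s₀, Circle.exp p.2))
      (mfderiv (modelStab E) (modelStab E) (permExt hW.complete (Φ p.1)) (q₀, 0, s₀, Circle.exp p.2)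
        ((0, 0, 0, mfderiv 𝓘(ℝ, ℝ) (𝓡 1) Circle.exp p.2 (1 : ℝ)) :
          E × ℂ × ℝ × EuclideanSpace ℝ (Fin 1))) / (2 * s₀)
  have hκc : ContinuousOn κ (Set.Icc (0 : ℝ) 1 ×ˢ Set.univ) :=
    ((continuous_alphaForm hW).comp_continuousOn
      (continuousOn_mfderiv_isotopy hW hreg hΦ hx (0, 0, 1))).div_const _
  have hα : ∀ r, alphaForm om Z (q₀, 0, s₀, Circle.exp r)
      ((0, 0, 0, mfderiv 𝓘(ℝ, ℝ) (𝓡 1) Circle.exp r (1 : ℝ)) :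
        E × ℂ × ℝ × EuclideanSpace ℝ (Fin 1)) = 2 * s₀ := by
    intro r
    refine (alphaForm_mk _ _ _ _ _).trans ?_
    have h2 : om q₀ (Z q₀) (0 : E) = 0 := (om q₀ (Z q₀)).map_zero
    have h3 := dTheta_mfderiv_circleExp r 1
    change om q₀ (Z q₀) (0 : E) + 1 / 2 * (conj (0 : ℂ) * 0).im + 2 * s₀ *
      dTheta (Circle.exp r) (mfderiv 𝓘(ℝ, ℝ) (𝓡 1) Circle.exp r (1 : ℝ)) = _
    rw [h2, h3]
    simp
  have hκ : ∀ t ∈ Set.Icc (0 : ℝ) 1, ∀ r,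
      ∀ v : TangentSpace (modelStab E) ((q₀, 0, s₀, Circle.exp r) : Stab F),
      alphaForm om Z (permExt hW.complete (Φ t) (q₀, 0, s₀, Circle.exp r))
        (mfderiv (modelStab E) (modelStab E) (permExt hW.complete (Φ t))
          (q₀, 0, s₀, Circle.exp r) v) =
        κ (t, r) * alphaForm om Z (q₀, 0, s₀, Circle.exp r) v := by
    intro t ht r
    obtain ⟨κ', hκ'⟩ := exists_conformal_factor hW hreg (hc t ht)
      (doubleCircle_subset_hitDomain hW.complete (hx (Circle.exp r)))
    have h2 : κ (t, r) = κ' := by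
      rw [div_eq_iff (by positivity)]
      exact (hκ' _).trans (congrArg (κ' * ·) (hα r))
    rw [h2]
    exact hκ'
  have hκne : ∀ t ∈ Set.Icc (0 : ℝ) 1, ∀ r, κ (t, r) ≠ 0 := fun t ht r ↦
    conformal_factor_ne_zero hW hreg (hΦ.1 t ht) (hx _) (hκ t ht r)
  have hκ1 : ∀ r, κ (1, r) = 1 := by
    intro r
    rw [div_eq_one_iff_eq (by positivity)]
    have hxr := hx (Circle.exp r)
    have h2 : mvfderiv (modelStab E) (psiPrime psi) ((q₀, 0, s₀, Circle.exp r) : Stab F)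
        ((0, 0, 0, mfderiv 𝓘(ℝ, ℝ) (𝓡 1) Circle.exp r (1 : ℝ)) :
        E × ℂ × ℝ × EuclideanSpace ℝ (Fin 1)) = 0 :=
      (mvfderiv_psiPrime_of_critical hW.morse.1 hq rfl _).trans (mul_zero _)
    have h3 := mfderiv_permExt_one hW hreg hxr h2
    have h4 := permExt_of_mem hW hreg (1 : Equiv.Perm (doubleCircle psi c)) ⟨_, hxr⟩
    refine Eq.trans ?_ (hα r)
    dsimp only
    rw [h1]
    exact alphaForm_congr h4 h3
  -- The factor has no zero and equals 1 at the identity, so the intermediate value theorem excludes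
  -- nonpositive values: the isotopy preserves the co-orientation.
  have hκpos : ∀ t ∈ Set.Icc (0 : ℝ) 1, ∀ r, 0 < κ (t, r) := by
    intro t ht r
    by_contra hneg
    have hcr : ContinuousOn (fun t ↦ κ (t, r)) (Set.Icc (0 : ℝ) 1) :=
      hκc.comp (by fun_prop) fun t ht ↦ ⟨ht, Set.mem_univ _⟩
    obtain ⟨t', ht', h0'⟩ := isPreconnected_Icc.intermediate_value ht
      (Set.right_mem_Icc.2 (zero_le_one' ℝ)) hcr ⟨not_lt.1 hneg, by
        simp only [hκ1]
        exact zero_le_one⟩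
    exact hκne t' ht' r h0'
  refine winding_eq_zero (D := fun p ↦ LinearMap.det
    (frameMap ν Z (permExt hW.complete (Φ p.1)) q₀ s₀ (Circle.exp p.2)))
    (continuousOn_linearMap_det (continuousOn_frameMap hW hreg hx hν hΦ)) ?_ ?_ hs ?_ ?_
  · intro t ht r hdet
    have hinj := frameMap_injective hW hreg hJ hνJ (hc t ht) (hx _) hZ hs.ne' (hκpos t ht r)
      (hκ t ht r)
    exact (LinearMap.bot_lt_ker_of_det_eq_zero hdet).ne' (LinearMap.ker_eq_bot.2 hinj)
  · intro t _ r
    dsimp only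
    rw [Circle.periodic_exp r]
  · intro r
    dsimp only
    rw [h0, frameMap_twistPerm hW hreg hx hq hZ]
  · intro r
    dsimp only
    rw [h1', frameMap_twistPerm hW hreg hx hq hZ, zpow_zero, Circle.coe_one, one_mul]

end Obstruction

end WeinsteinStab

open WeinsteinStab in
theorem theorem1 (m : ℕ) {F : Type*} [TopologicalSpace F] [T2Space F]
    [ChartedSpace (EuclideanSpace ℝ (Fin (2 * m))) F] [IsManifold (𝓡 (2 * m)) ∞ F]
    (om : ∀ q : F, TangentSpace (𝓡 (2 * m)) q →L[ℝ] TangentSpace (𝓡 (2 * m)) q →L[ℝ] ℝ)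
    (Z : ∀ q : F, TangentSpace (𝓡 (2 * m)) q) (psi : F → ℝ)
    (hW : IsWeinstein om Z psi)
    (J : ∀ q : F, TangentSpace (𝓡 (2 * m)) q →L[ℝ] TangentSpace (𝓡 (2 * m)) q)
    (hJ : IsAlmostComplex J) (hJtame : IsTamed om J) (hJtriv : IsComplexTrivial m J)
    (c : ℝ) (hmin : ∃ q, psi q < c)
    (hreg : IsRegularValueStab (EuclideanSpace ℝ (Fin (2 * m))) (psiStab psi) c) :
    ∃ Psi_c : Equiv.Perm (doubleCircle psi c),
      IsContactomorphism (modelStab (EuclideanSpace ℝ (Fin (2 * m)))) (xiStab om Z psi) Psi_c ∧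
      SmoothlyIsotopic (modelStab (EuclideanSpace ℝ (Fin (2 * m)))) (PsiMap psi c) Psi_c ∧
      ∀ k : ℤ, k ≠ 0 →
        ¬ ContactIsotopic (modelStab (EuclideanSpace ℝ (Fin (2 * m)))) (xiStab om Z psi)
          (Psi_c ^ k) 1 := by
  refine ⟨twistPerm hW hreg 1 1, ?_, ?_, fun k hk h ↦ hk ?_⟩
  · simpa using isContactomorphism_twistPerm hW hreg 1
  · rw [← twistPerm_zero_one hW hreg]
    exact smoothlyIsotopic_twistPerm hW hreg 1
  · obtain ⟨q₁, hq₁⟩ := hmin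
    obtain ⟨q₀, hle, hq, hZ⟩ := exists_critical_le hW q₁
    obtain ⟨ν, hν, hνJ⟩ := hJtriv
    have hpos : 0 < c - psi q₀ := by linarith
    -- Over the critical point with `z = 0`, the equation `ψ' = c` reads `s² = c - ψ_F(q₀)`; the
    -- positive root gives the base circle.
    have hx : ∀ u : Circle, ((q₀, 0, √(c - psi q₀), u) : Stab F) ∈ doubleCircle psi c := by
      intro u
      simp [doubleCircle, psiPrime, psiStab, Real.sq_sqrt hpos.le]
    exact eq_zero_of_contactIsotopic hW hreg hx hJtame hν hνJ hq hZ (Real.sqrt_pos.2 hpos) h
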